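/- Let $\mathcal O$ be a valuation ring (for example a discrete valuation ring) with algebraically closed residue field $K$, contained in an algebraically closed field $F$ of characteristic zero. Let $p\ge 1$, and let $\varepsilon\in\mathcal O$ be a primitive $p$th root of unity whose image in $K$ is again a primitive $p$th root of unity; its images in $F$ and $K$ are also written $\varepsilon$. Let $\kappa\ge 1$ and, for $1\le\alpha\le\kappa$, let $A^{(\alpha)}$ be an $\mathcal O$-algebra, free of finite rank as an $\mathcal O$-module, with an $\mathcal O$-algebra automorphism $\theta_\alpha$ such that $\theta_\alpha^p=1$. Put $A=A^{(1)}\otimes_{\mathcal O}\cdots\otimes_{\mathcal O}A^{(\kappa)}$ and $\theta=\theta_1\otimes\cdots\otimes\theta_\kappa$, write $A^{(\alpha)}_R=R\otimes_{\mathcal O}A^{(\alpha)}$ and $A_R=R\otimes_{\mathcal O}A=\bigotimes_\alpha A_R^{(\alpha)}$ for $R\in\{F,K\}$, and assume that $A_F$ is semisimple. Let the cyclic group $\mathbb Z_p$ of order $p$ act on each $A^{(\alpha)}$ and on $A$ (and on their scalar extensions), its fixed generator, also written $\theta$, acting by $\theta_\alpha$ and by $\theta_1\otimes\cdots\otimes\theta_\kappa$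 respectively. Crossed products are formed with the multiplication $(a\theta^k)(b\theta^m)=a\theta^k(b)\theta^{k+m}$, and modules are left modules. For a module $L$ of one of these algebras over $R\in\{F,K\}$ and $g\in\mathbb Z_p$, let $L^g$ be $L$ with $a$ acting as $g(a)$, and let $G_L=\{g\in\mathbb Z_p : L\cong L^g\}$ be the inertia group of $L$. If $L$ is simple, $l=|G_L|$ and $p=lk$, fix an isomorphism $\phi_L:L\to L^{\theta^k}$ with $\phi_L^l=1$. For $i\in\mathbb Z$ let $L_{l,i}$ be the module for the crossed product of the algebra with $G_L=\langle\theta^k\rangle$ which is $L$ as a vector space and on which $a\theta^{mk}$ acts as $v\mapsto\varepsilon^{mki}a\,\phi_L^m(v)$. If $H\le G_L$ is the subgroup of order $h$, then $L_{h,i}$ denotes the restriction of $L_{l,i}$ to the crossed product with $H$. Let $S^{(\alpha)}$ be a simple $A_F^{(\alpha)}$-module and $D^{(\alpha)}$ a simple $A_K^{(\alpha)}$-module for $1\le\alpha\le\kappa$, with fixed isomorphisms $\phi_{S^{(\alpha)}}$ and $\phi_{D^{(\alpha)}}$ as above. Let $S=S^{(1)}\otimes_F\cdots\otimes_F S^{(\kappa)}$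 and $D=D^{(1)}\otimes_K\cdots\otimes_K D^{(\kappa)}$, and let $s=|G_S|$, $d=|G_D|$, $G_0=G_S\cap G_D$ and $d_0=|G_0|$. Then $G_S\le G_{S^{(\alpha)}}$ and $G_D\le G_{D^{(\alpha)}}$ for all $\alpha$, and $S_{s,i}$ and $D_{d,j}$ are formed with $\phi_S=\bigotimes_\alpha\phi_{S^{(\alpha)}}^{|G_{S^{(\alpha)}}|/s}$ and $\phi_D=\bigotimes_\alpha\phi_{D^{(\alpha)}}^{|G_{D^{(\alpha)}}|/d}$. Let $B$ be one of the algebras $A^{(\alpha)}\rtimes G_0$, $A\rtimes G_0$, and $B_F$, $B_K$ the corresponding crossed products over $F$ and $K$. For a $B_F$-module $M$ and a simple $B_K$-module $E$, the decomposition number $[M:E]$ is the multiplicity of $E$ as a composition factor of $K\otimes_{\mathcal O}P$, where $P$ is a $B$-module that is free of finite rank over $\mathcal O$ with $F\otimes_{\mathcal O}P\cong M$ (a lattice of $M$). If $i,j\in\mathbb Z$ and the modules $S^{(\alpha)}_{d_0,i}$, $1\le\alpha\le\kappa$, have lattices, then $S_{s,i}{\downarrow}_{A_F\rtimes G_0}$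 has a lattice and, whatever the choice of all the lattices used to compute these numbers, $$\bigl[S_{s,i}{\downarrow}_{A_F\rtimes G_0}:D_{d,j}{\downarrow}_{A_K\rtimes G_0}\bigr]=\sum_{\substack{0\le j_1,\dots,j_\kappa<d_0\\ j_1+\dots+j_\kappa\equiv(\kappa-1)i+j\ (\mathrm{mod}\ d_0)}}\ \prod_{\alpha=1}^{\kappa}\bigl[S^{(\alpha)}_{d_0,i}:D^{(\alpha)}_{d_0,j_\alpha}\bigr].$$ -/

import Mathlib

open scoped TensorProduct

noncomputable section

namespace CliffordTensor

universe u

/-! ### Actions of the cyclic group of order `p` -/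

section Actions

variable {R : Type*} {A : Type*} [CommRing R] [Ring A] [Algebra R A] {p : ℕ}

/-- The action of `ℤ_p` (written multiplicatively, with generator `1 : ZMod p`) on an algebra `A`
in which the generator acts through the algebra automorphism `θ`, where `θ ^ p = 1`. -/
def cyclicAction (θ : A ≃ₐ[R] A) (hθ : θ ^ p = 1) :
    Multiplicative (ZMod p) →* (A ≃ₐ[R] A) :=
  AddMonoidHom.toMultiplicativeLeft
    (ZMod.lift p ⟨zmultiplesHom (Additive (A ≃ₐ[R] A)) (Additive.ofMul θ), by
      rw [zmultiplesHom_apply, natCast_zsmul, ← ofMul_pow, hθ, ofMul_one]⟩)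

theorem cyclicAction_gen (θ : A ≃ₐ[R] A) (hθ : θ ^ p = 1) :
    cyclicAction θ hθ (Multiplicative.ofAdd 1) = θ := by
  have h : ((1 : ℤ) : ZMod p) = 1 := by simp
  change Additive.toMul (ZMod.lift p _ (1 : ZMod p)) = θ
  rw [← h, ZMod.lift_coe]
  simp

variable {G : Type*} [Group G]

/-- The base change to `S` of an action by `R`-algebra automorphisms. -/
def baseAction (S : Type*) [CommRing S] [Algebra R S] (Θ : G →* (A ≃ₐ[R] A)) :
    G →* ((S ⊗[R] A) ≃ₐ[S] (S ⊗[R] A)) where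
  toFun g := Algebra.TensorProduct.congr AlgEquiv.refl (Θ g)
  map_one' := by
    ext x
    induction x using TensorProduct.induction_on with
    | zero => simp
    | tmul a b => simp
    | add a b ha hb => rw [map_add, map_add, ha, hb]
  map_mul' g h := by
    ext x
    induction x using TensorProduct.induction_on with
    | zero => simp
    | tmul a b => simp
    | add a b ha hb => rw [map_add, map_add, ha, hb]

theorem baseAction_tmul (S : Type*) [CommRing S] [Algebra R S] (Θ : G →* (A ≃ₐ[R] A))
    (g : G) (s : S) (a : A) : baseAction S Θ g (s ⊗ₜ a) = s ⊗ₜ Θ g a := rfl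

variable {ι : Type*} {B : ι → Type*} [∀ α, Ring (B α)] [∀ α, Algebra R (B α)]

/-- The tensor product of a family of algebra homomorphisms. -/
def tensorAlgHom (f : ∀ α, B α →ₐ[R] B α) : (⨂[R] α, B α) →ₐ[R] (⨂[R] α, B α) :=
  AlgHom.ofLinearMap (PiTensorProduct.map fun α => (f α).toLinearMap)
    (by
      rw [PiTensorProduct.one_def, PiTensorProduct.map_tprod]
      congr 1
      ext α
      simp)
    (by
      rw [LinearMap.map_mul_iff]
      ext x y
      simp only [LinearMap.compMultilinearMap_apply, LinearMap.compr₂_apply, LinearMap.mul_apply',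
        PiTensorProduct.tprod_mul_tprod, PiTensorProduct.map_tprod, LinearMap.compl₂_apply,
        LinearMap.comp_apply]
      congr 1
      ext α
      simp)

theorem tensorAlgHom_tprod (f : ∀ α, B α →ₐ[R] B α) (b : ∀ α, B α) :
    tensorAlgHom f (PiTensorProduct.tprod R b) = PiTensorProduct.tprod R fun α => f α (b α) :=
  PiTensorProduct.map_tprod _ _

/-- The diagonal action of `G` on a tensor product of algebras: `g` acts as
`Θ⁽¹⁾(g) ⊗ ⋯ ⊗ Θ⁽ᵏ⁾(g)`. -/
def diagonalAction (Θ : ∀ α, G →* (B α ≃ₐ[R] B α)) :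
    G →* ((⨂[R] α, B α) ≃ₐ[R] (⨂[R] α, B α)) where
  toFun g := AlgEquiv.ofAlgHom (tensorAlgHom fun α => (Θ α g).toAlgHom)
    (tensorAlgHom fun α => (Θ α g⁻¹).toAlgHom)
    (by
      apply AlgHom.toLinearMap_injective
      ext b
      simp [tensorAlgHom_tprod])
    (by
      apply AlgHom.toLinearMap_injective
      ext b
      simp [tensorAlgHom_tprod])
  map_one' := by
    apply AlgEquiv.coe_toAlgHom_injective
    apply AlgHom.toLinearMap_injective
    ext b
    simp [tensorAlgHom_tprod]
  map_mul' g h := by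
    apply AlgEquiv.coe_toAlgHom_injective
    apply AlgHom.toLinearMap_injective
    ext b
    simp [tensorAlgHom_tprod]

end Actions

/-! ### Crossed products `A ⋊ H` -/

section CrossedProducts

variable {R : Type*} {A : Type*} [CommRing R] [Ring A] [Algebra R A] {G : Type*} [Group G]

/-- The algebra `A ⋊ H`, for a subgroup `H` of a group `G` acting on `A` through `Θ`: its elements
are the formal sums `∑ a_g g` with `a_g ∈ A` and `g ∈ H`, multiplied by
`(a g) (b h) = a Θ_g(b) g h`. -/
def CrossedProduct (_Θ : G →* (A ≃ₐ[R] A)) (H : Subgroup G) : Type _ := SkewMonoidAlgebra A H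

/-- The action of the elements of `H` on `A`. -/
abbrev subgroupAction (Θ : G →* (A ≃ₐ[R] A)) (H : Subgroup G) : MulSemiringAction H A :=
  MulSemiringAction.compHom A (Θ.comp H.subtype)

theorem subgroupAction_smulCommClass (Θ : G →* (A ≃ₐ[R] A)) (H : Subgroup G) :
    letI := subgroupAction Θ H
    SMulCommClass H R A :=
  letI := subgroupAction Θ H
  ⟨fun g r a => map_smul (Θ g) r a⟩

instance (Θ : G →* (A ≃ₐ[R] A)) (H : Subgroup G) : Ring (CrossedProduct Θ H) :=
  @SkewMonoidAlgebra.instRing A H _ _ (subgroupAction Θ H)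

instance (Θ : G →* (A ≃ₐ[R] A)) (H : Subgroup G) : Algebra R (CrossedProduct Θ H) :=
  @SkewMonoidAlgebra.instAlgebraOfSMulCommClass R H _ _ A _ _ (subgroupAction Θ H)
    (subgroupAction_smulCommClass Θ H)

namespace CrossedProduct

variable {Θ : G →* (A ≃ₐ[R] A)} {H : Subgroup G}

/-- The element `a g` of `A ⋊ H`. -/
def of (a : A) (g : H) : CrossedProduct Θ H := SkewMonoidAlgebra.single g a

theorem of_mul_of (a b : A) (g h : H) :
    (of a g * of b h : CrossedProduct Θ H) = of (a * Θ g b) (g * h) :=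
  letI := subgroupAction Θ H
  SkewMonoidAlgebra.single_mul_single

theorem of_one : (of 1 1 : CrossedProduct Θ H) = 1 := rfl

theorem algebraMap_eq (r : R) :
    algebraMap R (CrossedProduct Θ H) r = of (algebraMap R A r) 1 := rfl

variable (Θ H) in
/-- The inclusion of `A` in `A ⋊ H`. -/
def ofAlg : A →ₐ[R] CrossedProduct Θ H where
  toFun a := of a 1
  map_one' := rfl
  map_mul' a b := by rw [of_mul_of]; simp
  map_zero' := SkewMonoidAlgebra.single_zero _
  map_add' a b := SkewMonoidAlgebra.single_add _ _ _
  commutes' _ := rfl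

variable (Θ H) in
/-- The inclusion of `H` in `A ⋊ H`. -/
def ofGroup : H →* CrossedProduct Θ H where
  toFun g := of 1 g
  map_one' := rfl
  map_mul' g h := by rw [of_mul_of]; simp

theorem ofGroup_mul_ofAlg (g : H) (a : A) :
    ofGroup Θ H g * ofAlg Θ H a = ofAlg Θ H (Θ g a) * ofGroup Θ H g := by
  change of 1 g * of a 1 = of (Θ g a) 1 * of 1 g
  rw [of_mul_of, of_mul_of]
  simp

/-- The homomorphism `A ⋊ H → B`, `a g ↦ f(a) T(g)`, attached to a covariant pair `(f, T)`. -/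
def lift {B : Type*} [Semiring B] [Algebra R B] (f : A →ₐ[R] B) (T : H →* B)
    (hfT : ∀ (g : H) (a : A), T g * f a = f (Θ g a) * T g) : CrossedProduct Θ H →ₐ[R] B :=
  letI := subgroupAction Θ H
  haveI := subgroupAction_smulCommClass Θ H
  SkewMonoidAlgebra.liftNCAlgHom f T (fun {a g} => (hfT g a).symm)

theorem lift_of {B : Type*} [Semiring B] [Algebra R B] (f : A →ₐ[R] B) (T : H →* B)
    (hfT : ∀ (g : H) (a : A), T g * f a = f (Θ g a) * T g) (a : A) (g : H) :
    lift f T hfT (of a g) = f a * T g :=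
  SkewMonoidAlgebra.liftNC_single _ _ _ _

/-- The inclusion `A ⋊ H' → A ⋊ H` for subgroups `H' ≤ H`. -/
def inclusion {H' H : Subgroup G} (h : H' ≤ H) : CrossedProduct Θ H' →ₐ[R] CrossedProduct Θ H :=
  lift (ofAlg Θ H) ((ofGroup Θ H).comp (Subgroup.inclusion h))
    (by exact fun g a => ofGroup_mul_ofAlg (Subgroup.inclusion h g) a)

theorem inclusion_of {H' H : Subgroup G} (h : H' ≤ H) (a : A) (g : H') :
    inclusion h (of a g : CrossedProduct Θ H') = of a (Subgroup.inclusion h g) := by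
  refine (lift_of _ _ _ a g).trans ?_
  change (of a 1 * of 1 (Subgroup.inclusion h g) : CrossedProduct Θ H) = _
  rw [of_mul_of]
  simp

end CrossedProduct

end CrossedProducts

/-! ### Modules, multiplicities of composition factors, inertia groups

A (left) module over an `R`-algebra `B` is given by its underlying `R`-module `V` and the algebra
homomorphism `ρ : B →ₐ[R] Module.End R V`. -/

section Modules

variable {R : Type*} [CommRing R]

/-- The `B`-module attached to `ρ : B →ₐ[R] Module.End R V`. -/
def AsModule {B V : Type*} [Ring B] [Algebra R B] [AddCommGroup V] [Module R V]
    (_ρ : B →ₐ[R] Module.End R V) : Type _ := V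

instance {B V : Type*} [Ring B] [Algebra R B] [AddCommGroup V] [Module R V]
    (ρ : B →ₐ[R] Module.End R V) : AddCommGroup (AsModule ρ) :=
  inferInstanceAs (AddCommGroup V)

instance {B V : Type*} [Ring B] [Algebra R B] [AddCommGroup V] [Module R V]
    (ρ : B →ₐ[R] Module.End R V) : Module B (AsModule ρ) :=
  Module.compHom V ρ.toRingHom

/-- `ρ` is an irreducible `B`-module. -/
abbrev IsIrreducible {B V : Type*} [Ring B] [Algebra R B] [AddCommGroup V] [Module R V]
    (ρ : B →ₐ[R] Module.End R V) : Prop := IsSimpleModule B (AsModule ρ)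

/-- The number of factors of a composition series of `M` that are isomorphic to `D`. -/
def factorCount {B M D : Type*} [Ring B] [AddCommGroup M] [Module B M] [AddCommGroup D]
    [Module B D] (s : CompositionSeries (Submodule B M)) : ℕ :=
  Nat.card {i : Fin s.length //
    Nonempty ((s i.succ ⧸ (s i.castSucc).submoduleOf (s i.succ)) ≃ₗ[B] D)}

/-- `D` occurs exactly `n` times as a composition factor of `M`. -/
def HasMultiplicity {B V W : Type*} [Ring B] [Algebra R B] [AddCommGroup V] [Module R V]
    [AddCommGroup W] [Module R W] (M : B →ₐ[R] Module.End R V) (D : B →ₐ[R] Module.End R W)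
    (n : ℕ) : Prop :=
  ∃ s : CompositionSeries (Submodule B (AsModule M)), s.head = ⊥ ∧ s.last = ⊤ ∧
    factorCount (D := AsModule D) s = n

/-- `ψ : V ≃ W` is an isomorphism from the module `ρ` to the module `σ`. -/
def IsModuleIso {B V W : Type*} [Ring B] [Algebra R B] [AddCommGroup V] [Module R V]
    [AddCommGroup W] [Module R W] (ρ : B →ₐ[R] Module.End R V) (σ : B →ₐ[R] Module.End R W)
    (ψ : V ≃ₗ[R] W) : Prop :=
  ∀ b v, ψ (ρ b v) = σ b (ψ v)

variable {A V : Type*} [Ring A] [Algebra R A] [AddCommGroup V] [Module R V]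

/-- The twist `L^t` of a module by an automorphism `t`: `a` acts on `L^t` as `t(a)` acts on `L`. -/
def twist (t : A ≃ₐ[R] A) (ρ : A →ₐ[R] Module.End R V) : A →ₐ[R] Module.End R V :=
  ρ.comp t.toAlgHom

/-- The inertia group `G_L = {g ∈ G | L ≅ L^g}`. -/
def inertiaGroup {G : Type*} [Group G] (Θ : G →* (A ≃ₐ[R] A)) (ρ : A →ₐ[R] Module.End R V) :
    Subgroup G where
  carrier := {g | ∃ ψ : V ≃ₗ[R] V, IsModuleIso ρ (twist (Θ g) ρ) ψ}
  one_mem' := ⟨LinearEquiv.refl R V, fun b v => by simp [twist]⟩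
  mul_mem' := by
    rintro g h ⟨ψ, hψ⟩ ⟨χ, hχ⟩
    refine ⟨χ.trans ψ, fun b v => ?_⟩
    have h1 := hχ b v
    have h2 := hψ (Θ h b) (χ v)
    simp only [twist, AlgHom.comp_apply] at h1 h2 ⊢
    rw [LinearEquiv.trans_apply, h1]
    exact h2.trans (by simp)
  inv_mem' := by
    rintro g ⟨ψ, hψ⟩
    refine ⟨ψ.symm, fun b v => ?_⟩
    have h1 := hψ (Θ g⁻¹ b) (ψ.symm v)
    rw [LinearEquiv.symm_apply_eq, twist] at *
    refine Eq.symm (h1.trans ?_)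
    simp

end Modules

/-! ### The modules `L_{l,i}` -/

section Extensions

variable {p : ℕ}

variable {R A V : Type*} [Field R] [Ring A] [Algebra R A] [AddCommGroup V] [Module R V]

/-- An isomorphism `φ : L → L^{θ^k}` with `φ ^ l = 1`, where `l = |G_L|` and `p = l k`, so that
`θ^k` generates the inertia group `G_L`. -/
structure InertiaIso (Θ : Multiplicative (ZMod p) →* (A ≃ₐ[R] A))
    (ρ : A →ₐ[R] Module.End R V) where
  φ : V ≃ₗ[R] V
  isModuleIso : IsModuleIso ρ (twist
    (Θ (Multiplicative.ofAdd 1 ^ (p / Nat.card (inertiaGroup Θ ρ)))) ρ) φ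
  pow_card : φ ^ Nat.card (inertiaGroup Θ ρ) = 1

theorem isModuleIso_pow {G : Type*} [Group G] {Θ : G →* (A ≃ₐ[R] A)}
    {ρ : A →ₐ[R] Module.End R V} {g : G} {φ : V ≃ₗ[R] V}
    (h : IsModuleIso ρ (twist (Θ g) ρ) φ) (n : ℕ) :
    IsModuleIso ρ (twist (Θ (g ^ n)) ρ) (φ ^ n) := by
  induction n with
  | zero => intro b v; simp [twist]
  | succ n ih =>
    intro b v
    have h1 := h b v
    have h2 := ih (Θ g b) (φ v)
    simp only [twist, AlgHom.comp_apply] at h1 h2 ⊢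
    rw [pow_succ, LinearEquiv.mul_apply, h1]
    refine h2.trans ?_
    rw [pow_succ, map_mul]
    rfl

theorem card_subgroup_dvd [NeZero p] (H : Subgroup (Multiplicative (ZMod p))) :
    Nat.card H ∣ p := by
  have h := Subgroup.card_subgroup_dvd_card H
  rwa [show Nat.card (Multiplicative (ZMod p)) = p from Nat.card_zmod p] at h

theorem div_card_dvd_val [NeZero p] (H : Subgroup (Multiplicative (ZMod p))) (g : H) :
    p / Nat.card H ∣ (Multiplicative.toAdd (g : Multiplicative (ZMod p))).val := by
  obtain ⟨k, hk⟩ := card_subgroup_dvd H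
  have hpos : 0 < Nat.card H := Nat.card_pos
  have h1 : (g : Multiplicative (ZMod p)) ^ Nat.card H = 1 := by
    have := pow_card_eq_one' (x := g)
    exact_mod_cast congrArg Subtype.val this
  have h2 : ((Nat.card H * (Multiplicative.toAdd (g : Multiplicative (ZMod p))).val : ℕ) :
      ZMod p) = 0 := by
    rw [Nat.cast_mul, ZMod.natCast_zmod_val, ← nsmul_eq_mul, ← toAdd_pow, h1, toAdd_one]
  rw [ZMod.natCast_eq_zero_iff] at h2
  have h3 : p / Nat.card H = k :=
    Nat.div_eq_of_eq_mul_right hpos hk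
  rw [h3]
  have h4 : Nat.card H * k ∣ Nat.card H *
      (Multiplicative.toAdd (g : Multiplicative (ZMod p))).val := hk ▸ h2
  exact Nat.dvd_of_mul_dvd_mul_left hpos h4

/-- The action of the inertia group `G_L = ⟨θ^k⟩` on `L_{l,i}`: the element `θ^{mk}` acts as
`ε^{mki} φ^m`. -/
def extensionGroupHom [NeZero p] {Θ : Multiplicative (ZMod p) →* (A ≃ₐ[R] A)}
    {ρ : A →ₐ[R] Module.End R V} {ε : R} (hε : ε ^ p = 1) (φ : InertiaIso Θ ρ) (i : ℤ) :
    inertiaGroup Θ ρ →* Module.End R V where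
  toFun g :=
    let n : ℕ := (Multiplicative.toAdd (g : Multiplicative (ZMod p))).val
    ε ^ ((n : ℤ) * i) • (φ.φ ^ (n / (p / Nat.card (inertiaGroup Θ ρ)))).toLinearMap
  map_one' := by
    ext v
    simp
  map_mul' g h := by
    obtain ⟨x, hx⟩ := div_card_dvd_val _ g
    obtain ⟨y, hy⟩ := div_card_dvd_val _ h
    obtain ⟨k, hk⟩ := card_subgroup_dvd (inertiaGroup Θ ρ)
    have hp : 0 < p := Nat.pos_of_ne_zero (NeZero.ne p)
    have hpos : 0 < Nat.card (inertiaGroup Θ ρ) := Nat.card_pos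
    have hkpos : 0 < k := Nat.pos_of_ne_zero (by rintro rfl; omega)
    have hdiv : p / Nat.card (inertiaGroup Θ ρ) = k :=
      Nat.div_eq_of_eq_mul_right hpos hk
    have hε0 : ε ≠ 0 := by
      rintro rfl
      rw [zero_pow hp.ne'] at hε
      exact zero_ne_one hε
    have hadd : (Multiplicative.toAdd ((g * h : inertiaGroup Θ ρ) :
        Multiplicative (ZMod p))).val = (k * x + k * y) % p := by
      rw [Subgroup.coe_mul, toAdd_mul, ZMod.val_add, hx, hy, hdiv]
    have hmod : (k * x + k * y) % p = k * ((x + y) % Nat.card (inertiaGroup Θ ρ)) := by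
      conv_lhs => rw [hk, mul_comm (Nat.card _) k, ← mul_add]
      exact Nat.mul_mod_mul_left _ _ _
    have hpow : ε ^ (((((k * x + k * y) % p : ℕ)) : ℤ) * i) =
        ε ^ (((k * x : ℕ) : ℤ) * i) * ε ^ (((k * y : ℕ) : ℤ) * i) := by
      rw [zpow_mul, zpow_natCast, ← pow_eq_pow_mod _ hε, ← zpow_natCast, ← zpow_mul,
        ← zpow_add₀ hε0]
      congr 1
      push_cast
      ring
    have hφ : φ.φ ^ ((x + y) % Nat.card (inertiaGroup Θ ρ)) = φ.φ ^ x * φ.φ ^ y := by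
      rw [← pow_eq_pow_mod _ φ.pow_card, pow_add]
    simp only [hadd, hpow]
    rw [hmod, hx, hy, hdiv, Nat.mul_div_cancel_left _ hkpos, Nat.mul_div_cancel_left _ hkpos,
      Nat.mul_div_cancel_left _ hkpos, hφ]
    ext v
    simp only [LinearMap.smul_apply, LinearEquiv.coe_coe, LinearEquiv.mul_apply,
      Module.End.mul_apply, map_smul, mul_smul]
    exact smul_comm _ _ _

/-- The `(A ⋊ G_L)`-module `L_{l,i}`: it is `L` as a vector space, and `a θ^{mk}` acts as
`v ↦ ε^{mki} a φ^m(v)`, where `l = |G_L|` and `p = l k`. -/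
def extension [NeZero p] {Θ : Multiplicative (ZMod p) →* (A ≃ₐ[R] A)}
    {ρ : A →ₐ[R] Module.End R V} {ε : R} (hε : ε ^ p = 1) (φ : InertiaIso Θ ρ) (i : ℤ) :
    CrossedProduct Θ (inertiaGroup Θ ρ) →ₐ[R] Module.End R V :=
  CrossedProduct.lift ρ (extensionGroupHom hε φ i) (by
    intro g a
    obtain ⟨x, hx⟩ := div_card_dvd_val _ g
    obtain ⟨k, hk⟩ := card_subgroup_dvd (inertiaGroup Θ ρ)
    have hp : 0 < p := Nat.pos_of_ne_zero (NeZero.ne p)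
    have hpos : 0 < Nat.card (inertiaGroup Θ ρ) := Nat.card_pos
    have hkpos : 0 < k := Nat.pos_of_ne_zero (by rintro rfl; omega)
    have hdiv : p / Nat.card (inertiaGroup Θ ρ) = k :=
      Nat.div_eq_of_eq_mul_right hpos hk
    have hg : (Multiplicative.ofAdd (1 : ZMod p) ^ (p / Nat.card (inertiaGroup Θ ρ))) ^ x =
        (g : Multiplicative (ZMod p)) := by
      rw [← pow_mul, ← hx, ← ofAdd_nsmul, nsmul_eq_mul, mul_one, ZMod.natCast_zmod_val,
        ofAdd_toAdd]
    have h := isModuleIso_pow φ.isModuleIso x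
    rw [hg] at h
    ext v
    have h1 := h a v
    simp only [twist, AlgHom.comp_apply] at h1
    simp only [extensionGroupHom, MonoidHom.coe_mk, OneHom.coe_mk, Module.End.mul_apply,
      LinearMap.smul_apply, LinearEquiv.coe_coe, map_smul]
    rw [hx, hdiv, Nat.mul_div_cancel_left _ hkpos, h1]
    rfl)

theorem extension_of [NeZero p] {Θ : Multiplicative (ZMod p) →* (A ≃ₐ[R] A)}
    {ρ : A →ₐ[R] Module.End R V} {ε : R} (hε : ε ^ p = 1) (φ : InertiaIso Θ ρ) (i : ℤ)
    (a : A) (m : ℕ) (g : inertiaGroup Θ ρ)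
    (hg : (g : Multiplicative (ZMod p)) =
      Multiplicative.ofAdd 1 ^ (m * (p / Nat.card (inertiaGroup Θ ρ)))) (v : V) :
    extension hε φ i (.of a g) v =
      ε ^ ((m : ℤ) * (p / Nat.card (inertiaGroup Θ ρ) : ℕ) * i) • ρ a ((φ.φ ^ m) v) := by
  obtain ⟨k, hk⟩ := card_subgroup_dvd (inertiaGroup Θ ρ)
  have hp : 0 < p := Nat.pos_of_ne_zero (NeZero.ne p)
  have hpos : 0 < Nat.card (inertiaGroup Θ ρ) := Nat.card_pos
  have hkpos : 0 < k := Nat.pos_of_ne_zero (by rintro rfl; omega)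
  have hdiv : p / Nat.card (inertiaGroup Θ ρ) = k :=
    Nat.div_eq_of_eq_mul_right hpos hk
  have hval : (Multiplicative.toAdd (g : Multiplicative (ZMod p))).val =
      k * (m % Nat.card (inertiaGroup Θ ρ)) := by
    rw [hg, hdiv, ← ofAdd_nsmul, toAdd_ofAdd, nsmul_eq_mul, mul_one, ZMod.val_natCast]
    conv_lhs => rw [hk, mul_comm (Nat.card _) k, mul_comm m k]
    exact Nat.mul_mod_mul_left _ _ _
  have hε' : ε ^ (((k * (m % Nat.card (inertiaGroup Θ ρ)) : ℕ) : ℤ) * i) =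
      ε ^ ((m : ℤ) * (k : ℕ) * i) := by
    rw [← Nat.mul_mod_mul_left, mul_comm k (Nat.card _), ← hk, zpow_mul, zpow_natCast,
      ← pow_eq_pow_mod _ hε, ← zpow_natCast, ← zpow_mul]
    congr 1
    push_cast
    ring
  rw [extension, CrossedProduct.lift_of]
  simp only [extensionGroupHom, MonoidHom.coe_mk, OneHom.coe_mk, Module.End.mul_apply,
      LinearMap.smul_apply, LinearEquiv.coe_coe, map_smul]
  rw [hval, hdiv, Nat.mul_div_cancel_left _ hkpos, ← pow_eq_pow_mod _ φ.pow_card, hε']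

end Extensions

/-! ### Outer tensor products of modules -/

section Tensor

variable {O R : Type*} [CommRing O] [Field R] [Algebra O R] {ι : Type*}
  {A : ι → Type*} [∀ α, Ring (A α)] [∀ α, Algebra O (A α)]
  {V : ι → Type*} [∀ α, AddCommGroup (V α)] [∀ α, Module R (V α)]

/-- The action of `⨂ A⁽ᵅ⁾` on `⨂ V⁽ᵅ⁾`. -/
def tensorAction (ρ : ∀ α, (R ⊗[O] A α) →ₐ[R] Module.End R (V α)) :
    (⨂[O] α, A α) →ₐ[O] Module.End R (⨂[R] α, V α) :=
  PiTensorProduct.liftAlgHom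
    { toFun := fun a => PiTensorProduct.map fun α => ρ α (1 ⊗ₜ a α)
      map_update_add' := by
        intro _ a β x y
        have h : ∀ z, (fun α => ρ α (1 ⊗ₜ Function.update a β z α)) =
            Function.update (fun α => ρ α (1 ⊗ₜ a α)) β (ρ β (1 ⊗ₜ z)) := fun z =>
          funext fun α => Function.apply_update (fun α b => ρ α (1 ⊗ₜ b)) a β z α
        rw [h, h, h, TensorProduct.tmul_add, map_add, PiTensorProduct.map_update_add]
      map_update_smul' := by
        intro _ a β c x
        have h : ∀ z, (fun α => ρ α (1 ⊗ₜ Function.update a β z α)) =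
            Function.update (fun α => ρ α (1 ⊗ₜ a α)) β (ρ β (1 ⊗ₜ z)) := fun z =>
          funext fun α => Function.apply_update (fun α b => ρ α (1 ⊗ₜ b)) a β z α
        have hc : (1 : R) ⊗ₜ[O] (c • x) = (algebraMap O R c) • ((1 : R) ⊗ₜ[O] x) := by
          rw [← TensorProduct.smul_tmul, TensorProduct.smul_tmul', Algebra.smul_def, smul_eq_mul]
        rw [h, h, hc, map_smul, PiTensorProduct.map_update_smul, algebraMap_smul] }
    (by
      change PiTensorProduct.map (fun α => ρ α (1 ⊗ₜ (1 : ∀ α, A α) α)) = 1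
      rw [← PiTensorProduct.map_one]
      congr 1
      ext1 α
      exact map_one (ρ α))
    (by
      intro a b
      change PiTensorProduct.map (fun α => ρ α (1 ⊗ₜ (a * b) α)) =
        PiTensorProduct.map (fun α => ρ α (1 ⊗ₜ a α)) *
          PiTensorProduct.map (fun α => ρ α (1 ⊗ₜ b α))
      rw [← PiTensorProduct.map_mul]
      congr 1
      ext1 α
      rw [← map_mul, Algebra.TensorProduct.tmul_mul_tmul, one_mul, Pi.mul_apply])

theorem tensorAction_commute (ρ : ∀ α, (R ⊗[O] A α) →ₐ[R] Module.End R (V α)) (r : R)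
    (x : ⨂[O] α, A α) :
    Commute (Algebra.ofId R (Module.End R (⨂[R] α, V α)) r) (tensorAction ρ x) :=
  Algebra.commutes r (tensorAction ρ x)

/-- The outer tensor product `V⁽¹⁾ ⊗ ⋯ ⊗ V⁽ᵏ⁾` of modules for the algebras
`A_R⁽ᵅ⁾ = R ⊗ A⁽ᵅ⁾`, as a module for `A_R = R ⊗ (A⁽¹⁾ ⊗ ⋯ ⊗ A⁽ᵏ⁾)`. -/
def tensorModule (ρ : ∀ α, (R ⊗[O] A α) →ₐ[R] Module.End R (V α)) :
    (R ⊗[O] (⨂[O] α, A α)) →ₐ[R] Module.End R (⨂[R] α, V α) :=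
  Algebra.TensorProduct.lift (Algebra.ofId R _) (tensorAction ρ) (tensorAction_commute ρ)

theorem tensorModule_tprod (ρ : ∀ α, (R ⊗[O] A α) →ₐ[R] Module.End R (V α))
    (r : R) (a : ∀ α, A α) (v : ∀ α, V α) :
    tensorModule ρ (r ⊗ₜ PiTensorProduct.tprod O a) (PiTensorProduct.tprod R v) =
      r • PiTensorProduct.tprod R fun α => ρ α (1 ⊗ₜ a α) (v α) := by
  have h : tensorAction ρ (PiTensorProduct.tprod O a) =
      PiTensorProduct.map fun α => ρ α (1 ⊗ₜ a α) := PiTensorProduct.lift.tprod _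
  rw [tensorModule, Algebra.TensorProduct.lift_tmul, h, Algebra.ofId_apply,
    Algebra.algebraMap_eq_smul_one, smul_mul_assoc, one_mul, LinearMap.smul_apply,
    PiTensorProduct.map_tprod]

section Inertia

variable {G : Type*} [Group G]

theorem baseAction_diagonalAction_tprod (Θ : ∀ α, G →* (A α ≃ₐ[O] A α)) (g : G) (r : R)
    (a : ∀ α, A α) :
    baseAction R (diagonalAction Θ) g (r ⊗ₜ PiTensorProduct.tprod O a) =
      r ⊗ₜ PiTensorProduct.tprod O fun α => Θ α g (a α) := by
  rw [baseAction_tmul]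
  congr 1
  exact tensorAlgHom_tprod _ _

/-- A semilinear endomorphism of an irreducible module that is not zero is an isomorphism. -/
theorem exists_isModuleIso {B W : Type*} [Ring B] [Algebra R B] [AddCommGroup W] [Module R W]
    {ρ : B →ₐ[R] Module.End R W} (hρ : IsIrreducible ρ) (t : B ≃ₐ[R] B) (h : W →ₗ[R] W)
    (hh : ∀ b v, h (ρ b v) = ρ (t b) (h v)) (h0 : h ≠ 0) :
    ∃ ψ : W ≃ₗ[R] W, IsModuleIso ρ (twist t ρ) ψ := by
  let N : Submodule B (AsModule ρ) :=
    { carrier := {v | h v = 0}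
      zero_mem' := map_zero h
      add_mem' := fun {x y} (hx : h x = 0) (hy : h y = 0) =>
        ((map_add h x y).trans (congrArg₂ (· + ·) hx hy)).trans (add_zero 0)
      smul_mem' := fun b x (hx : h x = 0) =>
        ((hh b x).trans (congrArg (ρ (t b)) hx)).trans (map_zero (ρ (t b))) }
  let M : Submodule B (AsModule ρ) :=
    { carrier := {v | ∃ w : W, h w = v}
      zero_mem' := ⟨0, map_zero h⟩
      add_mem' := by
        rintro _ _ ⟨x, rfl⟩ ⟨y, rfl⟩
        exact ⟨x + y, map_add h x y⟩
      smul_mem' := by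
        rintro b _ ⟨x, rfl⟩
        refine ⟨ρ (t.symm b) x, ?_⟩
        rw [hh, AlgEquiv.apply_symm_apply]
        rfl }
  have hN : N = ⊥ := by
    refine (eq_bot_or_eq_top N).resolve_right fun hT => h0 ?_
    ext v
    have hv : ∀ v' : AsModule ρ, v' ∈ N := fun v' => hT ▸ Submodule.mem_top
    exact hv v
  have hM : M = ⊤ := by
    refine (eq_bot_or_eq_top M).resolve_left fun hT => h0 ?_
    ext v
    have hv : ∀ v' : AsModule ρ, v' ∈ M → v' = 0 := fun v' hv' => by
      rw [hT] at hv'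
      exact (Submodule.mem_bot B).1 hv'
    exact hv (h v) ⟨v, rfl⟩
  refine ⟨LinearEquiv.ofBijective h ⟨?_, ?_⟩, hh⟩
  · rw [injective_iff_map_eq_zero]
    intro v hv
    have hv' : ∀ v' : AsModule ρ, v' ∈ N → v' = 0 := fun v' hv' => by
      rw [hN] at hv'
      exact (Submodule.mem_bot B).1 hv'
    exact hv' v hv
  · intro v
    have hv : ∀ v' : AsModule ρ, v' ∈ M := fun v' => hM ▸ Submodule.mem_top
    exact hv v

/-- The inertia group of an outer tensor product is contained in those of its factors. -/
theorem inertiaGroup_tensorModule_le [Finite ι] (Θ : ∀ α, G →* (A α ≃ₐ[O] A α))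
    {ρ : ∀ α, (R ⊗[O] A α) →ₐ[R] Module.End R (V α)} (hρ : ∀ α, IsIrreducible (ρ α)) (α : ι) :
    inertiaGroup (baseAction R (diagonalAction Θ)) (tensorModule ρ) ≤
      inertiaGroup (baseAction R (Θ α)) (ρ α) := by
  classical
  have := Fintype.ofFinite ι
  rintro g ⟨ψ, hψ⟩
  have hne : ∀ β, ∃ w : V β, w ≠ 0 := fun β => by
    have : Nontrivial (AsModule (ρ β)) := IsSimpleModule.nontrivial (R ⊗[O] A β) _
    exact exists_ne (0 : AsModule (ρ β))
  choose w hw using hne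
  let b : ∀ β, Module.Basis (Module.Basis.ofVectorSpaceIndex R (V β)) R (V β) :=
    fun β => Module.Basis.ofVectorSpace R (V β)
  have hw0 : PiTensorProduct.tprod R w ≠ 0 := by
    have hq : ∀ β, ∃ q, (b β).repr (w β) q ≠ 0 := fun β => by
      by_contra! hcon
      exact hw β ((b β).repr.map_eq_zero_iff.1 (Finsupp.ext hcon))
    choose q hq using hq
    intro h0
    have h1 := Basis.piTensorProduct_repr_tprod_apply b w q
    rw [h0, map_zero] at h1
    exact Finset.prod_ne_zero_iff.2 (fun β _ => hq β) h1.symm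
  have hy0 : ψ (PiTensorProduct.tprod R w) ≠ 0 := fun h0 => hw0 (ψ.map_eq_zero_iff.1 h0)
  obtain ⟨q, hq⟩ : ∃ q, (Basis.piTensorProduct b).repr (ψ (PiTensorProduct.tprod R w)) q ≠ 0 := by
    by_contra! hcon
    exact hy0 ((Basis.piTensorProduct b).repr.map_eq_zero_iff.1 (Finsupp.ext hcon))
  have hinj : Function.Injective (fun k => Function.update q α k) :=
    Function.update_injective q α
  let c : (⨂[R] β, V β) →ₗ[R] V α :=
    (b α).repr.symm.toLinearMap ∘ₗ Finsupp.lcomapDomain (fun k => Function.update q α k) hinj ∘ₗ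
      (Basis.piTensorProduct b).repr.toLinearMap
  have hcrepr : ∀ y k, (b α).repr (c y) k =
      (Basis.piTensorProduct b).repr y (Function.update q α k) := fun y k => by
    simp only [c, LinearMap.comp_apply, LinearEquiv.coe_coe, LinearEquiv.apply_symm_apply]
    rfl
  have hct : ∀ v, c (PiTensorProduct.tprod R v) =
      (∏ β ∈ Finset.univ.erase α, (b β).repr (v β) (q β)) • v α := fun v => by
    apply (b α).repr.injective
    ext k
    rw [hcrepr, Basis.piTensorProduct_repr_tprod_apply, map_smul, Finsupp.smul_apply, smul_eq_mul,
      ← Finset.mul_prod_erase _ _ (Finset.mem_univ α), Function.update_self, mul_comm]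
    congr 1
    refine Finset.prod_congr rfl fun β hβ => ?_
    rw [Function.update_of_ne (Finset.ne_of_mem_erase hβ)]
  let E : A α → R ⊗[O] (⨂[O] β, A β) := fun a =>
    1 ⊗ₜ PiTensorProduct.tprod O (Function.update 1 α a)
  have hE : ∀ a v, tensorModule ρ (E a) (PiTensorProduct.tprod R v) =
      PiTensorProduct.tprod R (Function.update v α (ρ α (1 ⊗ₜ a) (v α))) := fun a v => by
    rw [tensorModule_tprod, one_smul]
    congr 1
    funext β
    rcases eq_or_ne β α with rfl | hβ
    · simp
    · rw [Function.update_of_ne hβ, Function.update_of_ne hβ, Pi.one_apply,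
        ← Algebra.TensorProduct.one_def, map_one, Module.End.one_apply]
  have hcE : ∀ a y, c (tensorModule ρ (E a) y) = ρ α (1 ⊗ₜ a) (c y) := fun a y => by
    induction y using PiTensorProduct.induction_on with
    | smul_tprod r v =>
      rw [map_smul, map_smul, map_smul, map_smul, hE, hct, hct, Function.update_self, map_smul]
      congr 2
      refine Finset.prod_congr rfl fun β hβ => ?_
      rw [Function.update_of_ne (Finset.ne_of_mem_erase hβ)]
    | add x y hx hy => rw [map_add, map_add, map_add, map_add, hx, hy]
  have hgE : ∀ a, baseAction R (diagonalAction Θ) g (E a) = E (Θ α g a) := fun a => by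
    change baseAction R (diagonalAction Θ) g (1 ⊗ₜ _) = 1 ⊗ₜ _
    rw [baseAction_diagonalAction_tprod]
    congr 2
    funext β
    rcases eq_or_ne β α with rfl | hβ
    · simp
    · rw [Function.update_of_ne hβ, Function.update_of_ne hβ, Pi.one_apply, map_one]
  let h : V α →ₗ[R] V α :=
    c ∘ₗ ψ.toLinearMap ∘ₗ (PiTensorProduct.tprod R).toLinearMap w α
  have hdef : ∀ v, h v = c (ψ (PiTensorProduct.tprod R (Function.update w α v))) := fun _ => rfl
  have hh1 : ∀ a v, h (ρ α (1 ⊗ₜ a) v) = ρ α (1 ⊗ₜ Θ α g a) (h v) := fun a v => by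
    have h1 := hE a (Function.update w α v)
    rw [Function.update_self, Function.update_idem] at h1
    rw [hdef, hdef, ← h1, hψ]
    change c (tensorModule ρ (baseAction R (diagonalAction Θ) g (E a)) _) = _
    rw [hgE, hcE]
  refine exists_isModuleIso (hρ α) _ h (fun x v => ?_) (fun h0 => ?_)
  · induction x using TensorProduct.induction_on with
    | zero => simp
    | tmul r a =>
      have hr : ∀ a : A α, r ⊗ₜ[O] a = r • ((1 : R) ⊗ₜ[O] a) := fun a => by
        rw [TensorProduct.smul_tmul', smul_eq_mul, mul_one]
      rw [baseAction_tmul, hr, hr, map_smul, map_smul, LinearMap.smul_apply, LinearMap.smul_apply,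
        map_smul, hh1]
    | add x y hx hy =>
      rw [map_add, map_add, map_add, LinearMap.add_apply, LinearMap.add_apply, map_add, hx, hy]
  · have h1 : c (ψ (PiTensorProduct.tprod R w)) = 0 := by
      have h2 := hdef (w α)
      rw [Function.update_eq_self, h0] at h2
      exact h2.symm
    have h3 := hcrepr (ψ (PiTensorProduct.tprod R w)) (q α)
    rw [h1, Function.update_eq_self, map_zero] at h3
    exact hq h3.symm

end Inertia

/-- The isomorphism `φ = ⨂ (φ⁽ᵅ⁾)^{l_α / l}` defining the modules `L_{l,i}` for an outer tensor
product `L = ⨂ L⁽ᵅ⁾` of irreducible modules, where `l = |G_L|` and `l_α = |G_{L⁽ᵅ⁾}|`. -/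
def tensorInertiaIso [Finite ι] {p : ℕ} [NeZero p]
    {Θ : ∀ α, Multiplicative (ZMod p) →* (A α ≃ₐ[O] A α)}
    {ρ : ∀ α, (R ⊗[O] A α) →ₐ[R] Module.End R (V α)} (hρ : ∀ α, IsIrreducible (ρ α))
    (φ : ∀ α, InertiaIso (baseAction R (Θ α)) (ρ α)) :
    InertiaIso (baseAction R (diagonalAction Θ)) (tensorModule ρ) where
  φ := PiTensorProduct.congr fun α =>
    (φ α).φ ^ (Nat.card (inertiaGroup (baseAction R (Θ α)) (ρ α)) /
      Nat.card (inertiaGroup (baseAction R (diagonalAction Θ)) (tensorModule ρ)))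
  isModuleIso := by
    set s := Nat.card (inertiaGroup (baseAction R (diagonalAction Θ)) (tensorModule ρ)) with hs
    have key : ∀ α (a : A α) (v : V α),
        ((φ α).φ ^ (Nat.card (inertiaGroup (baseAction R (Θ α)) (ρ α)) / s))
          (ρ α (1 ⊗ₜ a) v) = ρ α (1 ⊗ₜ Θ α (Multiplicative.ofAdd 1 ^ (p / s)) a)
            (((φ α).φ ^ (Nat.card (inertiaGroup (baseAction R (Θ α)) (ρ α)) / s)) v) := by
      intro α a v
      have h := isModuleIso_pow (φ α).isModuleIso
        (Nat.card (inertiaGroup (baseAction R (Θ α)) (ρ α)) / s) (1 ⊗ₜ a) v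
      rw [← pow_mul, Nat.div_mul_div (card_subgroup_dvd _)
        (Subgroup.card_dvd_of_le (inertiaGroup_tensorModule_le Θ hρ α))] at h
      exact h
    intro x y
    induction x using TensorProduct.induction_on with
    | zero => simp
    | add x x' hx hx' =>
      rw [map_add, map_add, LinearMap.add_apply, LinearMap.add_apply, map_add, hx, hx']
    | tmul r a =>
      induction a using PiTensorProduct.induction_on with
      | add a a' ha ha' =>
        rw [TensorProduct.tmul_add, map_add, map_add, LinearMap.add_apply, LinearMap.add_apply,
          map_add, ha, ha']
      | smul_tprod c a =>
        rw [← TensorProduct.smul_tmul]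
        induction y using PiTensorProduct.induction_on with
        | add y y' hy hy' => rw [map_add, map_add, map_add, map_add, hy, hy']
        | smul_tprod d v =>
          rw [map_smul, map_smul, map_smul, map_smul]
          congr 1
          change _ = tensorModule ρ (baseAction R (diagonalAction Θ) _ _) _
          rw [baseAction_diagonalAction_tprod, PiTensorProduct.congr_tprod, tensorModule_tprod,
            tensorModule_tprod, map_smul, PiTensorProduct.congr_tprod]
          congr 2
          funext α
          exact key α _ _
  pow_card := by
    set s := Nat.card (inertiaGroup (baseAction R (diagonalAction Θ)) (tensorModule ρ)) with hs
    have key : ∀ (χ : ∀ α, V α ≃ₗ[R] V α) (n : ℕ) (v : ∀ α, V α),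
        ((PiTensorProduct.congr χ : (⨂[R] α, V α) ≃ₗ[R] (⨂[R] α, V α)) ^ n)
          (PiTensorProduct.tprod R v) = PiTensorProduct.tprod R fun α => (χ α ^ n) (v α) := by
      intro χ n
      induction n with
      | zero => intro v; simp
      | succ n ih =>
        intro v
        rw [pow_succ, LinearEquiv.mul_apply, PiTensorProduct.congr_tprod, ih]
        simp only [pow_succ, LinearEquiv.mul_apply]
    apply LinearEquiv.toLinearMap_injective
    ext v
    refine (key _ s v).trans ?_
    simp only [← pow_mul]
    congr 1
    funext α
    rw [Nat.div_mul_cancel (Subgroup.card_dvd_of_le (inertiaGroup_tensorModule_le Θ hρ α)),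
      (φ α).pow_card]
    rfl

end Tensor

theorem algebraMap_pow_eq_one {O : Type*} [CommRing O] {ε : O} {p : ℕ} (hε : IsPrimitiveRoot ε p)
    (R : Type*) [CommRing R] [Algebra O R] : algebraMap O R ε ^ p = 1 := by
  rw [← map_pow, hε.pow_eq_one, map_one]

/-! ### Modular reduction and decomposition numbers -/

section Decomposition

variable {O : Type u} [CommRing O] {A : Type*} [Ring A] [Algebra O A] {G : Type*} [Group G]
  {Θ : G →* (A ≃ₐ[O] A)} {H : Subgroup G}

theorem baseModule_commute (R : Type*) [CommRing R] [Algebra O R] {P : Type*} [AddCommGroup P]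
    [Module O P] (τ : CrossedProduct Θ H →ₐ[O] Module.End O P) (r : R) (a : A) :
    Commute (Algebra.ofId R (Module.End R (R ⊗[O] P)) r)
      (((Module.End.baseChangeHom O R P).comp (τ.comp (CrossedProduct.ofAlg Θ H))) a) :=
  Algebra.commutes r _

/-- The action of `R ⊗ A` on `R ⊗ P` for an `(A ⋊ H)`-module `P` over `O`. -/
def baseModuleAlg (R : Type*) [CommRing R] [Algebra O R] {P : Type*} [AddCommGroup P] [Module O P]
    (τ : CrossedProduct Θ H →ₐ[O] Module.End O P) :
    (R ⊗[O] A) →ₐ[R] Module.End R (R ⊗[O] P) :=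
  Algebra.TensorProduct.lift (Algebra.ofId R _)
    ((Module.End.baseChangeHom O R P).comp (τ.comp (CrossedProduct.ofAlg Θ H)))
    (baseModule_commute R τ)

theorem baseModuleAlg_tmul (R : Type*) [CommRing R] [Algebra O R] {P : Type*} [AddCommGroup P]
    [Module O P] (τ : CrossedProduct Θ H →ₐ[O] Module.End O P) (r : R) (a : A) (s : R) (x : P) :
    baseModuleAlg R τ (r ⊗ₜ a) (s ⊗ₜ x) = (r * s) ⊗ₜ τ (CrossedProduct.ofAlg Θ H a) x := by
  rw [baseModuleAlg, Algebra.TensorProduct.lift_tmul, Algebra.ofId_apply,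
    Algebra.algebraMap_eq_smul_one, smul_mul_assoc, one_mul, LinearMap.smul_apply]
  rfl

/-- The action of `H` on `R ⊗ P` for an `(A ⋊ H)`-module `P` over `O`. -/
def baseModuleGroup (R : Type*) [CommRing R] [Algebra O R] {P : Type*} [AddCommGroup P]
    [Module O P] (τ : CrossedProduct Θ H →ₐ[O] Module.End O P) :
    H →* Module.End R (R ⊗[O] P) where
  toFun g := (τ (CrossedProduct.ofGroup Θ H g)).baseChange R
  map_one' := by
    rw [map_one, map_one, LinearMap.baseChange_one]
  map_mul' g h := by
    rw [map_mul, map_mul, LinearMap.baseChange_mul]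

theorem baseModuleGroup_mul (R : Type*) [CommRing R] [Algebra O R] {P : Type*} [AddCommGroup P]
    [Module O P] (τ : CrossedProduct Θ H →ₐ[O] Module.End O P) (g : H) (b : R ⊗[O] A) :
    baseModuleGroup R τ g * baseModuleAlg R τ b =
      baseModuleAlg R τ (baseAction R Θ g b) * baseModuleGroup R τ g := by
  induction b using TensorProduct.induction_on with
  | zero => simp
  | add x y hx hy => rw [map_add, map_add, map_add, mul_add, add_mul, hx, hy]
  | tmul r a =>
    have h0 : ∀ x : P, τ (CrossedProduct.ofGroup Θ H g) (τ (CrossedProduct.ofAlg Θ H a) x) =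
        τ (CrossedProduct.ofAlg Θ H (Θ g a)) (τ (CrossedProduct.ofGroup Θ H g) x) := fun x => by
      rw [← Module.End.mul_apply, ← Module.End.mul_apply, ← map_mul, ← map_mul,
        CrossedProduct.ofGroup_mul_ofAlg]
    refine LinearMap.ext fun z => ?_
    induction z using TensorProduct.induction_on with
    | zero => rw [map_zero, map_zero]
    | add x y hx hy => rw [map_add, map_add, hx, hy]
    | tmul s x =>
      rw [Module.End.mul_apply, Module.End.mul_apply, baseModuleAlg_tmul, baseAction_tmul]
      change _ = baseModuleAlg R τ (r ⊗ₜ Θ g a) (s ⊗ₜ τ (CrossedProduct.ofGroup Θ H g) x)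
      rw [baseModuleAlg_tmul]
      change (r * s) ⊗ₜ τ (CrossedProduct.ofGroup Θ H g) _ = _
      rw [h0]

/-- For an `(A ⋊ H)`-module `P` over `O`, the `((R ⊗ A) ⋊ H)`-module `R ⊗ P`. -/
def baseModule (R : Type*) [CommRing R] [Algebra O R] {P : Type*} [AddCommGroup P] [Module O P]
    (τ : CrossedProduct Θ H →ₐ[O] Module.End O P) :
    CrossedProduct (baseAction R Θ) H →ₐ[R] Module.End R (R ⊗[O] P) :=
  CrossedProduct.lift (baseModuleAlg R τ) (baseModuleGroup R τ) (baseModuleGroup_mul R τ)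

theorem baseModule_of (R : Type*) [CommRing R] [Algebra O R] {P : Type*} [AddCommGroup P]
    [Module O P] (τ : CrossedProduct Θ H →ₐ[O] Module.End O P) (r : R) (a : A) (g : H) (s : R)
    (x : P) :
    baseModule R τ (.of (r ⊗ₜ a) g) (s ⊗ₜ x) = (r * s) ⊗ₜ τ (.of a g) x := by
  have h : (CrossedProduct.of a g : CrossedProduct Θ H) =
      CrossedProduct.ofAlg Θ H a * CrossedProduct.ofGroup Θ H g := by
    change CrossedProduct.of a g = CrossedProduct.of a 1 * CrossedProduct.of 1 g
    rw [CrossedProduct.of_mul_of]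
    simp
  rw [baseModule, CrossedProduct.lift_of, h, map_mul]
  exact baseModuleAlg_tmul R τ r a s (τ (CrossedProduct.ofGroup Θ H g) x)

/-- `n` is the decomposition number `[M : D]`: the module `M` of `A_F ⋊ H` has a lattice `P`,
that is, an `(A ⋊ H)`-module which is free of finite rank over `O` with `F ⊗ P ≅ M`, such that the
`(A_K ⋊ H)`-module `D` occurs exactly `n` times as a composition factor of the modular
reduction `K ⊗ P`. Here `A_F = F ⊗ A` and `A_K = K ⊗ A`. -/
def IsDecompositionNumber {F K : Type*} [Field F] [Field K] [Algebra O F] [Algebra O K]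
    {V W : Type*} [AddCommGroup V] [Module F V] [AddCommGroup W] [Module K W]
    (M : CrossedProduct (baseAction F Θ) H →ₐ[F] Module.End F V)
    (D : CrossedProduct (baseAction K Θ) H →ₐ[K] Module.End K W) (n : ℕ) : Prop :=
  ∃ (P : Type u) (_ : AddCommGroup P) (_ : Module O P)
    (τ : CrossedProduct Θ H →ₐ[O] Module.End O P),
    Module.Free O P ∧ Module.Finite O P ∧
    (∃ ψ : (F ⊗[O] P) ≃ₗ[F] V, IsModuleIso (baseModule F τ) M ψ) ∧
    HasMultiplicity (baseModule K τ) D n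

end Decomposition

end CliffordTensor
end

open scoped TensorProduct

noncomputable section

namespace CliffordTensor

universe w

/-! ### Irreducible modules over finite-dimensional algebras -/

section Irreducible

/-! Write `H` for `G₀`. The idea is to detect composition factors by explicit elements of the
crossed product and to read multiplicities off characteristic polynomials, which behave well under
reduction and under tensor products.

Let `L` be a simple `A_K`-module with a covariant action `T` of `H`, and let `E` be a projection of
rank one on `L`. By Burnside's theorem the algebra contains elements `u_k`, for `k ∈ H`, acting on
`L` as `E T(k)⁻¹`. Multiplying them by an element that acts as `1` on `L` and annihilates the kernel
of `L` modulo the radical removes their effect on all other simple modules. For a character `χ` of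
`H` put `e_χ = |H|⁻¹ ∑ χ(k)⁻¹ u_k k`. By orthogonality `e_χ` acts as `E` on the twist of `L` by `χ`
and as zero on the other twists, and a simple module on which `e_χ` is not zero is that twist
(`MatrixUnits.nonempty_equiv`). In a basis adapted to a composition series of `M`, all the `e_χ` are
triangular with diagonal entries `0` and `1`, and the entries `1` count the factors isomorphic to
the twist. So the multiplicity is that of the root `1` of the characteristic polynomial of `e_χ` on
`M` (`MatrixUnits.hasMultiplicity_iff`).

This gives independence of the lattice at once: an element of the reduced crossed product lifts to
`O`, and the characteristic polynomial of the lift on a lattice of `M` is determined over `F`, into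
which `O` embeds (`charpoly_baseModule_eq`).

For `D = ⨂ D⁽ᵅ⁾` take `u_k = ⨂ u_k⁽ᵅ⁾`. The relations among the `u_k⁽ᵅ⁾` hold only modulo radicals,
so the radical of each factor has to act as zero on the simple modules of the crossed product of the
tensor product (`CrossedSystem.of_mem_jacobson`). The `e_χ` are not tensor products, but Fourier
inversion in each factor, `u_k k = ∑ χ_l(k) e_{χ_l}`, expands them. The tensor product of lattices
of the `S⁽ᵅ⁾_{d₀,i}` carries the character `χ_i` to the power `κ`, and a twist by the exponent
`-(κ-1)i` makes it a lattice of the restriction of `S_{s,i}`. On its reduction, `e_{χ_j}` is the sum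
of the operators `⨂ e_{χ_{l_α}}` over the tuples with `∑ l_α ≡ (κ-1)i + j`
(`baseChangePi_tensorLattice_projector`). In the tensor product of triangular bases these operators
are triangular, and no two of them have an entry `1` at the same place, so the multiplicity of the
root `1` of their sum is the sum of the products of the multiplicities (`rootMultiplicity_sum_map`).
-/

/-- For a two-sided ideal `I` of an Artinian ring there is an element `c` that is `1` modulo `I`
and annihilates `I` on both sides modulo the Jacobson radical. -/
theorem exists_one_sub_mem_mul_mem_jacobson {A : Type*} [Ring A] [IsArtinianRing A] (I : Ideal A)
    [I.IsTwoSided] :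
    ∃ c : A, 1 - c ∈ I ∧ ∀ a ∈ I, a * c ∈ Ring.jacobson A ∧ c * a ∈ Ring.jacobson A := by
  have hss : IsSemisimpleModule A (A ⧸ Ring.jacobson A) :=
    (IsArtinian.isSemisimpleModule_iff_jacobson A _).2 (Module.jacobson_quotient_jacobson A A)
  -- Split `1 = f + (1 - f)` along `I` and a left complement `N` modulo the radical. Then `I (1 -
  -- f)` lies in both summands, hence in the radical.
  obtain ⟨N, hN⟩ := exists_isCompl (Submodule.map (Ring.jacobson A).mkQ I)
  have h1 : (Ring.jacobson A).mkQ 1 ∈ Submodule.map (Ring.jacobson A).mkQ I ⊔ N := by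
    rw [hN.sup_eq_top]; trivial
  obtain ⟨_, ⟨f, hf, rfl⟩, y, hy, hfy⟩ := Submodule.mem_sup.1 h1
  have hfI : f ∈ I := hf
  have hmem : ∀ z ∈ I, (Ring.jacobson A).mkQ z ∈ N → z ∈ Ring.jacobson A := fun z hz hzN => by
    have h := (Submodule.mem_bot A).1 (hN.disjoint.le_bot ⟨Submodule.mem_map_of_mem hz, hzN⟩)
    exact (Submodule.Quotient.mk_eq_zero _).1 h
  have hc : (Ring.jacobson A).mkQ (1 - f) ∈ N := by
    rw [map_sub, ← hfy, add_sub_cancel_left]; exact hy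
  have hleft : ∀ a ∈ I, a * (1 - f) ∈ Ring.jacobson A := fun a ha => by
    refine hmem _ (I.mul_mem_right _ ha) ?_
    rw [← smul_eq_mul, map_smul]
    exact N.smul_mem a hc
  refine ⟨1 - f, by simpa using hfI, fun a ha => ⟨hleft a ha, ?_⟩⟩
  -- The complement is only a left ideal, so `z = (1 - f) a` needs its own argument: `z A z` lies in
  -- the radical, and if `z ∉ m` then `1 = r z + i` with `i ∈ m` gives `z = z r z + z i ∈ m`.
  rw [Ring.jacobson_eq_sInf_isMaximal, Submodule.mem_sInf]
  intro m hm
  have hm' : Ideal.IsMaximal m := hm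
  by_contra hz
  obtain ⟨r, i, hi, hr⟩ := Ideal.IsMaximal.exists_inv hm' hz
  set z := (1 - f) * a with hzdef
  have h2 : z * r * z ∈ m := by
    apply Ring.jacobson_le_of_isMaximal m
    have : z * r * z = (1 - f) * ((a * r * (1 - f)) * a) := by rw [hzdef]; noncomm_ring
    rw [this]
    exact Ideal.mul_mem_left _ _ (Ideal.mul_mem_right _ _ (hleft _ (I.mul_mem_right _ ha)))
  apply hz
  have h3 : z = z * r * z + z * i := by rw [mul_assoc, ← mul_add, hr, mul_one]
  rw [h3]
  exact Ideal.add_mem m h2 (Ideal.mul_mem_left m _ hi)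

variable {R B V : Type*} [CommRing R] [Ring B] [Algebra R B] [AddCommGroup V] [Module R V]

instance (ρ : B →ₐ[R] Module.End R V) : Module R (AsModule ρ) := inferInstanceAs (Module R V)

instance (ρ : B →ₐ[R] Module.End R V) : IsScalarTower R B (AsModule ρ) where
  smul_assoc r b v := LinearMap.congr_fun (map_smul ρ r b) v

/-- Burnside's theorem. -/
theorem IsIrreducible.surjective {K A V : Type*} [Field K] [IsAlgClosed K] [Ring A] [Algebra K A]
    [AddCommGroup V] [Module K V] [FiniteDimensional K V] {ρ : A →ₐ[K] Module.End K V}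
    (hρ : IsIrreducible ρ) : Function.Surjective ρ := by
  intro f
  have : IsSimpleModule A (AsModule ρ) := hρ
  have : FiniteDimensional K (AsModule ρ) := inferInstanceAs (FiniteDimensional K V)
  have hbij := IsSimpleModule.algebraMap_end_bijective_of_isAlgClosed (A := A) (V := AsModule ρ) K
  -- By Schur's lemma the endomorphisms of the simple module are scalars, so every linear `f`
  -- commutes with them and the density theorem realizes `f` on a basis.
  let F : Module.End (Module.End A (AsModule ρ)) (AsModule ρ) :=
    { toFun := f
      map_add' := f.map_add
      map_smul' := fun g v => by
        obtain ⟨c, rfl⟩ := hbij.2 g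
        exact f.map_smul c v }
  classical
  let b := Module.finBasis K V
  obtain ⟨r, hr⟩ := jacobson_density (R := A) (M := AsModule ρ) F
    (Finset.univ.image (fun i => (b i : AsModule ρ)))
  exact ⟨r, b.ext fun i => (hr (b i) (Finset.mem_image_of_mem _ (Finset.mem_univ i))).symm⟩

theorem IsIrreducible.finiteDimensional {K A V : Type*} [Field K] [Ring A] [Algebra K A]
    [FiniteDimensional K A] [AddCommGroup V] [Module K V] {ρ : A →ₐ[K] Module.End K V}
    (hρ : IsIrreducible ρ) : FiniteDimensional K V := by
  have : IsSimpleModule A (AsModule ρ) := hρ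
  have : Module.Finite K (AsModule ρ) := Module.Finite.trans A _
  exact this

theorem IsIrreducible.exists_ne_zero {R A V : Type*} [CommRing R] [Ring A] [Algebra R A]
    [AddCommGroup V] [Module R V] {ρ : A →ₐ[R] Module.End R V}
    (hρ : IsIrreducible ρ) : ∃ v : V, v ≠ 0 := by
  have : Nontrivial (AsModule ρ) := IsSimpleModule.nontrivial A _
  exact exists_ne (0 : AsModule ρ)

end Irreducible

/-! ### Triangular operators -/

section Triangular

open Polynomial

variable {K V J : Type*} [Field K] [AddCommGroup V] [Module K V]

/-- The matrix of `f` in the basis `b` is triangular for the ranking `r` of the basis, with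
diagonal entries `t`. -/
def IsTriangular (b : Module.Basis J K V) (r : J → ℕ) (f : Module.End K V) (t : J → K) : Prop :=
  (∀ i j, i ≠ j → r j ≤ r i → b.repr (f (b j)) i = 0) ∧ ∀ j, b.repr (f (b j)) j = t j

/-- Several basis vectors may share a rank: the matrix is block triangular for the ranking, and the
weak inequality in `IsTriangular` makes each block of constant rank diagonal. -/
theorem IsTriangular.charpoly [Fintype J] [FiniteDimensional K V] {b : Module.Basis J K V}
    {r : J → ℕ} {f : Module.End K V} {t : J → K} (h : IsTriangular b r f t) :
    f.charpoly = ∏ j, (X - C (t j)) := by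
  classical
  rw [← LinearMap.charpoly_toMatrix f b]
  have hM : ∀ i j, LinearMap.toMatrix b b f i j = b.repr (f (b j)) i := fun i j =>
    LinearMap.toMatrix_apply _ _ _ _ _
  have hT : (LinearMap.toMatrix b b f).BlockTriangular r := fun i j hij => by
    rw [hM]; exact h.1 i j (fun h => by simp [h] at hij) hij.le
  rw [hT.charpoly, ← Finset.prod_fiberwise_of_maps_to (s := Finset.univ)
    (t := Finset.univ.image r) (g := r) (fun j _ => Finset.mem_image_of_mem _ (Finset.mem_univ j))]
  refine Finset.prod_congr rfl fun a _ => ?_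
  have hd : (LinearMap.toMatrix b b f).toSquareBlock r a = Matrix.diagonal fun j => t j.1 := by
    ext i j
    rw [Matrix.toSquareBlock_def, Matrix.of_apply, hM, Matrix.diagonal_apply]
    split_ifs with hij
    · rw [hij, h.2]
    · exact h.1 _ _ (fun h => hij (Subtype.ext h)) (by rw [i.2, j.2])
  rw [hd, Matrix.charpoly_diagonal, ← Finset.prod_subtype (p := fun j => r j = a)
    (f := fun j => X - C (t j))]
  simp

theorem IsTriangular.rootMultiplicity [Fintype J] [FiniteDimensional K V]
    {b : Module.Basis J K V} {r : J → ℕ} {f : Module.End K V} {t : J → K} [DecidableEq K]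
    (h : IsTriangular b r f t) (x : K) :
    f.charpoly.rootMultiplicity x = (Finset.univ.filter fun j => t j = x).card := by
  have h1 : ∏ j, (X - C (t j)) = ((Finset.univ.val.map t).map fun a => X - C a).prod := by
    rw [Multiset.map_map]; rfl
  rw [h.charpoly, ← count_roots, h1, roots_multiset_prod_X_sub_C, Multiset.count_map]
  simp only [eq_comm (a := x)]
  rfl

end Triangular

/-! ### Systems of generators of crossed products -/

section System

variable {R : Type*} {A : Type*} [CommRing R] [Ring A] [Algebra R A] {G : Type*} [Group G]

/-- The structure of a crossed product `A ⋊ H` on an algebra `B`: additive maps `a ↦ a g`, whose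
images generate `B`, with the multiplication of a crossed product. -/
structure CrossedSystem (Θ : G →* (A ≃ₐ[R] A)) (H : Subgroup G) (B : Type*) [Ring B]
    [Algebra R B] where
  of : H → A →+ B
  of_mul_of : ∀ g h a b, of g a * of h b = of (g * h) (a * Θ g b)
  of_one : of 1 1 = 1
  algebraMap_eq : ∀ r, algebraMap R B r = of 1 (algebraMap R A r)
  closure_eq_top : AddSubmonoid.closure {b | ∃ g a, of g a = b} = ⊤

variable {Θ : G →* (A ≃ₐ[R] A)} {H : Subgroup G}

namespace CrossedSystem

variable {B : Type*} [Ring B] [Algebra R B] (c : CrossedSystem Θ H B)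

@[elab_as_elim]
theorem induction {motive : B → Prop} (b : B) (of : ∀ g a, motive (c.of g a))
    (add : ∀ x y, motive x → motive y → motive (x + y)) : motive b := by
  have hb : b ∈ AddSubmonoid.closure {b | ∃ g a, c.of g a = b} := c.closure_eq_top ▸ trivial
  induction hb using AddSubmonoid.closure_induction with
  | mem x hx => obtain ⟨g, a, rfl⟩ := hx; exact of g a
  | zero => simpa using of 1 0
  | add x y _ _ hx hy => exact add x y hx hy

theorem smul_of (r : R) (g : H) (a : A) : r • c.of g a = c.of g (r • a) := by
  rw [Algebra.smul_def, c.algebraMap_eq, c.of_mul_of, one_mul, Algebra.smul_def]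
  simp

theorem of_eq_mul (g : H) (a : A) : c.of g a = c.of 1 a * c.of g 1 := by
  rw [c.of_mul_of]; simp

theorem algHom_ext {C : Type*} [Semiring C] [Algebra R C] {f g : B →ₐ[R] C}
    (h : ∀ k a, f (c.of k a) = g (c.of k a)) : f = g := by
  ext b
  induction b using c.induction with
  | of k a => exact h k a
  | add x y hx hy => rw [map_add, map_add, hx, hy]

end CrossedSystem

variable (Θ H) in
/-- The generators `a g` of `A ⋊ H`. -/
def CrossedProduct.system : CrossedSystem Θ H (CrossedProduct Θ H) where
  of g :=
    { toFun := fun a => of a g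
      map_zero' := SkewMonoidAlgebra.single_zero _
      map_add' := fun _ _ => SkewMonoidAlgebra.single_add _ _ _ }
  of_mul_of g h a b := of_mul_of a b g h
  of_one := rfl
  algebraMap_eq _ := rfl
  closure_eq_top := by
    rw [AddSubmonoid.eq_top_iff']
    intro b
    refine SkewMonoidAlgebra.induction_on (p := fun b => b ∈ AddSubmonoid.closure _) b
      (AddSubmonoid.zero_mem _) (fun g a => ?_) (fun _ _ hx hy => AddSubmonoid.add_mem _ hx hy)
    exact AddSubmonoid.subset_closure ⟨g, a, rfl⟩

theorem CrossedProduct.system_of (g : H) (a : A) :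
    (CrossedProduct.system Θ H).of g a = CrossedProduct.of a g := rfl

end System

/-! ### Twisted extensions of a module to a crossed product -/

section TwistedModule

variable {K A V G B : Type*} [CommRing K] [Ring A] [Algebra K A] [AddCommGroup V] [Module K V]
  [CommGroup G] [Ring B] [Algebra K B] {Θ : G →* (A ≃ₐ[K] A)} {H : Subgroup G}

/-- `τ` is the extension of the module `ρ` to the crossed product in which `H` acts through `T`
twisted by the character `χ`. -/
def IsTwistedExtension (c : CrossedSystem Θ H B) (ρ : A →ₐ[K] Module.End K V)
    (T : H →* Module.End K V) (χ : H →* K) (τ : B →ₐ[K] Module.End K V) : Prop :=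
  ∀ g a, τ (c.of g a) = χ g • (ρ a * T g)

variable (Θ H) in
/-- Elements of `A` that act, on a module `ρ` with a covariant action `T` of `H`, as matrix units
translated by `H`, together with the relations they satisfy modulo the ideal `J`. -/
structure MatrixUnits (ρ : A →ₐ[K] Module.End K V) (T : H →* Module.End K V) (J : Ideal A) where
  vec : V
  coord : V →ₗ[K] K
  coord_vec : coord vec = 1
  elem : H → A
  lift : V →ₗ[K] A
  apply_elem : ∀ k v, ρ (elem k) v = coord (T k⁻¹ v) • vec
  apply_lift : ∀ v, ρ (lift v) vec = v
  mul_elem : ∀ x k, x * elem k - lift (ρ x vec) * elem k ∈ J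
  action_elem : ∀ h k : H, Θ h (elem k) - lift (T h vec) * elem (h * k) ∈ J
  exists_apply_eq : ∀ v, v ≠ 0 → ∃ y, ρ y v = vec

namespace MatrixUnits

variable {ρ : A →ₐ[K] Module.End K V} {T : H →* Module.End K V} {J : Ideal A} [Fintype H]
  (u : MatrixUnits Θ H ρ T J) (c : CrossedSystem Θ H B)

/-- The element of `A ⋊ H` that acts as a projection of rank one on the twist by `χ` and
annihilates all other simple modules, where `ν = 1 / |H|`. -/
def projector (ν : K) (χ : H →* K) : B :=
  ∑ k : H, c.of k ((ν * χ k⁻¹) • u.elem k)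

/-- Orthogonality of characters: `χ⁻¹ψ` is a homomorphism to a domain, so its sum over `H` vanishes
unless it is trivial. -/
theorem sum_char_inv_mul [IsDomain K] {ν : K} (hν : ν * Fintype.card H = 1) (χ ψ : H →* K)
    [Decidable (χ = ψ)] :
    ∑ k : H, ν * χ k⁻¹ * ψ k = if χ = ψ then 1 else 0 := by
  classical
  let f : H →* K := (χ.comp (invMonoidHom (α := H))) * ψ
  have hf : ∀ k, f k = χ k⁻¹ * ψ k := fun k => rfl
  have hχ : ∀ k, χ k⁻¹ * χ k = 1 := fun k => by rw [← map_mul]; simp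
  have h1 : f = 1 ↔ χ = ψ := by
    constructor
    · intro h
      ext k
      have h2 := DFunLike.congr_fun h k
      rw [hf, MonoidHom.one_apply] at h2
      have h3 : χ k⁻¹ ≠ 0 := left_ne_zero_of_mul_eq_one (hχ k)
      exact mul_left_cancel₀ h3 ((hχ k).trans h2.symm)
    · rintro rfl
      ext k
      rw [hf, hχ, MonoidHom.one_apply]
  have h2 := sum_hom_units f
  simp only [hf] at h2
  simp_rw [mul_assoc, ← Finset.mul_sum, h2, h1]
  split_ifs
  · exact hν
  · simp

/-- With `E v = coord v • vec`, the element `u_k k` acts on the twist by `ψ` as `ψ(k) E T(k)⁻¹ T(k)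
= ψ(k) E`; orthogonality does the rest. -/
theorem apply_projector [IsDomain K] {ν : K} (hν : ν * Fintype.card H = 1) (χ : H →* K)
    {ψ : H →* K} [Decidable (χ = ψ)] {τ : B →ₐ[K] Module.End K V}
    (hτ : IsTwistedExtension c ρ T ψ τ) (v : V) :
    τ (u.projector c ν χ) v = if χ = ψ then u.coord v • u.vec else 0 := by
  have h : ∀ k : H, (τ (c.of k ((ν * χ k⁻¹) • u.elem k))) v =
      (ν * χ k⁻¹ * ψ k) • u.coord v • u.vec := fun k => by
    rw [hτ, map_smul, LinearMap.smul_apply, smul_mul_assoc, LinearMap.smul_apply,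
      Module.End.mul_apply, u.apply_elem, ← Module.End.mul_apply (T k⁻¹), ← map_mul,
      inv_mul_cancel, map_one, Module.End.one_apply, smul_smul, mul_comm (ψ k)]
  rw [projector, map_sum, LinearMap.sum_apply]
  simp_rw [h, ← Finset.sum_smul, sum_char_inv_mul hν χ ψ]
  split_ifs <;> simp

section Simple

variable {E : Type*} [AddCommGroup E] [Module B E]

/-- By `mul_elem`, left multiplication of every `u_k` by `y` depends, modulo `J`, only on the vector
`ρ y vec`, and `J` acts as zero. -/
theorem of_smul_projector_smul (hJ : ∀ x ∈ J, ∀ e : E, c.of 1 x • e = 0)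
    (ν : K) (χ : H →* K) (y : A) (v : E) :
    c.of 1 y • u.projector c ν χ • v =
      c.of 1 (u.lift (ρ y u.vec)) • u.projector c ν χ • v := by
  rw [← sub_eq_zero, ← sub_smul, ← map_sub, ← mul_smul, projector, Finset.mul_sum,
    Finset.sum_smul]
  refine Finset.sum_eq_zero fun k _ => ?_
  rw [c.of_mul_of, one_mul, c.of_eq_mul, mul_smul]
  apply hJ
  rw [OneMemClass.coe_one, map_one, AlgEquiv.one_apply, mul_smul_comm, sub_mul,
    Algebra.smul_def]
  exact Ideal.mul_mem_left _ _ (u.mul_elem y k)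

/-- Here `h u_k k = Θ_h(u_k) h k`, and `action_elem` replaces `Θ_h(u_k)` by `lift (T h vec) u_{hk}`;
reindexing by `k ↦ h k` brings out the factor `χ(h)`. -/
theorem group_smul_projector_smul (hJ : ∀ x ∈ J, ∀ e : E, c.of 1 x • e = 0)
    (ν : K) (χ : H →* K) (h : H) (v : E) :
    c.of h 1 • u.projector c ν χ • v =
      c.of 1 (χ h • u.lift (T h u.vec)) • u.projector c ν χ • v := by
  have h1 : c.of 1 (χ h • u.lift (T h u.vec)) * u.projector c ν χ =
      ∑ k : H, c.of (h * k) ((ν * χ k⁻¹) • (u.lift (T h u.vec) * u.elem (h * k))) := by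
    rw [projector, Finset.mul_sum, ← Equiv.sum_comp (Equiv.mulLeft h)]
    refine Finset.sum_congr rfl fun k _ => ?_
    have h2 : χ h * χ h⁻¹ = 1 := by rw [← map_mul]; simp
    rw [Equiv.coe_mulLeft, c.of_mul_of, one_mul, OneMemClass.coe_one, map_one,
      AlgEquiv.one_apply, smul_mul_smul_comm, mul_inv, map_mul]
    congr 2
    linear_combination (ν * χ k⁻¹) * h2
  rw [← sub_eq_zero, ← mul_smul, ← mul_smul, ← sub_smul, h1, projector, Finset.mul_sum,
    ← Finset.sum_sub_distrib, Finset.sum_smul]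
  refine Finset.sum_eq_zero fun k _ => ?_
  rw [c.of_mul_of, one_mul, ← map_sub, c.of_eq_mul, mul_smul]
  apply hJ
  rw [map_smul, ← smul_sub, Algebra.smul_def]
  exact Ideal.mul_mem_left _ _ (u.action_elem h k)

/-- A simple module that is not annihilated by the projector attached to `χ` is the twist of `ρ`
by `χ`. -/
theorem nonempty_equiv (hT : ∀ (g : H) a, T g * ρ a = ρ (Θ g a) * T g) [IsSimpleModule B E]
    (hJ : ∀ x ∈ J, c.of 1 x ∈ Ring.jacobson B)
    (ν : K) {χ : H →* K} {τ : B →ₐ[K] Module.End K V} (hτ : IsTwistedExtension c ρ T χ τ)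
    (v : E) (hv : u.projector c ν χ • v ≠ 0) :
    Nonempty (E ≃ₗ[B] AsModule τ) := by
  have hJ' : ∀ x ∈ J, ∀ e : E, c.of 1 x • e = 0 := fun x hx =>
    Module.mem_annihilator.1 (IsSemisimpleModule.jacobson_le_annihilator _ E (hJ x hx))
  set w := u.projector c ν χ • v with hw
  have K1 := fun y => u.of_smul_projector_smul c hJ' ν χ y v
  have K2 := fun h => u.group_smul_projector_smul c hJ' ν χ h v
  rw [← hw] at K1 K2
  have hof : ∀ (y : A) (h : H) (x : V), c.of 1 (u.lift (τ (c.of h y) x)) • w =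
      c.of h y • c.of 1 (u.lift x) • w := fun y h x => by
    have h1 : ρ (y * Θ h (u.lift x) * (χ h • u.lift (T h u.vec))) u.vec = τ (c.of h y) x := by
      rw [hτ, mul_smul_comm, map_smul, LinearMap.smul_apply,
        LinearMap.smul_apply, map_mul, map_mul, Module.End.mul_apply, u.apply_lift,
        Module.End.mul_apply, ← Module.End.mul_apply (ρ (Θ h (u.lift x))), ← hT,
        Module.End.mul_apply, u.apply_lift, Module.End.mul_apply]
    rw [← h1, ← K1, ← mul_smul (c.of h y), c.of_mul_of, mul_one, c.of_eq_mul h (_ * _),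
      mul_smul, K2, ← mul_smul (c.of 1 _) (c.of 1 _) w, c.of_mul_of, mul_one]
    simp
  have hlin : ∀ (b : B) (x : V), c.of 1 (u.lift (τ b x)) • w = b • c.of 1 (u.lift x) • w :=
    fun b x => by
    induction b using c.induction with
    | add b d hb hd => rw [map_add, LinearMap.add_apply, map_add, map_add, add_smul, add_smul,
        hb, hd]
    | of h y => exact hof y h x
  -- The two preceding relations make `x ↦ lift x • w` linear over the crossed product. It maps
  -- `vec` to `w ≠ 0`, and every nonzero `x` can be moved to `vec`, so the map is injective;
  -- simplicity of `E` gives surjectivity.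
  let f : AsModule τ →ₗ[B] E :=
    { toFun := fun x => c.of 1 (u.lift x) • w
      map_add' := fun x y => by
        have h : ∀ x y : V, c.of 1 (u.lift (x + y)) • w =
            c.of 1 (u.lift x) • w + c.of 1 (u.lift y) • w := fun x y => by
          rw [map_add, map_add, add_smul]
        exact h x y
      map_smul' := hlin }
  have hfv : f u.vec = w := by
    have h := K1 1
    rw [c.of_one, one_smul, map_one, Module.End.one_apply] at h
    exact h.symm
  have hinj : Function.Injective f := by
    rw [injective_iff_map_eq_zero]
    intro x hx
    by_contra hx0
    obtain ⟨y, hy⟩ := u.exists_apply_eq x hx0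
    have h1 : c.of 1 y • x = u.vec := by
      refine (LinearMap.congr_fun (hτ 1 y) x).trans ?_
      rw [map_one, map_one, one_smul, mul_one]
      exact hy
    apply hv
    rw [← hfv, ← h1, map_smul, hx, smul_zero]
  have hsurj : Function.Surjective f := by
    rw [← LinearMap.range_eq_top]
    refine (eq_bot_or_eq_top (LinearMap.range f)).resolve_left fun h => hv ?_
    have h2 : f u.vec ∈ LinearMap.range f := ⟨_, rfl⟩
    rw [h, Submodule.mem_bot, hfv] at h2
    exact h2
  exact ⟨(LinearEquiv.ofBijective f ⟨hinj, hsurj⟩).symm⟩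

end Simple

end MatrixUnits

end TwistedModule

/-! ### Elements in the radical of a crossed product -/

section Radical

theorem apply_mem_jacobson {A : Type*} [Ring A] (e : A ≃+* A) {a : A} (ha : a ∈ Ring.jacobson A) :
    e a ∈ Ring.jacobson A :=
  haveI : RingHomSurjective (e : A →+* A) := ⟨e.surjective⟩
  Ring.le_comap_jacobson (e : A →+* A) ha

/-- If `A` is generated, as a vector space, by products of elements of `f(A')` with elements
centralizing `f(A')`, then `f` maps the radical of `A'` into the radical of `A ⋊ H`. -/
theorem CrossedSystem.of_mem_jacobson {K A A' G B : Type*} [CommRing K] [Ring A] [Algebra K A]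
    [Ring A'] [Algebra K A'] [IsArtinianRing A'] [Group G] [Ring B] [Algebra K B]
    {Θ : G →* (A ≃ₐ[K] A)} {Θ' : G →* (A' ≃ₐ[K] A')} {H : Subgroup G} (c : CrossedSystem Θ H B)
    (f : A' →ₐ[K] A) (hf : ∀ g a, Θ g (f a) = f (Θ' g a))
    (hgen : ∀ x : A, x ∈ Submodule.span K {x | ∃ a z, (∀ b, Commute (f b) z) ∧ x = f a * z})
    {a : A'} (ha : a ∈ Ring.jacobson A') : c.of 1 (f a) ∈ Ring.jacobson B := by
  rw [Ring.jacobson_eq_sInf_isMaximal, Submodule.mem_sInf]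
  intro m hm
  have hm' : Ideal.IsMaximal m := hm
  have hE : IsSimpleModule B (B ⧸ m) :=
    isSimpleModule_iff_isCoatom.2 (Ideal.isMaximal_def.1 hm')
  have : Nontrivial (B ⧸ m) := IsSimpleModule.nontrivial B _
  -- The vectors killed by `f(rad A')` form a submodule: on generators, `f(a)` passes `f(a') z` as
  -- `z f(a a')`, and passing `h` applies `Θ'(h⁻¹)`, which preserves the radical.
  let N : Submodule B (B ⧸ m) :=
    { carrier := {v | ∀ a ∈ Ring.jacobson A', c.of 1 (f a) • v = 0}
      zero_mem' := fun a _ => smul_zero _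
      add_mem' := fun hv hw a ha => by rw [smul_add, hv a ha, hw a ha, add_zero]
      smul_mem' := fun b v hv a ha => by
        induction b using c.induction with
        | add b d hb hd => rw [add_smul, smul_add, hb, hd, add_zero]
        | of h x =>
          have hx := hgen x
          induction hx using Submodule.span_induction with
          | zero => rw [map_zero, zero_smul, smul_zero]
          | add x y _ _ hx hy => rw [map_add, add_smul, smul_add, hx, hy, add_zero]
          | smul r x _ hx =>
            rw [← mul_smul] at hx ⊢
            rw [← c.smul_of, mul_smul_comm, Algebra.smul_def, mul_smul, hx, smul_zero]
          | mem x hx =>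
            obtain ⟨a', z, hz, rfl⟩ := hx
            have h1 : f a * (f a' * z) = z * Θ h (f (Θ' (h⁻¹ : H) (a * a'))) := by
              rw [← mul_assoc, ← map_mul, (hz _).eq, hf, ← AlgEquiv.mul_apply, ← map_mul]
              simp
            rw [← mul_smul, c.of_mul_of, OneMemClass.coe_one, map_one, AlgEquiv.one_apply, h1,
              one_mul]
            have h2 : c.of h (z * Θ h (f (Θ' (h⁻¹ : H) (a * a')))) =
                c.of h z * c.of 1 (f (Θ' (h⁻¹ : H) (a * a'))) := by
              rw [c.of_mul_of, mul_one]
            rw [h2, mul_smul, hv, smul_zero]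
            exact apply_mem_jacobson (Θ' (h⁻¹ : H)).toRingEquiv (Ideal.mul_mem_right _ _ ha) }
  -- The radical of `A'` is nilpotent. If `n + 1` is the least exponent whose power acts as zero, a
  -- nonzero vector `f(a) v` with `a` in the `n`-th power lies in `N`.
  have hN : N ≠ ⊥ := by
    classical
    have hex : ∃ n, ∀ a ∈ Ring.jacobson A' ^ n, ∀ v : B ⧸ m, c.of 1 (f a) • v = 0 := by
      obtain ⟨n, hn⟩ := IsSemiprimaryRing.isNilpotent (R := A')
      refine ⟨n, fun a ha v => ?_⟩
      rw [hn] at ha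
      rw [(Submodule.mem_bot _).1 ha, map_zero, map_zero, zero_smul]
    obtain ⟨v₀, hv₀⟩ := exists_ne (0 : B ⧸ m)
    have hspec := Nat.find_spec hex
    obtain ⟨n, hn⟩ : ∃ n, Nat.find hex = n + 1 := by
      refine Nat.exists_eq_succ_of_ne_zero fun h0 => hv₀ ?_
      have h1 := hspec 1 (by rw [h0, Submodule.pow_zero, Ideal.one_eq_top]; trivial) v₀
      rwa [map_one, c.of_one, one_smul] at h1
    have hlt := Nat.find_min hex (m := n) (by omega)
    push Not at hlt
    obtain ⟨a, ha, v, hav⟩ := hlt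
    intro hbot
    have hmem : c.of 1 (f a) • v ∈ N := fun b hb => by
      rw [← mul_smul, c.of_mul_of, OneMemClass.coe_one, map_one, AlgEquiv.one_apply, mul_one,
        ← map_mul]
      refine hspec _ ?_ v
      rw [hn, Ideal.IsTwoSided.pow_succ]
      exact Ideal.mul_mem_mul hb ha
    rw [hbot] at hmem
    exact hav ((Submodule.mem_bot _).1 hmem)
  have htop := (eq_bot_or_eq_top N).resolve_left hN
  have h1 : (Submodule.Quotient.mk (1 : B) : B ⧸ m) ∈ N := htop ▸ Submodule.mem_top
  have h2 := h1 a ha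
  rw [← Submodule.Quotient.mk_smul, Submodule.Quotient.mk_eq_zero, smul_eq_mul, mul_one] at h2
  exact h2

end Radical

/-! ### Existence of matrix units -/

section Existence

variable {K A V G : Type*} [CommRing K] [Ring A] [Algebra K A] [AddCommGroup V]
  [Module K V] [CommGroup G] {Θ : G →* (A ≃ₐ[K] A)} {H : Subgroup G}

theorem ker_apply {ρ : A →ₐ[K] Module.End K V} {T : H →* Module.End K V}
    (hT : ∀ (g : H) a, T g * ρ a = ρ (Θ g a) * T g) (g : H) {a : A} (ha : ρ a = 0) :
    ρ (Θ g a) = 0 := by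
  have h1 : T g * T g⁻¹ = 1 := by rw [← map_mul]; simp
  rw [← mul_one (ρ (Θ g a)), ← h1, ← mul_assoc, ← hT, ha, mul_zero, zero_mul]

/-- The section gives preimages `e_k` of the required operators of rank one, for which the relations
hold modulo `ker ρ`. The element `c` attached to the ideal `ker ρ` turns membership in `ker ρ` into
membership in the radical, so `u_k = c e_k` works. -/
theorem MatrixUnits.nonempty_of_section [IsArtinianRing A] {ρ : A →ₐ[K] Module.End K V}
    {T : H →* Module.End K V}
    (hT : ∀ (g : H) a, T g * ρ a = ρ (Θ g a) * T g)
    (s : Module.End K V →ₗ[K] A) (hs : ∀ f, ρ (s f) = f) (vec : V) (coord : V →ₗ[K] K)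
    (hvec : coord vec = 1) (hex : ∀ v : V, v ≠ 0 → ∃ f : Module.End K V, f v = vec) :
    Nonempty (MatrixUnits Θ H ρ T (Ring.jacobson A)) := by
  obtain ⟨c, hc1, hc⟩ := exists_one_sub_mem_mul_mem_jacobson (RingHom.ker ρ)
  replace hc1 : ρ (1 - c) = 0 := hc1
  replace hc : ∀ a, ρ a = 0 → a * c ∈ Ring.jacobson A ∧ c * a ∈ Ring.jacobson A := hc
  have hρc : ρ c = 1 := by
    rw [map_sub, map_one, sub_eq_zero] at hc1; exact hc1.symm
  -- This expresses that `c` is central modulo the radical: `z c e` may be replaced by `c (z e)`.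
  have hzce : ∀ z e, ρ (z * e) = 0 → z * (c * e) ∈ Ring.jacobson A := fun z e hze => by
    have h1 : z * (c * e) = c * (z * e) - c * (z * (1 - c)) * e + (1 - c) * z * c * e := by
      noncomm_ring
    rw [h1]
    refine add_mem (sub_mem (hc _ hze).2 (Ideal.mul_mem_right _ _ (hc _ ?_).2))
      (Ideal.mul_mem_right _ _ (hc _ ?_).1)
    · rw [map_mul, hc1, mul_zero]
    · rw [map_mul, hc1, zero_mul]
  let e : H → A := fun k => s ((coord ∘ₗ T k⁻¹).smulRight vec)
  have he : ∀ k v, ρ (c * e k) v = coord (T k⁻¹ v) • vec := fun k v => by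
    rw [map_mul, hρc, one_mul, hs]; rfl
  have hlift : ∀ v, ρ (s (coord.smulRight v)) vec = v := fun v => by
    rw [hs, LinearMap.smulRight_apply, hvec, one_smul]
  refine ⟨⟨vec, coord, hvec, fun k => c * e k,
    s ∘ₗ (LinearMap.smulRightₗ coord), he, hlift, fun x k => ?_, fun h k => ?_, fun v hv => ?_⟩⟩
  · rw [← sub_mul]
    refine hzce _ _ (LinearMap.ext fun v => ?_)
    have h1 : ρ (e k) v = coord (T k⁻¹ v) • vec := by rw [hs]; rfl
    rw [map_mul, Module.End.mul_apply, h1, map_smul, map_sub, LinearMap.sub_apply]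
    change coord (T k⁻¹ v) • (ρ x vec - ρ (s (coord.smulRight (ρ x vec))) vec) = 0
    rw [hlift, sub_self, smul_zero]
  · change Θ h (c * e k) - s (coord.smulRight (T h vec)) * (c * e (h * k)) ∈ _
    set t := s (coord.smulRight (T h vec)) with ht
    set y := Θ h (c * e k) - t * (c * e (h * k)) with hy
    have hρy : ρ y = 0 := by
      rw [hy, map_sub, sub_eq_zero]
      have h1 : ρ (Θ h (c * e k)) = T h * ρ (c * e k) * T h⁻¹ := by
        rw [hT, mul_assoc, ← map_mul, mul_inv_cancel, map_one, mul_one]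
      rw [h1]
      ext v
      rw [Module.End.mul_apply, Module.End.mul_apply, he, map_mul, Module.End.mul_apply, he,
        map_smul, map_smul, hlift, mul_inv, mul_comm h⁻¹, map_mul, Module.End.mul_apply]
    -- This splits `y` as `c y + (1 - c) y`. The factor `(1 - c) Θ_h(c)` that occurs lies in the
    -- radical, being the image under `Θ_h` of `Θ_{h⁻¹}(1 - c) c`, an element of `ker ρ` times `c`.
    have h1 : y = c * y + (Θ h (Θ (h⁻¹ : H) (1 - c) * c) * Θ h (e k)
        - (1 - c) * t * c * e (h * k)) := by
      have h2 : Θ h (Θ (h⁻¹ : H) (1 - c) * c) = (1 - c) * Θ h c := by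
        rw [map_mul, ← AlgEquiv.mul_apply, ← map_mul]
        simp
      rw [h2, hy, map_mul]
      noncomm_ring
    rw [h1]
    refine add_mem (hc _ hρy).2 (sub_mem (Ideal.mul_mem_right _ _ ?_)
      (Ideal.mul_mem_right _ _ (hc _ ?_).1))
    · exact apply_mem_jacobson (Θ h).toRingEquiv (hc _ (ker_apply hT h⁻¹ hc1)).1
    · rw [map_mul, hc1, zero_mul]
  · obtain ⟨f, hf⟩ := hex v hv
    exact ⟨s f, by rw [hs, hf]⟩

end Existence

/-- An irreducible module with a covariant action of `H` has matrix units. -/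
theorem IsIrreducible.nonempty_matrixUnits {K A V G : Type*} [Field K] [IsAlgClosed K] [Ring A]
    [Algebra K A] [FiniteDimensional K A] [AddCommGroup V] [Module K V] [CommGroup G]
    {Θ : G →* (A ≃ₐ[K] A)} {H : Subgroup G} {ρ : A →ₐ[K] Module.End K V}
    (hρ : IsIrreducible ρ) {T : H →* Module.End K V}
    (hT : ∀ (g : H) a, T g * ρ a = ρ (Θ g a) * T g) :
    Nonempty (MatrixUnits Θ H ρ T (Ring.jacobson A)) := by
  have := hρ.finiteDimensional
  have : IsArtinianRing A := IsArtinianRing.of_finite K A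
  obtain ⟨s, hs⟩ := ρ.toLinearMap.exists_rightInverse_of_surjective
    (LinearMap.range_eq_top.2 hρ.surjective)
  obtain ⟨v, hv⟩ := hρ.exists_ne_zero
  obtain ⟨f, hf⟩ := Module.Projective.exists_dual_eq_one K hv
  refine MatrixUnits.nonempty_of_section hT s (fun g => LinearMap.congr_fun hs g) v f hf
    fun w hw => ?_
  obtain ⟨g, hg⟩ := Module.Projective.exists_dual_eq_one K hw
  exact ⟨g.smulRight v, by rw [LinearMap.smulRight_apply, hg, one_smul]⟩

/-! ### Triangular bases from composition series -/

section TriangularBasis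

variable {K L : Type*} [Field K] [DecidableEq L]

/-- The operators `x l` are simultaneously triangular in a suitable basis, with diagonal entries
`0` and `1`, such that at each place at most one of them has the entry `1`, and `n l` is
the number of entries `1` of `x l`. -/
def HasTriangularBasis {E : Type*} [AddCommGroup E] [Module K E] (x : L → Module.End K E)
    (n : L → ℕ) : Prop :=
  ∃ (J : Type) (_ : Fintype J) (b : Module.Basis J K E) (r : J → ℕ) (t : J → Option L),
    (∀ l, IsTriangular b r (x l) fun j => if t j = some l then 1 else 0) ∧
    ∀ l, (Finset.univ.filter fun j => t j = some l).card = n l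

/-- The multiplicity of the root `1` recovers `n l` exactly, whereas the trace would give it only
modulo the characteristic of `K`. -/
theorem HasTriangularBasis.rootMultiplicity {E : Type*} [AddCommGroup E] [Module K E]
    [FiniteDimensional K E] {x : L → Module.End K E} {n : L → ℕ} (h : HasTriangularBasis x n)
    (l : L) : (x l).charpoly.rootMultiplicity 1 = n l := by
  classical
  obtain ⟨J, _, b, r, t, htri, hn⟩ := h
  rw [(htri l).rootMultiplicity, ← hn]
  simp

/-- Split the sequence linearly. The operators map lifted vectors of the quotient to lifts plus
vectors of the submodule, so ranking the lifts above the whole submodule, by the shift `N`, keeps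
them triangular. -/
theorem HasTriangularBasis.of_exact {W E Q : Type*} [AddCommGroup W] [Module K W]
    [AddCommGroup E] [Module K E] [AddCommGroup Q] [Module K Q] {x : L → Module.End K W}
    {y : L → Module.End K E} {z : L → Module.End K Q} {m n : L → ℕ}
    (f : W →ₗ[K] E) (g : E →ₗ[K] Q) (hf : Function.Injective f) (hg : Function.Surjective g)
    (hfg : ∀ e, g e = 0 ↔ ∃ w, f w = e) (hxy : ∀ l w, f (x l w) = y l (f w))
    (hyz : ∀ l e, g (y l e) = z l (g e)) (hx : HasTriangularBasis x m)
    (hz : HasTriangularBasis z n) : HasTriangularBasis y fun l => m l + n l := by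
  obtain ⟨J, _, b, r, t, hb, hm⟩ := hx
  obtain ⟨J', _, b', r', t', hb', hn⟩ := hz
  obtain ⟨s, hs⟩ := g.exists_rightInverse_of_surjective (LinearMap.range_eq_top.2 hg)
  replace hs : ∀ q, g (s q) = q := fun q => LinearMap.congr_fun hs q
  have hgf : ∀ w, g (f w) = 0 := fun w => (hfg _).2 ⟨w, rfl⟩
  let e : (W × Q) ≃ₗ[K] E := LinearEquiv.ofBijective (f.coprod s) (by
    constructor
    · rw [injective_iff_map_eq_zero]
      rintro ⟨w, q⟩ h
      rw [LinearMap.coprod_apply] at h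
      have hq : q = 0 := by
        have h1 := congrArg g h
        rwa [map_add, hgf, hs, zero_add, map_zero] at h1
      subst hq
      rw [map_zero, add_zero] at h
      obtain rfl : w = 0 := hf (h.trans (map_zero f).symm)
      rfl
    · intro v
      obtain ⟨w, hw⟩ := (hfg (v - s (g v))).1 (by rw [map_sub, hs, sub_self])
      exact ⟨(w, g v), by rw [LinearMap.coprod_apply, hw, sub_add_cancel]⟩)
  have he : ∀ w q, e (w, q) = f w + s q := fun w q => rfl
  have he1 : ∀ w, e.symm (f w) = (w, 0) := fun w => by
    rw [LinearEquiv.symm_apply_eq, he, map_zero, add_zero]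
  have he2 : ∀ v, (e.symm v).2 = g v := fun v => by
    obtain ⟨⟨w, q⟩, rfl⟩ := e.surjective v
    rw [LinearEquiv.symm_apply_apply, he, map_add, hgf, hs, zero_add]
  obtain ⟨N, hN⟩ : ∃ N, ∀ j, r j < N :=
    ⟨Finset.univ.sup r + 1, fun j => Nat.lt_succ_of_le (Finset.le_sup (Finset.mem_univ j))⟩
  let c := (b.prod b').map e
  have hcl : ∀ j, c (Sum.inl j) = f (b j) := fun j => by
    simp [c, he]
  have hcr : ∀ j, c (Sum.inr j) = s (b' j) := fun j => by
    simp [c, he]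
  have hrl : ∀ v i, c.repr v (Sum.inl i) = b.repr (e.symm v).1 i := fun v i => by
    simp [c]
  have hrr : ∀ v i, c.repr v (Sum.inr i) = b'.repr (g v) i := fun v i => by
    rw [← he2]; simp [c]
  refine ⟨J ⊕ J', inferInstance, c, Sum.elim r fun j => N + r' j, Sum.elim t t', fun l => ⟨?_, ?_⟩,
    fun l => ?_⟩
  · rintro (i | i) (j | j) hij hr
    · rw [hcl, hrl, ← hxy, he1]
      exact (hb l).1 i j (fun h => hij (h ▸ rfl)) hr
    · have h1 := hN i
      simp only [Sum.elim_inl, Sum.elim_inr] at hr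
      omega
    · rw [hcl, hrr, ← hxy, hgf, map_zero, Finsupp.zero_apply]
    · rw [hcr, hrr, hyz, hs]
      refine (hb' l).1 i j (fun h => hij (h ▸ rfl)) ?_
      simp only [Sum.elim_inr] at hr
      omega
  · rintro (j | j)
    · rw [hcl, hrl, ← hxy, he1]
      exact (hb l).2 j
    · rw [hcr, hrr, hyz, hs]
      exact (hb' l).2 j
  · change _ = m l + n l
    rw [← hm, ← hn, Finset.card_filter, Finset.card_filter, Finset.card_filter,
      Fintype.sum_sum_type]
    rfl

theorem hasTriangularBasis_zero (L : Type*) [DecidableEq L] (E : Type*) [AddCommGroup E] [Module K E]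
    [FiniteDimensional K E] : HasTriangularBasis (fun _ : L => (0 : Module.End K E)) 0 :=
  ⟨Fin (Module.finrank K E), inferInstance, Module.finBasis K E, 0, fun _ => none, by
    intro l
    constructor <;> simp, by simp⟩

theorem HasTriangularBasis.of_equiv {E E' : Type*} [AddCommGroup E] [Module K E]
    [AddCommGroup E'] [Module K E'] {x : L → Module.End K E} {x' : L → Module.End K E'}
    {n : L → ℕ} (e : E ≃ₗ[K] E') (hx : ∀ l v, e (x l v) = x' l (e v))
    (h : HasTriangularBasis x n) : HasTriangularBasis x' n := by
  obtain ⟨J, hJ, b, r, t, htri, hn⟩ := h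
  refine ⟨J, hJ, b.map e, r, t, fun l => ⟨fun i j hij hr => ?_, fun j => ?_⟩, hn⟩
  · rw [Module.Basis.map_apply, ← hx, Module.Basis.map_repr, LinearEquiv.trans_apply,
      LinearEquiv.symm_apply_apply]
    exact (htri l).1 i j hij hr
  · rw [Module.Basis.map_apply, ← hx, Module.Basis.map_repr, LinearEquiv.trans_apply,
      LinearEquiv.symm_apply_apply]
    exact (htri l).2 j

/-- Operators that vanish except for one, which is a projection of rank one. -/
theorem hasTriangularBasis_of_projection {E : Type*} [AddCommGroup E] [Module K E]
    [FiniteDimensional K E] {x : L → Module.End K E} (v : E) (f : E →ₗ[K] K) (hfv : f v = 1)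
    (l₀ : L) (hx : ∀ l w, x l w = if l = l₀ then f w • v else 0) :
    HasTriangularBasis x fun l => if l = l₀ then 1 else 0 := by
  have h1 : HasTriangularBasis (fun l => if l = l₀ then (1 : Module.End K K) else 0)
      fun l => if l = l₀ then 1 else 0 := by
    refine ⟨Unit, inferInstance, Module.Basis.singleton Unit K, 0, fun _ => some l₀,
      fun l => ⟨fun i j hij => (hij (Subsingleton.elim i j)).elim, fun j => ?_⟩, fun l => ?_⟩
    · by_cases h : l = l₀
      · simp [h]
      · simp [h, Ne.symm h]
    · by_cases h : l = l₀
      · simp [h]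
      · simp [h, Ne.symm h]
  -- In the sequence `0 → ker f → E → K → 0` all the operators vanish on `ker f`, and on `K` only
  -- the one with index `l₀` is nonzero, namely the identity.
  have h2 := HasTriangularBasis.of_exact (y := x) (LinearMap.ker f).subtype f
    Subtype.val_injective (fun c => ⟨c • v, by rw [map_smul, hfv, smul_eq_mul, mul_one]⟩)
    (fun e => ⟨fun h => ⟨⟨e, h⟩, rfl⟩, by rintro ⟨w, rfl⟩; exact w.2⟩)
    (fun l w => by
      have hw : f w = 0 := w.2
      simp [hx, hw])
    (fun l w => by
      rw [hx]
      split_ifs with h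
      · rw [map_smul, hfv, smul_eq_mul, mul_one]; rfl
      · simp)
    (hasTriangularBasis_zero L _) h1
  simpa using h2

/-- A simple module on which the operators either vanish or which is one of the modules `D l`. -/
theorem hasTriangularBasis_of_simple {B E : Type*} [Ring B] [Algebra K B] [AddCommGroup E]
    [Module K E] [Module B E] [IsScalarTower K B E] [FiniteDimensional K E]
    {V : Type*} [AddCommGroup V] [Module K V] (D : L → B →ₐ[K] Module.End K V) (x : L → B)
    (v₀ : V) (f : V →ₗ[K] K) (hf : f v₀ = 1)
    (hD : ∀ l l' v, D l' (x l) v = if l = l' then f v • v₀ else 0)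
    (hE : ∀ l, (∃ v : E, x l • v ≠ 0) → Nonempty (E ≃ₗ[B] AsModule (D l)))
    (y : L → Module.End K E) (hy : ∀ l v, y l v = x l • v) :
    ∃ n : L → ℕ, (∀ l, (Nonempty (E ≃ₗ[B] AsModule (D l)) → n l = 1) ∧
      (¬ Nonempty (E ≃ₗ[B] AsModule (D l)) → n l = 0)) ∧ HasTriangularBasis y n := by
  have hne : ∀ l, ∃ v : AsModule (D l), x l • v ≠ 0 := fun l => ⟨v₀, by
    have h2 := hD l l v₀
    rw [if_pos rfl, hf, one_smul] at h2
    intro h3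
    have h4 : v₀ = 0 := h2.symm.trans h3
    rw [h4, map_zero] at hf
    exact zero_ne_one hf⟩
  by_cases hex : ∃ l₀, Nonempty (E ≃ₗ[B] AsModule (D l₀))
  · obtain ⟨l₀, ⟨e⟩⟩ := hex
    let e' : E ≃ₗ[K] V := e.restrictScalars K
    have hfin : FiniteDimensional K V := Module.Finite.equiv e'
    -- The modules `D l` are pairwise non-isomorphic, since `x l` is nonzero on `D l` and zero on
    -- the others; so at most one index contributes.
    have hP : ∀ l, Nonempty (E ≃ₗ[B] AsModule (D l)) ↔ l = l₀ := fun l => by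
      constructor
      · rintro ⟨e'⟩
        by_contra hl
        obtain ⟨v, hv⟩ := hne l
        apply hv
        have h2 : x l • e (e'.symm v) = 0 := (hD l l₀ _).trans (if_neg hl)
        rw [← map_smul, ← map_smul, LinearEquiv.map_eq_zero_iff,
          LinearEquiv.map_eq_zero_iff] at h2
        exact h2
      · rintro rfl
        exact ⟨e⟩
    refine ⟨fun l => if l = l₀ then 1 else 0, fun l => ?_, ?_⟩
    · rw [hP]
      exact ⟨fun h => if_pos h, fun h => if_neg h⟩
    refine HasTriangularBasis.of_equiv e'.symm (x := fun l => D l₀ (x l)) (fun l v => ?_)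
      (hasTriangularBasis_of_projection v₀ f hf l₀ fun l w => hD l l₀ w)
    rw [hy]
    exact e.symm.map_smul (x l) (show AsModule (D l₀) from v)
  · push Not at hex
    have h2 : y = fun _ => (0 : Module.End K E) := by
      funext l
      ext1 v
      rw [hy]
      by_contra hv
      exact not_nonempty_iff.2 (hex l) (hE l ⟨v, hv⟩)
    refine ⟨0, fun l => ⟨fun h => (not_nonempty_iff.2 (hex l) h).elim, fun _ => rfl⟩, ?_⟩
    rw [h2]
    exact hasTriangularBasis_zero L _

/-- A simple quotient of a module contributes to the triangular basis. -/
theorem HasTriangularBasis.of_simple_quotient {B W M E : Type*} [Ring B] [Algebra K B]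
    [AddCommGroup W] [Module K W] [Module B W]
    [AddCommGroup M] [Module K M] [Module B M] [IsScalarTower K B M]
    [FiniteDimensional K M] [AddCommGroup E] [Module B E]
    {V : Type*} [AddCommGroup V] [Module K V] (D : L → B →ₐ[K] Module.End K V) (x : L → B)
    (v₀ : V) (f : V →ₗ[K] K) (hf : f v₀ = 1)
    (hD : ∀ l l' v, D l' (x l) v = if l = l' then f v • v₀ else 0)
    (hE : ∀ l, (∃ v : E, x l • v ≠ 0) → Nonempty (E ≃ₗ[B] AsModule (D l)))
    (w : L → Module.End K W) (hw : ∀ l v, w l v = x l • v)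
    (y : L → Module.End K M) (hy : ∀ l v, y l v = x l • v)
    (i : W →ₗ[B] M) (i' : W →ₗ[K] M) (hi' : ∀ v, i' v = i v) (hi : Function.Injective i)
    (g : M →ₗ[B] E) (hg : Function.Surjective g) (hig : ∀ e, g e = 0 ↔ ∃ v, i v = e)
    {m : L → ℕ} (hm : HasTriangularBasis w m) :
    ∃ n : L → ℕ, (∀ l, (Nonempty (E ≃ₗ[B] AsModule (D l)) → n l = 1) ∧
      (¬ Nonempty (E ≃ₗ[B] AsModule (D l)) → n l = 0)) ∧
      HasTriangularBasis y fun l => m l + n l := by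
  let _ : Module K E := Module.compHom E (algebraMap K B)
  have hKB : ∀ (c : K) (e : E), c • e = algebraMap K B c • e := fun _ _ => rfl
  have : IsScalarTower K B E := ⟨fun c b e => by
    rw [hKB, Algebra.smul_def, mul_smul]⟩
  let g' : M →ₗ[K] E :=
    { toFun := g
      map_add' := g.map_add
      map_smul' := fun c v => by
        rw [RingHom.id_apply, hKB, ← map_smul, algebraMap_smul] }
  have : FiniteDimensional K E := Module.Finite.of_surjective g' hg
  obtain ⟨n, hn, h⟩ := hasTriangularBasis_of_simple D x v₀ f hf hD hE
    (fun l => Algebra.lsmul K K E (x l)) fun _ _ => rfl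
  refine ⟨n, hn, HasTriangularBasis.of_exact i' g' (fun a b hab => hi ?_) hg (fun e => ?_)
    (fun l v => ?_) (fun l e => ?_) hm h⟩
  · rwa [hi', hi'] at hab
  · simp only [hi']
    exact hig e
  · rw [hi', hw, hy, hi', map_smul]
  · rw [hy]
    exact map_smul g (x l) e

/-- The composition factors of a module determine a triangular basis, if the operators vanish on
all simple modules except the modules `D l`, and are projections of rank one there. -/
theorem exists_hasTriangularBasis {B M : Type*} [Ring B] [Algebra K B] [AddCommGroup M]
    [Module K M] [Module B M] [IsScalarTower K B M] [FiniteDimensional K M]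
    {V : Type*} [AddCommGroup V] [Module K V] (D : L → B →ₐ[K] Module.End K V) (x : L → B)
    (v₀ : V) (f : V →ₗ[K] K) (hf : f v₀ = 1)
    (hD : ∀ l l' v, D l' (x l) v = if l = l' then f v • v₀ else 0)
    (hE : ∀ (P Q : Submodule B M) (l : L),
      IsSimpleModule B (Q ⧸ P.submoduleOf Q) → (∃ v : Q ⧸ P.submoduleOf Q, x l • v ≠ 0) →
      Nonempty ((Q ⧸ P.submoduleOf Q) ≃ₗ[B] AsModule (D l)))
    (s : CompositionSeries (Submodule B M)) (h0 : s.head = ⊥) (h1 : s.last = ⊤) :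
    HasTriangularBasis (fun l => Algebra.lsmul K K M (x l))
      fun l => factorCount (D := AsModule (D l)) s := by
  classical
  let P : Fin s.length → L → Prop := fun i l =>
    Nonempty ((s i.succ ⧸ (s i.castSucc).submoduleOf (s i.succ)) ≃ₗ[B] AsModule (D l))
  -- Partial counts for an induction up the series: only the factors below the place `k` contribute
  -- to the submodule `s k`.
  let cnt : Fin (s.length + 1) → L → ℕ := fun k l =>
    (Finset.univ.filter fun i : Fin s.length => i.castSucc < k ∧ P i l).card
  have hfin : ∀ k, FiniteDimensional K (s k) := fun k =>
    inferInstanceAs (FiniteDimensional K ((s k).restrictScalars K))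
  have hstep : ∀ k : Fin (s.length + 1),
      HasTriangularBasis (fun l => Algebra.lsmul K K (s k) (x l)) (cnt k) := fun k => by
    induction k using Fin.induction with
    | zero =>
      have hbot : s 0 = ⊥ := h0
      have h2 : (fun l => Algebra.lsmul K K (s 0) (x l)) = fun _ => 0 := by
        funext l
        ext1 v
        have h3 : Subsingleton (s 0) := by rw [hbot]; infer_instance
        exact Subsingleton.elim _ _
      have h3 : cnt 0 = 0 := by
        funext l
        simp [cnt]
      rw [h2, h3]
      exact hasTriangularBasis_zero L _
    | succ i ih =>
      have hle : s i.castSucc ≤ s i.succ := (s.step i).le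
      obtain ⟨n, hn, h⟩ := HasTriangularBasis.of_simple_quotient D x v₀ f hf hD
        (fun l => hE (s i.castSucc) (s i.succ) l
          ((covBy_iff_quot_is_simple hle).1 (s.step i)))
        _ (fun l v => rfl) (fun l => Algebra.lsmul K K (s i.succ) (x l)) (fun l v => rfl)
        (Submodule.inclusion hle) ((Submodule.inclusion hle).restrictScalars K) (fun _ => rfl)
        (Submodule.inclusion_injective hle) ((s i.castSucc).submoduleOf (s i.succ)).mkQ
        (Submodule.mkQ_surjective _) (fun e => by
          refine (Submodule.Quotient.mk_eq_zero _).trans ?_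
          rw [Submodule.submoduleOf, Submodule.mem_comap]
          exact ⟨fun h => ⟨⟨e, h⟩, rfl⟩, by rintro ⟨w, rfl⟩; exact w.2⟩) ih
      have h2 : cnt i.succ = fun l => cnt i.castSucc l + n l := by
        funext l
        have hnl : n l = if P i l then 1 else 0 := by
          split_ifs with hP
          · exact (hn l).1 hP
          · exact (hn l).2 hP
        rw [hnl]
        simp only [cnt, Finset.card_filter]
        rw [← Finset.sum_erase_add _ _ (Finset.mem_univ i),
          ← Finset.sum_erase_add Finset.univ (fun j => if j.castSucc < i.castSucc ∧ P j l then 1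
            else 0) (Finset.mem_univ i)]
        have h3 : ∀ j ∈ Finset.univ.erase i, (if j.castSucc < i.succ ∧ P j l then 1 else 0) =
            if j.castSucc < i.castSucc ∧ P j l then 1 else 0 := fun j hj => by
          have h4 := Fin.val_ne_of_ne (Finset.ne_of_mem_erase hj)
          have h5 : j.castSucc < i.succ ↔ j.castSucc < i.castSucc := by
            simp only [Fin.lt_def, Fin.val_castSucc, Fin.val_succ]
            omega
          simp only [h5]
        rw [Finset.sum_congr rfl h3]
        simp
      rw [h2]
      exact h
  have hlast := hstep (Fin.last _)
  have hcnt : cnt (Fin.last _) = fun l => factorCount (D := AsModule (D l)) s := by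
    funext l
    simp only [cnt, factorCount, P, Fin.castSucc_lt_last, true_and]
    rw [Nat.card_eq_fintype_card, Fintype.card_subtype]
  rw [hcnt] at hlast
  have htop : s (Fin.last _) = ⊤ := h1
  exact HasTriangularBasis.of_equiv
    (((LinearEquiv.ofEq _ _ htop).trans Submodule.topEquiv).restrictScalars K)
    (fun l v => rfl) hlast

end TriangularBasis

/-! ### Multiplicities of twisted modules -/

section Multiplicity

variable {K A V G B W L : Type*} [Field K] [Ring A] [Algebra K A] [AddCommGroup V] [Module K V]
  [CommGroup G] [Ring B] [Algebra K B] {Θ : G →* (A ≃ₐ[K] A)} {H : Subgroup G} [Fintype H]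
  [DecidableEq L] [AddCommGroup W] [Module K W] [FiniteDimensional K W]
  {ρ : A →ₐ[K] Module.End K V} {T : H →* Module.End K V} {J : Ideal A}

theorem MatrixUnits.hasTriangularBasis_of_compositionSeries (u : MatrixUnits Θ H ρ T J)
    (c : CrossedSystem Θ H B) (hT : ∀ (g : H) a, T g * ρ a = ρ (Θ g a) * T g)
    (hJ : ∀ x ∈ J, c.of 1 x ∈ Ring.jacobson B) {ν : K} (hν : ν * Fintype.card H = 1)
    {χ : L → H →* K} (hχ : Function.Injective χ) {D : L → B →ₐ[K] Module.End K V}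
    (hD : ∀ l, IsTwistedExtension c ρ T (χ l) (D l)) (M : B →ₐ[K] Module.End K W)
    (s : CompositionSeries (Submodule B (AsModule M))) (h0 : s.head = ⊥) (h1 : s.last = ⊤) :
    HasTriangularBasis (fun l => M (u.projector c ν (χ l)))
      fun l => factorCount (D := AsModule (D l)) s := by
  classical
  have : FiniteDimensional K (AsModule M) := inferInstanceAs (FiniteDimensional K W)
  refine exists_hasTriangularBasis (M := AsModule M) D (fun l => u.projector c ν (χ l)) u.vec
    u.coord u.coord_vec (fun l l' v => ?_) (fun P Q l hs => ?_) s h0 h1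
  · rw [u.apply_projector c hν (χ l) (hD l') v]
    simp only [hχ.eq_iff]
  · rintro ⟨v, hv⟩
    exact u.nonempty_equiv c hT hJ ν (hD l) v hv

/-- The left side does not involve a composition series, so all series give the same multiplicity.
-/
theorem MatrixUnits.rootMultiplicity_eq (u : MatrixUnits Θ H ρ T J)
    (c : CrossedSystem Θ H B) (hT : ∀ (g : H) a, T g * ρ a = ρ (Θ g a) * T g)
    (hJ : ∀ x ∈ J, c.of 1 x ∈ Ring.jacobson B) {ν : K} (hν : ν * Fintype.card H = 1)
    {χ : H →* K} {D : B →ₐ[K] Module.End K V}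
    (hD : IsTwistedExtension c ρ T χ D) {M : B →ₐ[K] Module.End K W} {n : ℕ}
    (h : HasMultiplicity M D n) :
    (M (u.projector c ν χ)).charpoly.rootMultiplicity 1 = n := by
  obtain ⟨s, h0, h1, rfl⟩ := h
  exact (u.hasTriangularBasis_of_compositionSeries c hT hJ hν
    (χ := fun _ : Unit => χ) (fun _ _ _ => rfl) (fun _ => hD) M s h0 h1).rootMultiplicity ()

/-- A single composition series serves all the twists. It is the common basis, not just the numbers,
that is needed for tensor products, where several projectors are added. -/
theorem MatrixUnits.exists_hasTriangularBasis (u : MatrixUnits Θ H ρ T J)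
    (c : CrossedSystem Θ H B) (hT : ∀ (g : H) a, T g * ρ a = ρ (Θ g a) * T g)
    (hJ : ∀ x ∈ J, c.of 1 x ∈ Ring.jacobson B) {ν : K} (hν : ν * Fintype.card H = 1)
    {χ : L → H →* K} (hχ : Function.Injective χ) {D : L → B →ₐ[K] Module.End K V}
    (hD : ∀ l, IsTwistedExtension c ρ T (χ l) (D l)) (M : B →ₐ[K] Module.End K W) :
    ∃ n : L → ℕ, HasTriangularBasis (fun l => M (u.projector c ν (χ l))) n ∧
      ∀ l, HasMultiplicity M (D l) (n l) := by
  have : FiniteDimensional K (AsModule M) := inferInstanceAs (FiniteDimensional K W)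
  have : IsNoetherian B (AsModule M) := isNoetherian_of_tower K inferInstance
  have : IsArtinian B (AsModule M) := isArtinian_of_tower K inferInstance
  obtain ⟨s, h0, h1⟩ := exists_compositionSeries_of_isNoetherian_isArtinian B (AsModule M)
  exact ⟨_, u.hasTriangularBasis_of_compositionSeries c hT hJ hν hχ hD M s h0 h1,
    fun l => ⟨s, h0, h1, rfl⟩⟩

/-- The multiplicity of a twisted module is the multiplicity of the root `1` of
the characteristic polynomial of its projector. -/
theorem MatrixUnits.hasMultiplicity_iff (u : MatrixUnits Θ H ρ T J)
    (c : CrossedSystem Θ H B) (hT : ∀ (g : H) a, T g * ρ a = ρ (Θ g a) * T g)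
    (hJ : ∀ x ∈ J, c.of 1 x ∈ Ring.jacobson B) {ν : K} (hν : ν * Fintype.card H = 1)
    {χ : H →* K} {D : B →ₐ[K] Module.End K V}
    (hD : IsTwistedExtension c ρ T χ D) {M : B →ₐ[K] Module.End K W} {n : ℕ} :
    HasMultiplicity M D n ↔ n = (M (u.projector c ν χ)).charpoly.rootMultiplicity 1 := by
  obtain ⟨m, -, hm⟩ := u.exists_hasTriangularBasis c hT hJ hν
    (χ := fun _ : Unit => χ) (fun _ _ _ => rfl) (fun _ => hD) M
  refine ⟨fun h => (u.rootMultiplicity_eq c hT hJ hν hD h).symm, ?_⟩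
  rintro rfl
  rw [u.rootMultiplicity_eq c hT hJ hν hD (hm ())]
  exact hm ()

end Multiplicity

/-! ### Base change of tensor products of families -/

section BaseChangePi

variable {O : Type*} [CommRing O] (R : Type*) [CommRing R] [Algebra O R] {ι : Type*}
  (M : ι → Type*) [∀ α, AddCommGroup (M α)] [∀ α, Module O (M α)]

/-- The multilinear map `m ↦ ⨂ (1 ⊗ m α)`. -/
def tprodBaseChange : MultilinearMap O M (⨂[R] α, (R ⊗[O] M α)) :=
  ((PiTensorProduct.tprod R).restrictScalars O).compLinearMap
    fun α => TensorProduct.mk O R (M α) 1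

theorem tprodBaseChange_apply (m : ∀ α, M α) :
    tprodBaseChange R M m = PiTensorProduct.tprod R fun α => (1 : R) ⊗ₜ[O] m α := rfl

variable [Finite ι] [∀ α, Module.Free O (M α)]

/-- Base change commutes with tensor products of families of free modules. -/
def baseChangePi : (R ⊗[O] (⨂[O] α, M α)) ≃ₗ[R] ⨂[R] α, (R ⊗[O] M α) :=
  ((Basis.piTensorProduct fun α => Module.Free.chooseBasis O (M α)).baseChange R).equiv
    (Basis.piTensorProduct fun α => (Module.Free.chooseBasis O (M α)).baseChange R)
    (Equiv.refl _)

/-- The equivalence is defined by matching bases, so its natural description is checked on basis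
vectors and extended by multilinearity. -/
theorem baseChangePi_tprod (m : ∀ α, M α) :
    baseChangePi R M (1 ⊗ₜ PiTensorProduct.tprod O m) =
      PiTensorProduct.tprod R fun α => (1 : R) ⊗ₜ[O] m α := by
  let f : MultilinearMap O M (⨂[R] α, (R ⊗[O] M α)) :=
    (((baseChangePi R M).toLinearMap.restrictScalars O) ∘ₗ
      TensorProduct.mk O R (⨂[O] α, M α) 1).compMultilinearMap (PiTensorProduct.tprod O)
  have h : f = tprodBaseChange R M := by
    refine Module.Basis.ext_multilinear (fun α => Module.Free.chooseBasis O (M α)) fun v => ?_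
    rw [tprodBaseChange_apply]
    have h1 := Module.Basis.equiv_apply
      ((Basis.piTensorProduct fun α => Module.Free.chooseBasis O (M α)).baseChange R) v
      (Basis.piTensorProduct fun α => (Module.Free.chooseBasis O (M α)).baseChange R)
      (Equiv.refl _)
    rw [Module.Basis.baseChange_apply, Basis.piTensorProduct_apply, Equiv.refl_apply,
      Basis.piTensorProduct_apply] at h1
    simp only [Module.Basis.baseChange_apply] at h1
    exact h1
  exact congrArg (fun g : MultilinearMap O M _ => g m) h

end BaseChangePi

/-! ### Pure tensors of elements of the algebras `K ⊗ A⁽ᵅ⁾` -/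

section PureTensor

variable {O K : Type*} [CommRing O] [CommRing K] [Algebra O K] {ι : Type*}
  {A : ι → Type*} [∀ α, Ring (A α)] [∀ α, Algebra O (A α)]

/-- As `O → K` is onto, every scalar can be moved across the tensor sign. This lifts elements of
reduced algebras to `O`. -/
theorem exists_eq_one_tmul (hK : Function.Surjective (algebraMap O K)) {M : Type*}
    [AddCommGroup M] [Module O M] (x : K ⊗[O] M) : ∃ m : M, x = 1 ⊗ₜ m := by
  induction x using TensorProduct.induction_on with
  | zero => exact ⟨0, (TensorProduct.tmul_zero _ _).symm⟩
  | tmul r m =>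
    obtain ⟨s, rfl⟩ := hK r
    exact ⟨s • m, by rw [← TensorProduct.smul_tmul, Algebra.smul_def, mul_one]⟩
  | add x y hx hy =>
    obtain ⟨m, rfl⟩ := hx
    obtain ⟨n, rfl⟩ := hy
    exact ⟨m + n, (TensorProduct.tmul_add _ _ _).symm⟩

theorem exists_eq_one_tmul_pi (hK : Function.Surjective (algebraMap O K))
    (x : ∀ α, K ⊗[O] A α) : ∃ a : ∀ α, A α, x = fun α => 1 ⊗ₜ a α := by
  choose a ha using fun α => exists_eq_one_tmul hK (x α)
  exact ⟨a, funext ha⟩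

variable [Finite ι] [∀ α, Module.Free O (A α)]

/-- The multilinear map `⨂ (K ⊗ A⁽ᵅ⁾) → K ⊗ ⨂ A⁽ᵅ⁾`. -/
def pureTensor : MultilinearMap K (fun α => K ⊗[O] A α) (K ⊗[O] (⨂[O] α, A α)) :=
  (baseChangePi K A).symm.toLinearMap.compMultilinearMap (PiTensorProduct.tprod K)

theorem pureTensor_one_tmul (a : ∀ α, A α) :
    pureTensor (fun α => (1 : K) ⊗ₜ[O] a α) = 1 ⊗ₜ PiTensorProduct.tprod O a :=
  (LinearEquiv.symm_apply_eq _).2 (baseChangePi_tprod K A a).symm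

theorem pureTensor_mul (hK : Function.Surjective (algebraMap O K)) (x y : ∀ α, K ⊗[O] A α) :
    pureTensor x * pureTensor y = pureTensor (x * y) := by
  obtain ⟨a, rfl⟩ := exists_eq_one_tmul_pi hK x
  obtain ⟨b, rfl⟩ := exists_eq_one_tmul_pi hK y
  have h : ((fun α => (1 : K) ⊗ₜ[O] a α) * fun α => (1 : K) ⊗ₜ[O] b α) =
      fun α => 1 ⊗ₜ (a * b) α := by
    funext α
    rw [Pi.mul_apply, Algebra.TensorProduct.tmul_mul_tmul, one_mul, Pi.mul_apply]
  rw [h, pureTensor_one_tmul, pureTensor_one_tmul, pureTensor_one_tmul,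
    Algebra.TensorProduct.tmul_mul_tmul, one_mul, PiTensorProduct.tprod_mul_tprod]

theorem baseAction_pureTensor {G : Type*} [Group G] (hK : Function.Surjective (algebraMap O K))
    (Θ : ∀ α, G →* (A α ≃ₐ[O] A α)) (g : G) (x : ∀ α, K ⊗[O] A α) :
    baseAction K (diagonalAction Θ) g (pureTensor x) =
      pureTensor fun α => baseAction K (Θ α) g (x α) := by
  obtain ⟨a, rfl⟩ := exists_eq_one_tmul_pi hK x
  rw [pureTensor_one_tmul, baseAction_tmul]
  simp only [baseAction_tmul]
  rw [pureTensor_one_tmul]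
  congr 1
  exact tensorAlgHom_tprod _ _

@[elab_as_elim]
theorem pureTensor_induction (hK : Function.Surjective (algebraMap O K))
    {motive : (K ⊗[O] (⨂[O] α, A α)) → Prop} (x : K ⊗[O] (⨂[O] α, A α))
    (pure : ∀ x, motive (pureTensor x)) (smul : ∀ (r : K) x, motive x → motive (r • x))
    (add : ∀ x y, motive x → motive y → motive (x + y)) : motive x := by
  obtain ⟨y, rfl⟩ := exists_eq_one_tmul hK x
  induction y using PiTensorProduct.induction_on with
  | smul_tprod r a =>
    rw [← TensorProduct.smul_tmul, Algebra.smul_def, mul_one]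
    have h : algebraMap O K r ⊗ₜ[O] PiTensorProduct.tprod O a =
        algebraMap O K r • ((1 : K) ⊗ₜ[O] PiTensorProduct.tprod O a) := by
      rw [TensorProduct.smul_tmul', smul_eq_mul, mul_one]
    rw [h, ← pureTensor_one_tmul]
    exact smul _ _ (pure _)
  | add x y hx hy => rw [TensorProduct.tmul_add]; exact add _ _ hx hy

variable [DecidableEq ι]

variable (O K A) in
/-- The inclusion of a factor. -/
def factorHom (α : ι) : (K ⊗[O] A α) →ₐ[K] (K ⊗[O] (⨂[O] α, A α)) :=
  Algebra.TensorProduct.map (AlgHom.id K K) (PiTensorProduct.singleAlgHom α)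

theorem factorHom_apply (hK : Function.Surjective (algebraMap O K)) (α : ι) (x : K ⊗[O] A α) :
    factorHom O K A α x = pureTensor (Function.update 1 α x) := by
  obtain ⟨a, rfl⟩ := exists_eq_one_tmul hK x
  have h : Function.update (1 : ∀ α, K ⊗[O] A α) α (1 ⊗ₜ a) =
      fun β => 1 ⊗ₜ Function.update (1 : ∀ α, A α) α a β := by
    funext β
    rcases eq_or_ne β α with rfl | hβ
    · simp
    · rw [Function.update_of_ne hβ, Function.update_of_ne hβ]
      rfl
  rw [h, pureTensor_one_tmul]
  rfl

theorem pureTensor_update (hK : Function.Surjective (algebraMap O K)) (α : ι)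
    (x : ∀ α, K ⊗[O] A α) (y : K ⊗[O] A α) :
    pureTensor (Function.update x α y) =
      factorHom O K A α y * pureTensor (Function.update x α 1) := by
  rw [factorHom_apply hK, pureTensor_mul hK]
  congr 1
  funext β
  rcases eq_or_ne β α with rfl | hβ
  · simp
  · simp [Function.update_of_ne hβ]

theorem baseAction_factorHom {G : Type*} [Group G] (hK : Function.Surjective (algebraMap O K))
    (Θ : ∀ α, G →* (A α ≃ₐ[O] A α)) (g : G) (α : ι) (x : K ⊗[O] A α) :
    baseAction K (diagonalAction Θ) g (factorHom O K A α x) =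
      factorHom O K A α (baseAction K (Θ α) g x) := by
  rw [factorHom_apply hK, factorHom_apply hK, baseAction_pureTensor hK]
  congr 1
  funext β
  rcases eq_or_ne β α with rfl | hβ
  · simp
  · rw [Function.update_of_ne hβ, Function.update_of_ne hβ, Pi.one_apply, map_one]

/-- A pure tensor is its component at `α` times the pure tensor with that component replaced by `1`,
and the latter commutes with the factor `α`. This is the generation hypothesis of
`CrossedSystem.of_mem_jacobson`. -/
theorem mem_span_factorHom_mul (hK : Function.Surjective (algebraMap O K)) (α : ι)
    (x : K ⊗[O] (⨂[O] α, A α)) :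
    x ∈ Submodule.span K {x | ∃ a z, (∀ b, Commute (factorHom O K A α b) z) ∧
      x = factorHom O K A α a * z} := by
  refine pureTensor_induction hK x (fun x => ?_) (fun r x hx => Submodule.smul_mem _ r hx)
    fun x y hx hy => add_mem hx hy
  · refine Submodule.subset_span ⟨x α, pureTensor (Function.update x α 1), fun b => ?_, ?_⟩
    · rw [Commute, SemiconjBy, factorHom_apply hK, pureTensor_mul hK, pureTensor_mul hK]
      congr 1
      funext β
      rcases eq_or_ne β α with rfl | hβ
      · simp
      · simp [Function.update_of_ne hβ]
    · rw [← pureTensor_update hK, Function.update_eq_self]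

/-- The components are exchanged one at a time; each exchange changes the tensor by a multiple of an
element of `J`. -/
theorem pureTensor_sub_mem (hK : Function.Surjective (algebraMap O K))
    {J : Ideal (K ⊗[O] (⨂[O] α, A α))} [J.IsTwoSided] {I : ∀ α, Ideal (K ⊗[O] A α)}
    (hJ : ∀ α, ∀ x ∈ I α, factorHom O K A α x ∈ J) (x y : ∀ α, K ⊗[O] A α)
    (h : ∀ α, x α - y α ∈ I α) : pureTensor x - pureTensor y ∈ J := by
  have := Fintype.ofFinite ι
  have key : ∀ s : Finset ι, pureTensor (s.piecewise x y) - pureTensor y ∈ J := fun s => by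
    induction s using Finset.induction_on with
    | empty => simp
    | insert α s hα ih =>
      rw [← sub_add_sub_cancel _ (pureTensor (s.piecewise x y))]
      refine add_mem ?_ ih
      have h1 : s.piecewise x y = Function.update (s.piecewise x y) α (y α) := by
        rw [← Finset.piecewise_eq_of_notMem s x y hα, Function.update_eq_self]
      rw [Finset.piecewise_insert]
      nth_rw 2 [h1]
      rw [pureTensor_update hK, pureTensor_update hK α _ (y α), ← sub_mul, ← map_sub]
      exact Ideal.mul_mem_right _ _ (hJ α _ (h α))
  simpa using key Finset.univ

end PureTensor

/-! ### Matrix units of tensor products -/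

section TensorMatrixUnits

variable {O K : Type*} [CommRing O] [Field K] [Algebra O K] {ι : Type*}
  {A : ι → Type*} [∀ α, Ring (A α)] [∀ α, Algebra O (A α)]
  {V : ι → Type*} [∀ α, AddCommGroup (V α)] [∀ α, Module K (V α)]

/-- The diagonal action of a group on a tensor product. -/
def tensorGroup {H : Type*} [Group H] (T : ∀ α, H →* Module.End K (V α)) :
    H →* Module.End K (⨂[K] α, V α) where
  toFun h := PiTensorProduct.map fun α => T α h
  map_one' := by
    simp only [map_one]
    exact PiTensorProduct.map_one
  map_mul' g h := by
    simp only [map_mul]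
    exact PiTensorProduct.map_mul _ _

theorem tensorGroup_tprod {H : Type*} [Group H] (T : ∀ α, H →* Module.End K (V α)) (h : H)
    (v : ∀ α, V α) : tensorGroup T h (PiTensorProduct.tprod K v) =
      PiTensorProduct.tprod K fun α => T α h (v α) :=
  PiTensorProduct.map_tprod _ _

theorem tprod_linear_ext {E : Type*} [AddCommGroup E] [Module K E]
    {f g : (⨂[K] α, V α) →ₗ[K] E}
    (h : ∀ v, f (PiTensorProduct.tprod K v) = g (PiTensorProduct.tprod K v)) : f = g :=
  PiTensorProduct.ext (MultilinearMap.ext h)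

variable [Finite ι] [∀ α, Module.Free O (A α)]

theorem tensorModule_pureTensor (hK : Function.Surjective (algebraMap O K))
    (ρ : ∀ α, (K ⊗[O] A α) →ₐ[K] Module.End K (V α)) (x : ∀ α, K ⊗[O] A α) :
    tensorModule ρ (pureTensor x) = PiTensorProduct.map fun α => ρ α (x α) := by
  obtain ⟨a, rfl⟩ := exists_eq_one_tmul_pi hK x
  refine tprod_linear_ext fun v => ?_
  rw [pureTensor_one_tmul, tensorModule_tprod, one_smul, PiTensorProduct.map_tprod]

theorem tensorModule_pureTensor_tprod (hK : Function.Surjective (algebraMap O K))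
    (ρ : ∀ α, (K ⊗[O] A α) →ₐ[K] Module.End K (V α)) (x : ∀ α, K ⊗[O] A α) (v : ∀ α, V α) :
    tensorModule ρ (pureTensor x) (PiTensorProduct.tprod K v) =
      PiTensorProduct.tprod K fun α => ρ α (x α) (v α) := by
  rw [tensorModule_pureTensor hK, PiTensorProduct.map_tprod]

variable {G : Type*} [CommGroup G] {Θ : ∀ α, G →* (A α ≃ₐ[O] A α)} {H : Subgroup G}
  {ρ : ∀ α, (K ⊗[O] A α) →ₐ[K] Module.End K (V α)} {T : ∀ α, H →* Module.End K (V α)}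

theorem tensorGroup_mul (hK : Function.Surjective (algebraMap O K))
    (hT : ∀ α (g : H) a, T α g * ρ α a = ρ α (baseAction K (Θ α) g a) * T α g) (g : H)
    (a : K ⊗[O] (⨂[O] α, A α)) :
    tensorGroup T g * tensorModule ρ a =
      tensorModule ρ (baseAction K (diagonalAction Θ) g a) * tensorGroup T g := by
  refine pureTensor_induction hK a (fun x => ?_) (fun r x hx => ?_) fun x y hx hy => ?_
  · refine tprod_linear_ext fun v => ?_
    rw [baseAction_pureTensor hK, Module.End.mul_apply, Module.End.mul_apply,
      tensorModule_pureTensor_tprod hK, tensorGroup_tprod, tensorGroup_tprod,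
      tensorModule_pureTensor_tprod hK]
    congr 1
    funext α
    exact LinearMap.congr_fun (hT α g (x α)) (v α)
  · rw [map_smul, map_smul, map_smul, mul_smul_comm, hx, smul_mul_assoc]
  · rw [map_add, map_add, map_add, mul_add, hx, hy, add_mul]

variable {I : ∀ α, Ideal (K ⊗[O] A α)}

/-- Some coordinate `q` of `v` in a basis of pure tensors is nonzero. The operator of rank one
sending `v` to its coordinate `q` times `⨂ w α` is a tensor product of operators of rank one, each
in the image of `ρ α`. -/
theorem exists_tensorModule_apply_eq (hK : Function.Surjective (algebraMap O K))
    (hρ : ∀ α, Function.Surjective (ρ α)) (w : ∀ α, V α) (v : ⨂[K] α, V α) (hv : v ≠ 0) :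
    ∃ y, tensorModule ρ y v = PiTensorProduct.tprod K w := by
  have := Fintype.ofFinite ι
  let b : ∀ α, Module.Basis _ K (V α) := fun α => Module.Basis.ofVectorSpace K (V α)
  obtain ⟨q, hq⟩ : ∃ q, (Basis.piTensorProduct b).repr v q ≠ 0 := by
    by_contra! hcon
    exact hv ((Basis.piTensorProduct b).repr.map_eq_zero_iff.1 (Finsupp.ext hcon))
  choose y hy using fun α => hρ α (((b α).coord (q α)).smulRight (w α))
  have h : tensorModule ρ (pureTensor y) =
      ((Basis.piTensorProduct b).coord q).smulRight (PiTensorProduct.tprod K w) := by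
    refine tprod_linear_ext fun u => ?_
    rw [tensorModule_pureTensor_tprod hK, LinearMap.smulRight_apply, Module.Basis.coord_apply,
      Basis.piTensorProduct_repr_tprod_apply, ← MultilinearMap.map_smul_univ]
    congr 1
    funext α
    rw [hy]
    rfl
  refine ⟨((Basis.piTensorProduct b).repr v q)⁻¹ • pureTensor y, ?_⟩
  rw [map_smul, LinearMap.smul_apply, h, LinearMap.smulRight_apply, Module.Basis.coord_apply,
    smul_smul, inv_mul_cancel₀ hq, one_smul]

/-- The matrix units of a tensor product are the pure tensors of matrix units. -/
def tensorMatrixUnits [DecidableEq ι] [Fintype ι] (hK : Function.Surjective (algebraMap O K))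
    (hρ : ∀ α, Function.Surjective (ρ α))
    {J : Ideal (K ⊗[O] (⨂[O] α, A α))} [J.IsTwoSided]
    (hJ : ∀ α, ∀ x ∈ I α, factorHom O K A α x ∈ J)
    (u : ∀ α, MatrixUnits (baseAction K (Θ α)) H (ρ α) (T α) (I α)) :
    MatrixUnits (baseAction K (diagonalAction Θ)) H (tensorModule ρ) (tensorGroup T) J where
  vec := PiTensorProduct.tprod K fun α => (u α).vec
  coord := PiTensorProduct.lift
    ((MultilinearMap.mkPiAlgebra K ι K).compLinearMap fun α => (u α).coord)
  coord_vec := by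
    rw [PiTensorProduct.lift.tprod]
    exact Finset.prod_eq_one fun α _ => (u α).coord_vec
  elem k := pureTensor fun α => (u α).elem k
  lift := PiTensorProduct.lift (pureTensor.compLinearMap fun α => (u α).lift)
  apply_elem k v := by
    have h : tensorModule ρ (pureTensor fun α => (u α).elem k) =
        ((PiTensorProduct.lift ((MultilinearMap.mkPiAlgebra K ι K).compLinearMap
          fun α => (u α).coord)) ∘ₗ tensorGroup T k⁻¹).smulRight
          (PiTensorProduct.tprod K fun α => (u α).vec) := by
      refine tprod_linear_ext fun v => ?_
      rw [tensorModule_pureTensor_tprod hK, LinearMap.smulRight_apply, LinearMap.comp_apply,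
        tensorGroup_tprod, PiTensorProduct.lift.tprod]
      change _ = (∏ α, (u α).coord (T α k⁻¹ (v α))) • _
      rw [← MultilinearMap.map_smul_univ]
      congr 1
      funext α
      exact (u α).apply_elem k (v α)
    rw [h]
    rfl
  apply_lift v := by
    have h : LinearMap.applyₗ (PiTensorProduct.tprod K fun α => (u α).vec) ∘ₗ
        (tensorModule ρ).toLinearMap ∘ₗ
          PiTensorProduct.lift (pureTensor.compLinearMap fun α => (u α).lift) =
          LinearMap.id := by
      refine tprod_linear_ext fun v => ?_
      rw [LinearMap.comp_apply, LinearMap.comp_apply, PiTensorProduct.lift.tprod]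
      exact (tensorModule_pureTensor_tprod hK ρ _ _).trans
        (congrArg (PiTensorProduct.tprod K) (funext fun α => (u α).apply_lift (v α)))
    exact LinearMap.congr_fun h v
  -- Both terms are linear in `x`, so `x` may be taken to be a pure tensor, for which the relation
  -- is componentwise.
  mul_elem x k := by
    refine pureTensor_induction hK x (fun x => ?_) (fun r x hx => ?_) fun x y hx hy => ?_
    · rw [tensorModule_pureTensor_tprod hK, PiTensorProduct.lift.tprod]
      change _ - pureTensor _ * _ ∈ J
      rw [pureTensor_mul hK, pureTensor_mul hK]
      exact pureTensor_sub_mem hK hJ _ _ fun α => (u α).mul_elem (x α) k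
    · rw [map_smul, LinearMap.smul_apply, map_smul, smul_mul_assoc, smul_mul_assoc, ← smul_sub]
      exact Submodule.smul_of_tower_mem J r hx
    · rw [map_add, LinearMap.add_apply, map_add, add_mul, add_mul, add_sub_add_comm]
      exact add_mem hx hy
  action_elem h k := by
    rw [baseAction_pureTensor hK, tensorGroup_tprod, PiTensorProduct.lift.tprod]
    change _ - pureTensor _ * _ ∈ J
    rw [pureTensor_mul hK]
    exact pureTensor_sub_mem hK hJ _ _ fun α => (u α).action_elem h k
  exists_apply_eq v hv := exists_tensorModule_apply_eq hK hρ _ v hv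

end TensorMatrixUnits

/-! ### The part of the radical of a crossed product that lies in `A` -/

section RadicalIdeal

variable {R A G B : Type*} [CommRing R] [Ring A] [Algebra R A] [Group G] [Ring B] [Algebra R B]
  {Θ : G →* (A ≃ₐ[R] A)} {H : Subgroup G}

/-- The elements of `A` that lie in the radical of a crossed product `A ⋊ H`. -/
def CrossedSystem.radical (c : CrossedSystem Θ H B) : Ideal A where
  carrier := {a | c.of 1 a ∈ Ring.jacobson B}
  zero_mem' := by simp
  add_mem' ha hb := by
    rw [Set.mem_ofPred_eq, map_add]
    exact add_mem ha hb
  smul_mem' a b hb := by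
    have h : c.of 1 (a * b) = c.of 1 a * c.of 1 b := by rw [c.of_mul_of]; simp
    rw [Set.mem_ofPred_eq, smul_eq_mul, h]
    exact Ideal.mul_mem_left _ _ hb

instance (c : CrossedSystem Θ H B) : c.radical.IsTwoSided where
  mul_mem_of_left {a} b ha := by
    have h : c.of 1 (a * b) = c.of 1 a * c.of 1 b := by rw [c.of_mul_of]; simp
    change c.of 1 (a * b) ∈ Ring.jacobson B
    rw [h]
    exact Ideal.mul_mem_right _ _ ha

end RadicalIdeal

/-! ### Characters of subgroups of `ℤ_p` -/

section Characters

variable {p : ℕ} [NeZero p]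

/-- The character `θ^n ↦ ε^{nz}`. -/
def rootCharacter {R : Type*} [CommRing R] {ε : R} (hε : ε ^ p = 1)
    (H : Subgroup (Multiplicative (ZMod p))) (z : ℤ) : H →* R :=
  (AddChar.zmodChar p hε).toMonoidHom.comp ((zpowGroupHom z).comp H.subtype)

section CommRing

variable {R : Type*} [CommRing R] {ε : R} (hε : ε ^ p = 1)
  (H : Subgroup (Multiplicative (ZMod p)))

theorem rootCharacter_apply (z : ℤ) (g : H) : rootCharacter hε H z g =
    ε ^ (Multiplicative.toAdd ((g : Multiplicative (ZMod p)) ^ z)).val := rfl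

theorem rootCharacter_add (z w : ℤ) (g : H) :
    rootCharacter hε H (z + w) g = rootCharacter hε H z g * rootCharacter hε H w g := by
  have h := (AddChar.zmodChar p hε).toMonoidHom.map_mul
    ((g : Multiplicative (ZMod p)) ^ z) ((g : Multiplicative (ZMod p)) ^ w)
  rw [← zpow_add] at h
  exact h

theorem rootCharacter_zero (g : H) : rootCharacter hε H 0 g = 1 := by
  rw [rootCharacter_apply]; simp

theorem rootCharacter_sum {ι : Type*} (s : Finset ι) (z : ι → ℤ) (g : H) :
    rootCharacter hε H (∑ α ∈ s, z α) g = ∏ α ∈ s, rootCharacter hε H (z α) g := by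
  classical
  induction s using Finset.induction_on with
  | empty => rw [Finset.sum_empty, Finset.prod_empty, rootCharacter_zero]
  | insert a s ha ih => rw [Finset.sum_insert ha, Finset.prod_insert ha, rootCharacter_add, ih]

theorem rootCharacter_natCast (l : ℕ) (g : H) :
    rootCharacter hε H l g = rootCharacter hε H 1 g ^ l := by
  induction l with
  | zero => rw [Nat.cast_zero, rootCharacter_zero, pow_zero]
  | succ l ih => rw [Nat.cast_succ, rootCharacter_add, ih, pow_succ]

theorem rootCharacter_algebraMap {S : Type*} [CommRing S] [Algebra R S]
    (hε' : algebraMap R S ε ^ p = 1) (z : ℤ) (g : H) :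
    rootCharacter hε' H z g = algebraMap R S (rootCharacter hε H z g) := by
  rw [rootCharacter_apply, rootCharacter_apply, map_pow]

variable {hε} in
theorem rootCharacter_apply_eq_iff (hp : IsPrimitiveRoot ε p) (z w : ℤ) (g : H) :
    rootCharacter hε H z g = rootCharacter hε H w g ↔ g ^ z = g ^ w := by
  refine ⟨fun h => ?_, fun h => ?_⟩
  · rw [rootCharacter_apply, rootCharacter_apply] at h
    have h1 := ZMod.val_injective p (hp.pow_inj (ZMod.val_lt _) (ZMod.val_lt _) h)
    exact Subtype.ext (by simpa using Multiplicative.toAdd.injective h1)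
  · rw [rootCharacter_apply, rootCharacter_apply, ← Subgroup.coe_zpow, h, Subgroup.coe_zpow]

variable {hε} in
-- `H` is cyclic, so comparing at a generator suffices. This is the source of the congruence modulo
-- `d₀`.
theorem rootCharacter_eq_iff (hp : IsPrimitiveRoot ε p) (z w : ℤ) :
    rootCharacter hε H z = rootCharacter hε H w ↔ z ≡ w [ZMOD (Nat.card H : ℕ)] := by
  rw [DFunLike.ext_iff]
  simp only [rootCharacter_apply_eq_iff H hp]
  refine ⟨fun h => ?_, fun h g => ?_⟩
  · obtain ⟨g, hg⟩ := IsCyclic.exists_ofOrder_eq_natCard (α := H)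
    rw [← hg]
    exact zpow_eq_zpow_iff_modEq.1 (h g)
  · exact zpow_eq_zpow_iff_modEq.2
      (h.of_dvd (Int.natCast_dvd_natCast.2 (orderOf_dvd_natCard g)))

variable {hε} in
-- The dual orthogonality relation: a geometric sum of the powers of a `|H|`-th root of unity, which
-- differs from `1` when `g ≠ 1`.
theorem sum_rootCharacter [IsDomain R] (hp : IsPrimitiveRoot ε p) (g : H) :
    ∑ l : Fin (Nat.card H), rootCharacter hε H (l : ℕ) g =
      if g = 1 then (Nat.card H : R) else 0 := by
  simp only [rootCharacter_natCast]
  split_ifs with h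
  · subst h; simp
  · have h1 : rootCharacter hε H 1 g ≠ 1 := fun h1 => h (by
      have h2 := (rootCharacter_apply_eq_iff (hε := hε) H hp 1 0 g).1
        (by rw [h1, rootCharacter_zero])
      simpa using h2)
    have h2 : rootCharacter hε H 1 g ^ Nat.card H = 1 := by
      rw [← map_pow, pow_card_eq_one', map_one]
    rw [Fin.sum_univ_eq_sum_range fun l => rootCharacter hε H 1 g ^ l]
    have h3 := mul_geom_sum (rootCharacter hε H 1 g) (Nat.card H)
    rw [h2, sub_self] at h3
    exact (mul_eq_zero.1 h3).resolve_left (sub_ne_zero.2 h1)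

end CommRing

/-- `rootCharacter` puts the integer exponent on `g`, which makes sense over `O` and commutes with
base change; over a field this agrees with the scalars in `extensionGroupHom`. -/
theorem rootCharacter_eq_zpow {R : Type*} [Field R] {ε : R} (hε : ε ^ p = 1)
    (H : Subgroup (Multiplicative (ZMod p))) (z : ℤ) (g : H) :
    rootCharacter hε H z g =
      ε ^ (((Multiplicative.toAdd (g : Multiplicative (ZMod p))).val : ℤ) * z) := by
  rw [zpow_mul, zpow_natCast]
  exact AddChar.map_zsmul_eq_zpow (AddChar.zmodChar p hε) z
    (Multiplicative.toAdd (g : Multiplicative (ZMod p)))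

end Characters

/-! ### The modules `L_{h,i}` as twisted extensions -/

section Extension

variable {p : ℕ} [NeZero p] {R A V : Type*} [Field R] [Ring A] [Algebra R A] [AddCommGroup V]
  [Module R V] {Θ : Multiplicative (ZMod p) →* (A ≃ₐ[R] A)} {ρ : A →ₐ[R] Module.End R V} {ε : R}
  {H : Subgroup (Multiplicative (ZMod p))}

/-- The action of `H` on `L_{h,0}`. -/
def inertiaHom (hε : ε ^ p = 1) (φ : InertiaIso Θ ρ) (hH : H ≤ inertiaGroup Θ ρ) :
    H →* Module.End R V :=
  (extensionGroupHom hε φ 0).comp (Subgroup.inclusion hH)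

theorem inertiaHom_apply (hε : ε ^ p = 1) (φ : InertiaIso Θ ρ) (hH : H ≤ inertiaGroup Θ ρ)
    (g : H) (v : V) : inertiaHom hε φ hH g v =
      (φ.φ ^ ((Multiplicative.toAdd (g : Multiplicative (ZMod p))).val /
        (p / Nat.card (inertiaGroup Θ ρ)))) v := by
  have h : ε ^ (((Multiplicative.toAdd (g : Multiplicative (ZMod p))).val : ℤ) * 0) = 1 := by simp
  change (ε ^ (((Multiplicative.toAdd (g : Multiplicative (ZMod p))).val : ℤ) * 0) • _ :
    Module.End R V) v = _
  rw [h, one_smul]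
  rfl

theorem isTwistedExtension_extension (hε : ε ^ p = 1) (φ : InertiaIso Θ ρ)
    (hH : H ≤ inertiaGroup Θ ρ) (i : ℤ) :
    IsTwistedExtension (CrossedProduct.system Θ H) ρ (inertiaHom hε φ hH)
      (rootCharacter hε H i) ((extension hε φ i).comp (CrossedProduct.inclusion hH)) := by
  intro g a
  rw [CrossedProduct.system_of, AlgHom.comp_apply, CrossedProduct.inclusion_of, extension,
    CrossedProduct.lift_of, rootCharacter_eq_zpow, ← mul_smul_comm]
  congr 1
  refine LinearMap.ext fun v => ?_
  rw [LinearMap.smul_apply, inertiaHom_apply]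
  rfl

/-- Covariance is read off from the module `L_{h,0}` by applying its action to the relation `g a =
Θ_g(a) g`. -/
theorem inertiaHom_mul (hε : ε ^ p = 1) (φ : InertiaIso Θ ρ)
    (hH : H ≤ inertiaGroup Θ ρ) (g : H) (a : A) :
    inertiaHom hε φ hH g * ρ a = ρ (Θ g a) * inertiaHom hε φ hH g := by
  set c := CrossedProduct.system Θ H
  have h := isTwistedExtension_extension hε φ hH 0
  have h1 : ∀ g a, ((extension hε φ 0).comp (CrossedProduct.inclusion hH)) (c.of g a) =
      ρ a * inertiaHom hε φ hH g := fun g a => by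
    rw [h, rootCharacter_zero, one_smul]
  have h2 : c.of g 1 * c.of 1 a = c.of 1 (Θ g a) * c.of g 1 := by
    rw [c.of_mul_of, c.of_mul_of]; simp
  have h3 := congrArg ((extension hε φ 0).comp (CrossedProduct.inclusion hH)) h2
  rw [map_mul, map_mul, h1, h1, h1, map_one, map_one, mul_one, mul_one, one_mul] at h3
  exact h3

end Extension

/-! ### The inertia action on an outer tensor product -/

section TensorExtension

variable {p : ℕ} [NeZero p] {O R : Type*} [CommRing O] [Field R] [Algebra O R] {ι : Type*}
  [Finite ι] {A : ι → Type*} [∀ α, Ring (A α)] [∀ α, Algebra O (A α)]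
  {V : ι → Type*} [∀ α, AddCommGroup (V α)] [∀ α, Module R (V α)]
  {Θ : ∀ α, Multiplicative (ZMod p) →* (A α ≃ₐ[O] A α)}
  {ρ : ∀ α, (R ⊗[O] A α) →ₐ[R] Module.End R (V α)} {ε : R}
  {H : Subgroup (Multiplicative (ZMod p))}

/-- A comparison of exponents. With `s = |G_L|`, `|G_{L⁽ᵅ⁾}| = s t` and `p = s t k`, an element of
`H` is `θ^n` with `n = t k x`. It acts on the tensor product by the power `x` of `⨂ φ_α^t`, and on
the factor by `φ_α^(n / k) = φ_α^(t x)`. -/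
theorem inertiaHom_tensorInertiaIso (hε : ε ^ p = 1) (hρ : ∀ α, IsIrreducible (ρ α))
    (φ : ∀ α, InertiaIso (baseAction R (Θ α)) (ρ α))
    (hH : H ≤ inertiaGroup (baseAction R (diagonalAction Θ)) (tensorModule ρ)) :
    inertiaHom hε (tensorInertiaIso hρ φ) hH =
      tensorGroup fun α => inertiaHom hε (φ α) (hH.trans (inertiaGroup_tensorModule_le Θ hρ α)) := by
  refine MonoidHom.ext fun g => tprod_linear_ext fun v => ?_
  rw [inertiaHom_apply, tensorGroup_tprod]
  set s := Nat.card (inertiaGroup (baseAction R (diagonalAction Θ)) (tensorModule ρ)) with hs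
  have key : ∀ (χ : ∀ α, V α ≃ₗ[R] V α) (n : ℕ) (v : ∀ α, V α),
      ((PiTensorProduct.congr χ : (⨂[R] α, V α) ≃ₗ[R] (⨂[R] α, V α)) ^ n)
        (PiTensorProduct.tprod R v) = PiTensorProduct.tprod R fun α => (χ α ^ n) (v α) := by
    intro χ n
    induction n with
    | zero => intro v; simp
    | succ n ih =>
      intro v
      rw [pow_succ, LinearEquiv.mul_apply, PiTensorProduct.congr_tprod, ih]
      simp only [pow_succ, LinearEquiv.mul_apply]
  refine (key _ _ v).trans (congrArg _ (funext fun α => ?_))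
  rw [inertiaHom_apply, ← pow_mul]
  congr 2
  obtain ⟨x, hx⟩ := div_card_dvd_val _ (Subgroup.inclusion hH g)
  obtain ⟨k, hk⟩ := card_subgroup_dvd (inertiaGroup (baseAction R (Θ α)) (ρ α))
  obtain ⟨t, ht⟩ := Subgroup.card_dvd_of_le (inertiaGroup_tensorModule_le Θ hρ α)
  rw [← hs] at ht hx
  rw [Subgroup.coe_inclusion] at hx
  have hp : 0 < p := Nat.pos_of_ne_zero (NeZero.ne p)
  have hspos : 0 < s := Nat.card_pos
  have hk' : p = s * (t * k) := by rw [← mul_assoc, ← ht, ← hk]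
  have htk : 0 < t * k := Nat.pos_of_ne_zero (by intro h; rw [h] at hk'; omega)
  have h1 : p / s = t * k := Nat.div_eq_of_eq_mul_right hspos hk'
  have h2 : p / Nat.card (inertiaGroup (baseAction R (Θ α)) (ρ α)) = k :=
    Nat.div_eq_of_eq_mul_right Nat.card_pos hk
  rw [h1] at hx
  rw [hx, h1, h2, ht, Nat.mul_div_cancel_left _ hspos, Nat.mul_div_cancel_left _ htk,
    mul_comm t k, mul_assoc, Nat.mul_div_cancel_left _ (Nat.pos_of_mul_pos_left htk)]

end TensorExtension

/-! ### Independence of the lattice -/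

section Lattice

variable {O : Type*} [CommRing O] {A : Type*} [Ring A] [Algebra O A] {G : Type*} [Group G]
  {Θ : G →* (A ≃ₐ[O] A)} {H : Subgroup G}

theorem baseModule_system_of (R : Type*) [CommRing R] [Algebra O R] {P : Type*} [AddCommGroup P]
    [Module O P] (τ : CrossedProduct Θ H →ₐ[O] Module.End O P) (a : A) (g : H) :
    baseModule R τ ((CrossedProduct.system (baseAction R Θ) H).of g (1 ⊗ₜ a)) =
      (τ (.of a g)).baseChange R := by
  refine LinearMap.ext fun x => ?_
  induction x using TensorProduct.induction_on with
  | zero => rw [map_zero, map_zero]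
  | add x y hx hy => rw [map_add, map_add, hx, hy]
  | tmul r x =>
    rw [CrossedProduct.system_of, baseModule_of, one_mul, LinearMap.baseChange_tmul]

/-- The order of quantifiers matters: one lift `z` serves all lattices, so two lattices can be
compared through it. -/
theorem exists_baseModule_eq_baseChange {R : Type*} [CommRing R] [Algebra O R]
    (hR : Function.Surjective (algebraMap O R)) (x : CrossedProduct (baseAction R Θ) H) :
    ∃ z : CrossedProduct Θ H, ∀ (P : Type w) [AddCommGroup P] [Module O P]
      (τ : CrossedProduct Θ H →ₐ[O] Module.End O P),
      baseModule R τ x = (τ z).baseChange R := by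
  induction x using (CrossedProduct.system (baseAction R Θ) H).induction with
  | of g a =>
    obtain ⟨a, rfl⟩ := exists_eq_one_tmul hR a
    exact ⟨.of a g, fun P _ _ τ => baseModule_system_of R τ a g⟩
  | add x y hx hy =>
    obtain ⟨z, hz⟩ := hx
    obtain ⟨w, hw⟩ := hy
    exact ⟨z + w, fun P _ _ τ => by
      rw [map_add, hz, hw, map_add, LinearMap.baseChange_add]⟩

theorem exists_baseChange_eq_baseModule (R : Type*) [CommRing R] [Algebra O R]
    (z : CrossedProduct Θ H) :
    ∃ x : CrossedProduct (baseAction R Θ) H, ∀ (P : Type w) [AddCommGroup P] [Module O P]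
      (τ : CrossedProduct Θ H →ₐ[O] Module.End O P),
      baseModule R τ x = (τ z).baseChange R := by
  induction z using (CrossedProduct.system Θ H).induction with
  | of g a => exact ⟨_, fun P _ _ τ => baseModule_system_of R τ a g⟩
  | add x y hx hy =>
    obtain ⟨z, hz⟩ := hx
    obtain ⟨w, hw⟩ := hy
    exact ⟨z + w, fun P _ _ τ => by
      rw [map_add, hz, hw, map_add, LinearMap.baseChange_add]⟩

/-- The characteristic polynomials of the elements of the reduced algebra on the modular reduction
of a lattice do not depend on the lattice. -/
theorem charpoly_baseModule_eq {F K : Type*} [Field F] [Field K] [Algebra O F] [FaithfulSMul O F]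
    [Algebra O K] (hK : Function.Surjective (algebraMap O K)) {V : Type*} [AddCommGroup V]
    [Module F V] {M : CrossedProduct (baseAction F Θ) H →ₐ[F] Module.End F V}
    {P : Type w} [AddCommGroup P] [Module O P] [Module.Free O P] [Module.Finite O P]
    {τ : CrossedProduct Θ H →ₐ[O] Module.End O P}
    {ψ : (F ⊗[O] P) ≃ₗ[F] V} (hψ : IsModuleIso (baseModule F τ) M ψ)
    {P' : Type w} [AddCommGroup P'] [Module O P'] [Module.Free O P'] [Module.Finite O P']
    {τ' : CrossedProduct Θ H →ₐ[O] Module.End O P'}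
    {ψ' : (F ⊗[O] P') ≃ₗ[F] V} (hψ' : IsModuleIso (baseModule F τ') M ψ')
    (x : CrossedProduct (baseAction K Θ) H) :
    (baseModule K τ x).charpoly = (baseModule K τ' x).charpoly := by
  obtain ⟨z, hz⟩ := exists_baseModule_eq_baseChange.{w} hK x
  obtain ⟨y, hy⟩ := exists_baseChange_eq_baseModule.{w} F z
  have : FiniteDimensional F V := Module.Finite.equiv ψ
  -- Over `F` the characteristic polynomial of the lift depends only on `M`. As `O → F` is
  -- injective, it is already the same over `O` for both lattices, hence also after reduction to
  -- `K`.
  have key : ∀ {P : Type w} [AddCommGroup P] [Module O P] [Module.Free O P] [Module.Finite O P]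
      {τ : CrossedProduct Θ H →ₐ[O] Module.End O P} {ψ : (F ⊗[O] P) ≃ₗ[F] V}
      (_ : IsModuleIso (baseModule F τ) M ψ),
      (τ z).charpoly.map (algebraMap O F) = (M y).charpoly := fun {P} _ _ _ _ τ ψ hψ => by
    rw [← LinearMap.charpoly_baseChange, ← hy, ← LinearEquiv.charpoly_conj ψ]
    congr 1
    refine LinearMap.ext fun v => ?_
    rw [LinearEquiv.conj_apply_apply, hψ, LinearEquiv.apply_symm_apply]
  have h : (τ z).charpoly = (τ' z).charpoly :=
    Polynomial.map_injective _ (FaithfulSMul.algebraMap_injective O F) ((key hψ).trans (key hψ').symm)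
  rw [hz, hz, LinearMap.charpoly_baseChange, LinearMap.charpoly_baseChange, h]

end Lattice

/-! ### Tensor products of lattices -/

section TensorLattice

variable {O : Type*} [CommRing O] {ι : Type*}
  {A : ι → Type*} [∀ α, Ring (A α)] [∀ α, Algebra O (A α)] {p : ℕ}
  {Θ : ∀ α, Multiplicative (ZMod p) →* (A α ≃ₐ[O] A α)}
  {H : Subgroup (Multiplicative (ZMod p))}
  {P : ι → Type*} [∀ α, AddCommGroup (P α)] [∀ α, Module O (P α)]
  (τ : ∀ α, CrossedProduct (Θ α) H →ₐ[O] Module.End O (P α))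

/-- The action of `⨂ A⁽ᵅ⁾` on a tensor product of lattices. -/
def tensorLatticeAlg : (⨂[O] α, A α) →ₐ[O] Module.End O (⨂[O] α, P α) :=
  PiTensorProduct.liftAlgHom
    ((PiTensorProduct.mapMultilinear O P P).compLinearMap fun α =>
      ((τ α).comp (CrossedProduct.ofAlg (Θ α) H)).toLinearMap)
    (by
      refine Eq.trans ?_ PiTensorProduct.map_one
      exact congrArg PiTensorProduct.map (funext fun α =>
        map_one ((τ α).comp (CrossedProduct.ofAlg (Θ α) H))))
    (fun a b => by
      refine Eq.trans ?_ (PiTensorProduct.map_mul _ _)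
      exact congrArg PiTensorProduct.map (funext fun α =>
        map_mul ((τ α).comp (CrossedProduct.ofAlg (Θ α) H)) (a α) (b α)))

theorem tensorLatticeAlg_tprod (a : ∀ α, A α) :
    tensorLatticeAlg τ (PiTensorProduct.tprod O a) =
      PiTensorProduct.map fun α => τ α (CrossedProduct.ofAlg (Θ α) H (a α)) :=
  PiTensorProduct.lift.tprod _

/-- The twisted diagonal action of `H` on a tensor product of lattices. -/
def tensorLatticeGroup (χ : H →* O) : H →* Module.End O (⨂[O] α, P α) where
  toFun h := χ h • PiTensorProduct.map (R := O) (s := P) (t := P) fun α =>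
    τ α (CrossedProduct.ofGroup (Θ α) H h)
  map_one' := by
    simp only [map_one, one_smul]
    exact PiTensorProduct.map_one
  map_mul' g h := by
    simp only [map_mul]
    rw [smul_mul_smul_comm]
    congr 1
    exact PiTensorProduct.map_mul (fun α => τ α (CrossedProduct.ofGroup (Θ α) H g)) _

theorem tensorLatticeGroup_apply (χ : H →* O) (g : H) : tensorLatticeGroup τ χ g =
    χ g • PiTensorProduct.map fun α => τ α (CrossedProduct.ofGroup (Θ α) H g) := rfl

theorem tensorLatticeGroup_mul (χ : H →* O) (g : H) (x : ⨂[O] α, A α) :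
    tensorLatticeGroup τ χ g * tensorLatticeAlg τ x =
      tensorLatticeAlg τ (diagonalAction Θ g x) * tensorLatticeGroup τ χ g := by
  induction x using PiTensorProduct.induction_on with
  | add x y hx hy => rw [map_add, map_add, map_add, mul_add, add_mul, hx, hy]
  | smul_tprod r a =>
    rw [map_smul, map_smul, map_smul, mul_smul_comm, smul_mul_assoc]
    congr 1
    have h : diagonalAction Θ g (PiTensorProduct.tprod O a) =
        PiTensorProduct.tprod O fun α => Θ α g (a α) := tensorAlgHom_tprod _ _
    rw [h, tensorLatticeAlg_tprod, tensorLatticeAlg_tprod, tensorLatticeGroup_apply,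
      smul_mul_assoc, mul_smul_comm, ← PiTensorProduct.map_mul, ← PiTensorProduct.map_mul]
    congr 2
    funext α
    rw [← map_mul, ← map_mul, CrossedProduct.ofGroup_mul_ofAlg]

/-- The tensor product of lattices for the algebras `A⁽ᵅ⁾ ⋊ H`, twisted by a character of `H`. -/
def tensorLattice (χ : H →* O) :
    CrossedProduct (diagonalAction Θ) H →ₐ[O] Module.End O (⨂[O] α, P α) :=
  CrossedProduct.lift (tensorLatticeAlg τ) (tensorLatticeGroup τ χ) (tensorLatticeGroup_mul τ χ)

theorem tensorLattice_of (χ : H →* O) (a : ∀ α, A α) (g : H) :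
    tensorLattice τ χ (.of (PiTensorProduct.tprod O a) g) =
      χ g • PiTensorProduct.map fun α => τ α (.of (a α) g) := by
  rw [tensorLattice, CrossedProduct.lift_of, tensorLatticeAlg_tprod, tensorLatticeGroup_apply,
    mul_smul_comm, ← PiTensorProduct.map_mul]
  congr 2
  funext α
  rw [← map_mul]
  congr 1
  change (CrossedProduct.of _ _ * CrossedProduct.of _ _ : CrossedProduct (Θ α) H) = _
  rw [CrossedProduct.of_mul_of]
  simp

variable [Finite ι] [∀ α, Module.Free O (P α)]

/-- Used over `F` to identify the module of which the tensor product is a lattice, and over `K` to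
compute projectors on its reduction. -/
theorem baseChangePi_tensorLattice (R : Type*) [CommRing R] [Algebra O R] (χ : H →* O)
    (a : ∀ α, A α) (g : H) (x : R ⊗[O] (⨂[O] α, P α)) :
    baseChangePi R P (baseModule R (tensorLattice τ χ)
      ((CrossedProduct.system (baseAction R (diagonalAction Θ)) H).of g
        (1 ⊗ₜ PiTensorProduct.tprod O a)) x) =
    algebraMap O R (χ g) • PiTensorProduct.map (fun α => baseModule R (τ α)
      ((CrossedProduct.system (baseAction R (Θ α)) H).of g (1 ⊗ₜ a α))) (baseChangePi R P x) := by
  simp only [baseModule_system_of, tensorLattice_of]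
  induction x using TensorProduct.induction_on with
  | zero => simp only [map_zero, smul_zero]
  | add x y hx hy => rw [map_add, map_add, hx, hy, map_add, map_add, smul_add]
  | tmul r y =>
    induction y using PiTensorProduct.induction_on with
    | add x y hx hy =>
      rw [TensorProduct.tmul_add, map_add, map_add, hx, hy, map_add, map_add, smul_add]
    | smul_tprod s v =>
      have h1 : r ⊗ₜ[O] (s • PiTensorProduct.tprod O v) =
          (s • r) • ((1 : R) ⊗ₜ[O] PiTensorProduct.tprod O v) := by
        rw [← TensorProduct.smul_tmul, TensorProduct.smul_tmul', smul_eq_mul, mul_one]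
      have h2 : (1 : R) ⊗ₜ[O] (χ g • PiTensorProduct.tprod O fun α => τ α (.of (a α) g) (v α)) =
          algebraMap O R (χ g) • ((1 : R) ⊗ₜ[O]
            PiTensorProduct.tprod O fun α => τ α (.of (a α) g) (v α)) := by
        rw [TensorProduct.tmul_smul, algebraMap_smul]
      rw [h1, map_smul, map_smul, map_smul, map_smul, smul_comm (algebraMap O R (χ g))]
      congr 1
      rw [LinearMap.baseChange_tmul, LinearMap.smul_apply, PiTensorProduct.map_tprod, h2, map_smul,
        baseChangePi_tprod, baseChangePi_tprod, PiTensorProduct.map_tprod]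
      simp only [LinearMap.baseChange_tmul]

end TensorLattice

/-! ### Triangular bases of tensor products -/

section TensorTriangular

variable {K L ι : Type*} [Field K] [Fintype ι]
  {V : ι → Type*} [∀ α, AddCommGroup (V α)] [∀ α, Module K (V α)]

/-- Matrix entries of a tensor product are products of entries. A nonzero one forces the rank to
drop in every component where `i` and `j` differ, so the sum of the ranks drops as well. -/
theorem IsTriangular.repr_map {J : ι → Type*} {b : ∀ α, Module.Basis (J α) K (V α)}
    {r : ∀ α, J α → ℕ} {f : ∀ α, Module.End K (V α)} {t : ∀ α, J α → K}
    (h : ∀ α, IsTriangular (b α) (r α) (f α) (t α)) :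
    IsTriangular (Basis.piTensorProduct b) (fun j => ∑ α, r α (j α)) (PiTensorProduct.map f)
      fun j => ∏ α, t α (j α) := by
  have hrepr : ∀ i j, (Basis.piTensorProduct b).repr
      (PiTensorProduct.map f (Basis.piTensorProduct b j)) i =
        ∏ α, (b α).repr (f α (b α (j α))) (i α) := fun i j => by
    rw [Basis.piTensorProduct_apply, PiTensorProduct.map_tprod,
      Basis.piTensorProduct_repr_tprod_apply]
  refine ⟨fun i j hij hr => ?_, fun j => ?_⟩
  · rw [hrepr]
    by_contra h0
    rw [← ne_eq, Finset.prod_ne_zero_iff] at h0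
    have h1 : ∀ α, i α ≠ j α → r α (i α) < r α (j α) := fun α hα => by
      by_contra! hle
      exact h0 α (Finset.mem_univ α) ((h α).1 _ _ hα hle)
    obtain ⟨α, hα⟩ := Function.ne_iff.1 hij
    refine hr.not_gt (Finset.sum_lt_sum (fun β _ => ?_) ⟨α, Finset.mem_univ α, h1 α hα⟩)
    by_cases hβ : i β = j β
    · rw [hβ]
    · exact (h1 β hβ).le
  · rw [hrepr]
    exact Finset.prod_congr rfl fun α _ => (h α).2 (j α)

theorem IsTriangular.sum {E J M : Type*} [AddCommGroup E] [Module K E] {b : Module.Basis J K E}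
    {r : J → ℕ} (s : Finset M) {f : M → Module.End K E} {t : M → J → K}
    (h : ∀ m ∈ s, IsTriangular b r (f m) (t m)) :
    IsTriangular b r (∑ m ∈ s, f m) fun j => ∑ m ∈ s, t m j := by
  refine ⟨fun i j hij hr => ?_, fun j => ?_⟩
  · rw [LinearMap.sum_apply, map_sum, Finsupp.finsetSum_apply]
    exact Finset.sum_eq_zero fun m hm => (h m hm).1 i j hij hr
  · rw [LinearMap.sum_apply, map_sum, Finsupp.finsetSum_apply]
    exact Finset.sum_congr rfl fun m hm => (h m hm).2 j

/-- The operator of the tuple `l` has diagonal entry `1` at `j` exactly when the label of each `j α`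
is `l α`. A place `j` thus fits at most one tuple, the entries of the sum are again `0` or `1`, and
the places with entry `1` form a disjoint union of products. -/
theorem rootMultiplicity_sum_map [DecidableEq L] [∀ α, FiniteDimensional K (V α)]
    {x : ∀ α, L → Module.End K (V α)} {n : ι → L → ℕ} (h : ∀ α, HasTriangularBasis (x α) (n α))
    (s : Finset (ι → L)) :
    (∑ l ∈ s, PiTensorProduct.map fun α => x α (l α)).charpoly.rootMultiplicity 1 =
      ∑ l ∈ s, ∏ α, n α (l α) := by
  classical
  choose J hJ b r t htri hn using h
  have h1 := IsTriangular.sum s (fun l _ => IsTriangular.repr_map fun α => htri α (l α))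
  have hprod : ∀ (j : ∀ α, J α) (l : ι → L),
      ∏ α, (if t α (j α) = some (l α) then (1 : K) else 0) =
        if ∀ α, t α (j α) = some (l α) then 1 else 0 := fun j l => by
    rw [Fintype.prod_ite_zero]
    simp
  rw [h1.rootMultiplicity]
  simp only [hprod]
  have huniq : ∀ (j : ∀ α, J α) (l l' : ι → L), (∀ α, t α (j α) = some (l α)) →
      (∀ α, t α (j α) = some (l' α)) → l = l' := fun j l l' hl hl' =>
    funext fun α => Option.some.inj ((hl α).symm.trans (hl' α))
  have hfil : (Finset.univ.filter fun j : ∀ α, J α =>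
      ∑ l ∈ s, (if ∀ α, t α (j α) = some (l α) then (1 : K) else 0) = 1) =
      s.biUnion fun l => Fintype.piFinset fun α => Finset.univ.filter fun k => t α k = some (l α) := by
    ext j
    simp only [Finset.mem_filter, Finset.mem_univ, true_and, Finset.mem_biUnion,
      Fintype.mem_piFinset]
    constructor
    · intro hj
      obtain ⟨l, hl, hl'⟩ := Finset.exists_ne_zero_of_sum_ne_zero (hj.trans_ne one_ne_zero)
      exact ⟨l, hl, by simpa using hl'⟩
    · rintro ⟨l, hl, hl'⟩
      rw [Finset.sum_eq_single_of_mem l hl fun l' _ hne => if_neg fun h => hne (huniq j _ _ h hl'),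
        if_pos hl']
  rw [hfil, Finset.card_biUnion]
  · refine Finset.sum_congr rfl fun l _ => ?_
    rw [Fintype.card_piFinset]
    exact Finset.prod_congr rfl fun α _ => hn α (l α)
  · intro l _ l' _ hne
    rw [Function.onFun, Finset.disjoint_left]
    intro j hj hj'
    simp only [Fintype.mem_piFinset, Finset.mem_filter, Finset.mem_univ, true_and] at hj hj'
    exact hne (huniq j _ _ hj hj')

end TensorTriangular

/-! ### Modules of tensor lattices over the field of fractions -/

section TensorLatticeIso

variable {O F : Type*} [CommRing O] [Field F] [Algebra O F] {ι : Type*}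
  {A : ι → Type*} [∀ α, Ring (A α)] [∀ α, Algebra O (A α)] {p : ℕ}
  {Θ : ∀ α, Multiplicative (ZMod p) →* (A α ≃ₐ[O] A α)}
  {H : Subgroup (Multiplicative (ZMod p))}

theorem algHom_ext_tprod {B C : Type*} [Ring B] [Algebra F B] [Semiring C] [Algebra F C]
    (c : CrossedSystem (baseAction F (diagonalAction Θ)) H B) {f g : B →ₐ[F] C}
    (h : ∀ k a, f (c.of k (1 ⊗ₜ PiTensorProduct.tprod O a)) =
      g (c.of k (1 ⊗ₜ PiTensorProduct.tprod O a))) : f = g := by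
  refine c.algHom_ext fun k x => ?_
  induction x using TensorProduct.induction_on with
  | zero => simp only [map_zero]
  | add x y hx hy => simp only [map_add, hx, hy]
  | tmul r y =>
    induction y using PiTensorProduct.induction_on with
    | add x y hx hy => simp only [TensorProduct.tmul_add, map_add, hx, hy]
    | smul_tprod s a =>
      have h1 : r ⊗ₜ[O] (s • PiTensorProduct.tprod O a) =
          (s • r) • ((1 : F) ⊗ₜ[O] PiTensorProduct.tprod O a) := by
        rw [← TensorProduct.smul_tmul, TensorProduct.smul_tmul', smul_eq_mul, mul_one]
      rw [h1, ← c.smul_of, map_smul, map_smul, h]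

/-- Phrasing the isomorphism as an equality of algebra homomorphisms allows it to be checked on
generators. -/
theorem isModuleIso_of_conj {B V W : Type*} [Ring B] [Algebra F B] [AddCommGroup V] [Module F V]
    [AddCommGroup W] [Module F W] {M : B →ₐ[F] Module.End F V} {N : B →ₐ[F] Module.End F W}
    {ψ : V ≃ₗ[F] W} (h : (ψ.conjAlgEquiv F).toAlgHom.comp M = N) : IsModuleIso M N ψ := by
  subst h
  intro b v
  change _ = ψ (M b (ψ.symm (ψ v)))
  rw [LinearEquiv.symm_apply_apply]

variable [Finite ι] {P : ι → Type*} [∀ α, AddCommGroup (P α)] [∀ α, Module O (P α)]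
  [∀ α, Module.Free O (P α)]
  (τ : ∀ α, CrossedProduct (Θ α) H →ₐ[O] Module.End O (P α))
  {S : ι → Type*} [∀ α, AddCommGroup (S α)] [∀ α, Module F (S α)]

/-- The tensor product of twists by `χ` is the twist by a power of `χ`; the character `η` of the
lattice corrects it to `ξ`. -/
theorem isModuleIso_tensorLattice [Fintype ι]
    {σ : ∀ α, (F ⊗[O] A α) →ₐ[F] Module.End F (S α)} {T : ∀ α, H →* Module.End F (S α)}
    {χ ξ : H →* F} {η : H →* O} (hη : ∀ g, algebraMap O F (η g) * χ g ^ Fintype.card ι = ξ g)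
    {M : ∀ α, CrossedProduct (baseAction F (Θ α)) H →ₐ[F] Module.End F (S α)}
    (hM : ∀ α, IsTwistedExtension (CrossedProduct.system (baseAction F (Θ α)) H) (σ α) (T α) χ
      (M α))
    {N : CrossedProduct (baseAction F (diagonalAction Θ)) H →ₐ[F] Module.End F (⨂[F] α, S α)}
    (hN : IsTwistedExtension (CrossedProduct.system (baseAction F (diagonalAction Θ)) H)
      (tensorModule σ) (tensorGroup T) ξ N)
    {ψ : ∀ α, (F ⊗[O] P α) ≃ₗ[F] S α} (hψ : ∀ α, IsModuleIso (baseModule F (τ α)) (M α) (ψ α)) :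
    IsModuleIso (baseModule F (tensorLattice τ η)) N
      ((baseChangePi F P).trans (PiTensorProduct.congr ψ)) := by
  set Ψ := (baseChangePi F P).trans (PiTensorProduct.congr ψ) with hΨ
  have key : (Ψ.conjAlgEquiv F).toAlgHom.comp (baseModule F (tensorLattice τ η)) = N := by
    refine algHom_ext_tprod (CrossedProduct.system _ H) fun g a => ?_
    refine tprod_linear_ext fun s => ?_
    rw [hN, LinearMap.smul_apply, Module.End.mul_apply, tensorGroup_tprod, tensorModule_tprod,
      one_smul]
    change Ψ (baseModule F (tensorLattice τ η) _ (Ψ.symm (PiTensorProduct.tprod F s))) = _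
    have hs : baseChangePi F P (Ψ.symm (PiTensorProduct.tprod F s)) =
        PiTensorProduct.tprod F fun α => (ψ α).symm (s α) := by
      rw [hΨ, LinearEquiv.trans_symm, LinearEquiv.trans_apply, LinearEquiv.apply_symm_apply,
        PiTensorProduct.congr_symm_tprod]
    rw [hΨ, LinearEquiv.trans_apply, ← hΨ, baseChangePi_tensorLattice, hs,
      PiTensorProduct.map_tprod, map_smul, PiTensorProduct.congr_tprod]
    have h1 : ∀ α, ψ α (baseModule F (τ α)
        ((CrossedProduct.system (baseAction F (Θ α)) H).of g (1 ⊗ₜ a α)) ((ψ α).symm (s α))) =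
        χ g • σ α (1 ⊗ₜ a α) (T α g (s α)) := fun α => by
      rw [hψ, LinearEquiv.apply_symm_apply, hM]
      rfl
    simp only [h1]
    rw [MultilinearMap.map_smul_univ, smul_smul, Finset.prod_const, Finset.card_univ, hη]
  exact isModuleIso_of_conj key

end TensorLatticeIso

/-! ### Projectors on tensor lattices -/

theorem piTensorProduct_map_sum_smul {R ι L : Type*} [CommRing R] [Fintype ι] [DecidableEq ι]
    [Fintype L] {V : ι → Type*} [∀ α, AddCommGroup (V α)] [∀ α, Module R (V α)] (r : ι → L → R)
    (x : ∀ α, L → Module.End R (V α)) :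
    (PiTensorProduct.map fun α => ∑ l, r α l • x α l) =
      ∑ l : ι → L, (∏ α, r α (l α)) • PiTensorProduct.map fun α => x α (l α) := by
  refine ((PiTensorProduct.mapMultilinear R V V).map_sum fun α l => r α l • x α l).trans
    (Finset.sum_congr rfl fun l _ => ?_)
  exact MultilinearMap.map_smul_univ _ _ _

section Projector

variable {p : ℕ} [NeZero p] {K : Type*} [Field K] {ε : K}
  {H : Subgroup (Multiplicative (ZMod p))} [Fintype H]

/-- Fourier inversion. It is needed because the elements `u_k k`, unlike the projectors, act on
tensor products factor by factor. -/
theorem MatrixUnits.of_elem_eq_sum {A V B : Type*} [Ring A] [Algebra K A] [AddCommGroup V]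
    [Module K V] [Ring B] [Algebra K B] {Θ : Multiplicative (ZMod p) →* (A ≃ₐ[K] A)}
    {ρ : A →ₐ[K] Module.End K V} {T : H →* Module.End K V} {J : Ideal A}
    (u : MatrixUnits Θ H ρ T J) (c : CrossedSystem Θ H B) (hε : ε ^ p = 1)
    (hp : IsPrimitiveRoot ε p) {ν : K} (hν : ν * Nat.card H = 1) (k : H) :
    c.of k (u.elem k) = ∑ l : Fin (Nat.card H), rootCharacter hε H (l : ℕ) k •
      u.projector c ν (rootCharacter hε H (l : ℕ)) := by
  simp only [projector, Finset.smul_sum]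
  rw [Finset.sum_comm]
  have h : ∀ g : H, ∑ l : Fin (Nat.card H), rootCharacter hε H (l : ℕ) k •
      c.of g ((ν * rootCharacter hε H (l : ℕ) g⁻¹) • u.elem g) =
      if g = k then c.of k (u.elem k) else 0 := fun g => by
    have h1 : ∀ l : Fin (Nat.card H), rootCharacter hε H (l : ℕ) k •
        c.of g ((ν * rootCharacter hε H (l : ℕ) g⁻¹) • u.elem g) =
        (ν * rootCharacter hε H (l : ℕ) (k * g⁻¹)) • c.of g (u.elem g) := fun l => by
      rw [← c.smul_of, smul_smul, map_mul]
      congr 1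
      ring
    simp only [h1]
    rw [← Finset.sum_smul, ← Finset.mul_sum, sum_rootCharacter H hp]
    by_cases hg : g = k
    · subst hg
      rw [mul_inv_cancel, if_pos rfl, if_pos rfl, hν, one_smul]
    · rw [if_neg hg, if_neg fun h => hg (mul_inv_eq_one.1 h).symm, mul_zero, zero_smul]
  simp only [h]
  rw [Finset.sum_ite_eq' Finset.univ k, if_pos (Finset.mem_univ k)]

variable {O : Type*} [CommRing O] [Algebra O K] {ι : Type*} [Fintype ι] [DecidableEq ι]
  {A : ι → Type*} [∀ α, Ring (A α)] [∀ α, Algebra O (A α)] [∀ α, Module.Free O (A α)]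
  {Θ : ∀ α, Multiplicative (ZMod p) →* (A α ≃ₐ[O] A α)}
  {P : ι → Type*} [∀ α, AddCommGroup (P α)] [∀ α, Module O (P α)]
  [∀ α, Module.Free O (P α)]
  {V : ι → Type*} [∀ α, AddCommGroup (V α)] [∀ α, Module K (V α)]
  {ρ : ∀ α, (K ⊗[O] A α) →ₐ[K] Module.End K (V α)} {T : ∀ α, H →* Module.End K (V α)}
  {I : ∀ α, Ideal (K ⊗[O] A α)} {J : Ideal (K ⊗[O] (⨂[O] α, A α))}

/-- On the tensor lattice `u_k k` acts as `η(k)` times a tensor product. Expanding every factor by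
Fourier inversion and summing over `k` against the inverse of the character `j`, orthogonality
leaves the tuples with `c + ∑ l α ≡ j`. -/
theorem baseChangePi_tensorLattice_projector (hK : Function.Surjective (algebraMap O K))
    (u : ∀ α, MatrixUnits (baseAction K (Θ α)) H (ρ α) (T α) (I α))
    (U : MatrixUnits (baseAction K (diagonalAction Θ)) H (tensorModule ρ) (tensorGroup T) J)
    (hU : ∀ k, U.elem k = pureTensor fun α => (u α).elem k)
    (hε : ε ^ p = 1) (hp : IsPrimitiveRoot ε p) {ν : K} (hν : ν * Nat.card H = 1)
    {η : H →* O} {c : ℤ} (hη : ∀ g, algebraMap O K (η g) = rootCharacter hε H c g)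
    (τ : ∀ α, CrossedProduct (Θ α) H →ₐ[O] Module.End O (P α)) (j : ℤ)
    (w : K ⊗[O] (⨂[O] α, P α)) :
    baseChangePi K P (baseModule K (tensorLattice τ η)
      (U.projector (CrossedProduct.system _ H) ν (rootCharacter hε H j)) w) =
    (∑ l ∈ Finset.univ.filter fun l : ι → Fin (Nat.card H) =>
        j ≡ c + ∑ α, ((l α : ℕ) : ℤ) [ZMOD (Nat.card H : ℕ)],
      PiTensorProduct.map fun α => baseModule K (τ α) ((u α).projector
        (CrossedProduct.system _ H) ν (rootCharacter hε H ((l α : ℕ) : ℤ))))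
      (baseChangePi K P w) := by
  set x : ∀ α, Fin (Nat.card H) → Module.End K (K ⊗[O] P α) := fun α l =>
    baseModule K (τ α) ((u α).projector (CrossedProduct.system _ H) ν
      (rootCharacter hε H ((l : ℕ) : ℤ))) with hx
  have hterm : ∀ k : H, baseChangePi K P (baseModule K (tensorLattice τ η)
      ((CrossedProduct.system (baseAction K (diagonalAction Θ)) H).of k
        ((ν * rootCharacter hε H j k⁻¹) • U.elem k)) w) =
      ∑ l : ι → Fin (Nat.card H), (ν * rootCharacter hε H j k⁻¹ *
        rootCharacter hε H (c + ∑ α, ((l α : ℕ) : ℤ)) k) •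
          PiTensorProduct.map (fun α => x α (l α)) (baseChangePi K P w) := fun k => by
    obtain ⟨a, ha⟩ := exists_eq_one_tmul_pi hK fun α => (u α).elem k
    have h1 : ∀ α, baseModule K (τ α) ((CrossedProduct.system (baseAction K (Θ α)) H).of k
        (1 ⊗ₜ a α)) = ∑ l : Fin (Nat.card H), rootCharacter hε H ((l : ℕ) : ℤ) k • x α l := fun α => by
      have h2 : (1 : K) ⊗ₜ[O] a α = (u α).elem k := (congrFun ha α).symm
      rw [h2, (u α).of_elem_eq_sum _ hε hp hν, map_sum]
      simp only [map_smul, hx]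
    rw [← CrossedSystem.smul_of, map_smul, hU, ha, pureTensor_one_tmul, LinearMap.smul_apply,
      map_smul, baseChangePi_tensorLattice, hη]
    simp only [h1]
    rw [piTensorProduct_map_sum_smul, LinearMap.sum_apply, Finset.smul_sum, Finset.smul_sum]
    refine Finset.sum_congr rfl fun l _ => ?_
    rw [LinearMap.smul_apply, smul_smul, smul_smul, rootCharacter_add, rootCharacter_sum]
    congr 1
    ring
  rw [MatrixUnits.projector, map_sum, LinearMap.sum_apply, map_sum]
  simp only [hterm]
  rw [Finset.sum_comm, LinearMap.sum_apply, Finset.sum_filter]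
  refine Finset.sum_congr rfl fun l _ => ?_
  classical
  rw [← Finset.sum_smul, MatrixUnits.sum_char_inv_mul (by rwa [← Nat.card_eq_fintype_card]),
    ite_smul, one_smul, zero_smul]
  simp only [rootCharacter_eq_iff H hp, hx]

end Projector

/-! ### Decomposition numbers -/

section DecompositionNumber

variable {O : Type w} [CommRing O] {A : Type*} [Ring A] [Algebra O A] {G : Type*} [CommGroup G]
  {Θ : G →* (A ≃ₐ[O] A)} {H : Subgroup G} [Fintype H]

/-- A decomposition number, defined through some lattice, can be computed on any given one. -/
theorem MatrixUnits.isDecompositionNumber_iff {F K : Type*} [Field F] [Field K] [Algebra O F]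
    [FaithfulSMul O F] [Algebra O K] (hK : Function.Surjective (algebraMap O K)) {V W : Type*}
    [AddCommGroup V] [Module F V] [AddCommGroup W] [Module K W]
    {M : CrossedProduct (baseAction F Θ) H →ₐ[F] Module.End F V}
    {P : Type w} [AddCommGroup P] [Module O P] [Module.Free O P] [Module.Finite O P]
    {τ : CrossedProduct Θ H →ₐ[O] Module.End O P}
    {ψ : (F ⊗[O] P) ≃ₗ[F] V} (hψ : IsModuleIso (baseModule F τ) M ψ)
    {ρ : (K ⊗[O] A) →ₐ[K] Module.End K W} {T : H →* Module.End K W} {J : Ideal (K ⊗[O] A)}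
    (u : MatrixUnits (baseAction K Θ) H ρ T J)
    (hT : ∀ (g : H) a, T g * ρ a = ρ (baseAction K Θ g a) * T g)
    (hJ : ∀ x ∈ J, (CrossedProduct.system (baseAction K Θ) H).of 1 x ∈ Ring.jacobson _)
    {ν : K} (hν : ν * Fintype.card H = 1) {χ : H →* K}
    {D : CrossedProduct (baseAction K Θ) H →ₐ[K] Module.End K W}
    (hD : IsTwistedExtension (CrossedProduct.system _ H) ρ T χ D) {n : ℕ} :
    IsDecompositionNumber M D n ↔ n = (baseModule K τ
      (u.projector (CrossedProduct.system _ H) ν χ)).charpoly.rootMultiplicity 1 := by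
  rw [← u.hasMultiplicity_iff (CrossedProduct.system _ H) hT hJ hν hD]
  constructor
  · rintro ⟨P', _, _, τ', _, _, ⟨ψ', hψ'⟩, h⟩
    rw [u.hasMultiplicity_iff (CrossedProduct.system _ H) hT hJ hν hD] at h ⊢
    rw [h, charpoly_baseModule_eq hK hψ' hψ]
  · exact fun h => ⟨P, inferInstance, inferInstance, τ, inferInstance, inferInstance, ⟨ψ, hψ⟩, h⟩

end DecompositionNumber

theorem CrossedSystem.of_one_mem_jacobson {K A G B : Type*} [CommRing K] [Ring A] [Algebra K A]
    [IsArtinianRing A] [Group G] [Ring B] [Algebra K B] {Θ : G →* (A ≃ₐ[K] A)} {H : Subgroup G}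
    (c : CrossedSystem Θ H B) {a : A} (ha : a ∈ Ring.jacobson A) :
    c.of 1 a ∈ Ring.jacobson B :=
  c.of_mem_jacobson (AlgHom.id K A) (Θ' := Θ) (fun _ _ => rfl)
    (fun x => Submodule.subset_span ⟨x, 1, fun _ => Commute.one_right _, (mul_one _).symm⟩) ha

/-- `|H|` divides `p`, and `p` is nonzero in a field containing a primitive `p`-th root of unity. -/
theorem exists_mul_card_eq_one {p : ℕ} [NeZero p] {K : Type*} [Field K] {ε : K}
    (hε : IsPrimitiveRoot ε p) (H : Subgroup (Multiplicative (ZMod p))) :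
    ∃ ν : K, ν * Nat.card H = 1 := by
  have hp := hε.neZero'
  obtain ⟨k, hk⟩ := card_subgroup_dvd H
  refine ⟨(Nat.card H : K)⁻¹, inv_mul_cancel₀ fun h => hp.out ?_⟩
  have h1 := congrArg (Nat.cast : ℕ → K) hk
  rw [Nat.cast_mul, h, zero_mul] at h1
  exact h1

theorem charpoly_eq_of_forall {K E E' : Type*} [Field K] [AddCommGroup E] [Module K E]
    [FiniteDimensional K E] [AddCommGroup E'] [Module K E'] [FiniteDimensional K E']
    (e : E ≃ₗ[K] E') {f : Module.End K E} {g : Module.End K E'} (h : ∀ w, e (f w) = g (e w)) :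
    f.charpoly = g.charpoly := by
  rw [← LinearEquiv.charpoly_conj e]
  congr 1
  refine LinearMap.ext fun w => ?_
  rw [LinearEquiv.conj_apply_apply, h, LinearEquiv.apply_symm_apply]

end CliffordTensor

end

/-- The hypothesis on `m` allows a different lattice for every pair `(α, l)`. The equivalence for
all `n` says at once that the restriction of `S_{s,i}` has a lattice and that every lattice gives
the same number. -/
theorem mainTheorem5
    {O : Type*} {F : Type*} {K : Type*}
    [CommRing O] [IsDomain O] [ValuationRing O]
    [Field F] [IsAlgClosed F] [CharZero F] [Algebra O F] [FaithfulSMul O F]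
    [Field K] [IsAlgClosed K] [Algebra O K] (hK : Function.Surjective (algebraMap O K))
    {p : ℕ} [NeZero p] {ε : O} (hε : IsPrimitiveRoot ε p)
    (hεK : IsPrimitiveRoot (algebraMap O K ε) p)
    {κ : ℕ} (hκ : 1 ≤ κ)
    {A : Fin κ → Type*} [∀ α, Ring (A α)] [∀ α, Algebra O (A α)]
    [∀ α, Module.Free O (A α)] [∀ α, Module.Finite O (A α)]
    [IsSemisimpleRing (F ⊗[O] (⨂[O] α, A α))]
    (θ : ∀ α, A α ≃ₐ[O] A α) (hθ : ∀ α, θ α ^ p = 1)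
    {S : Fin κ → Type*} [∀ α, AddCommGroup (S α)] [∀ α, Module F (S α)]
    {σ : ∀ α, (F ⊗[O] A α) →ₐ[F] Module.End F (S α)}
    (hS : ∀ α, CliffordTensor.IsIrreducible (σ α))
    {D : Fin κ → Type*} [∀ α, AddCommGroup (D α)] [∀ α, Module K (D α)]
    {δ : ∀ α, (K ⊗[O] A α) →ₐ[K] Module.End K (D α)}
    (hD : ∀ α, CliffordTensor.IsIrreducible (δ α))
    (φS : ∀ α, CliffordTensor.InertiaIso
      (CliffordTensor.baseAction F (CliffordTensor.cyclicAction (θ α) (hθ α))) (σ α))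
    (φD : ∀ α, CliffordTensor.InertiaIso
      (CliffordTensor.baseAction K (CliffordTensor.cyclicAction (θ α) (hθ α))) (δ α)) :
    let Θ := fun α => CliffordTensor.cyclicAction (θ α) (hθ α)
    let G_S := CliffordTensor.inertiaGroup
      (CliffordTensor.baseAction F (CliffordTensor.diagonalAction Θ))
      (CliffordTensor.tensorModule σ)
    let G_D := CliffordTensor.inertiaGroup
      (CliffordTensor.baseAction K (CliffordTensor.diagonalAction Θ))
      (CliffordTensor.tensorModule δ)
    let G₀ : Subgroup (Multiplicative (ZMod p)) := G_S ⊓ G_D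
    ∀ (d₀ : ℕ), d₀ = Nat.card G₀ → ∀ (i j : ℤ) (m : Fin κ → Fin d₀ → ℕ),
      (∀ (α : Fin κ) (l : Fin d₀),
        CliffordTensor.IsDecompositionNumber (Θ := Θ α) (H := G₀)
          ((CliffordTensor.extension (CliffordTensor.algebraMap_pow_eq_one hε F) (φS α) i).comp (CliffordTensor.CrossedProduct.inclusion
            (inf_le_left.trans (CliffordTensor.inertiaGroup_tensorModule_le Θ hS α))))
          ((CliffordTensor.extension (CliffordTensor.algebraMap_pow_eq_one hε K) (φD α) (l : ℕ)).comp
            (CliffordTensor.CrossedProduct.inclusion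
              (inf_le_right.trans (CliffordTensor.inertiaGroup_tensorModule_le Θ hD α))))
          (m α l)) →
      ∀ n : ℕ,
        CliffordTensor.IsDecompositionNumber (Θ := CliffordTensor.diagonalAction Θ) (H := G₀)
          ((CliffordTensor.extension (CliffordTensor.algebraMap_pow_eq_one hε F) (CliffordTensor.tensorInertiaIso hS φS) i).comp
            (CliffordTensor.CrossedProduct.inclusion inf_le_left))
          ((CliffordTensor.extension (CliffordTensor.algebraMap_pow_eq_one hε K)
            (CliffordTensor.tensorInertiaIso hD φD) j).comp
            (CliffordTensor.CrossedProduct.inclusion inf_le_right))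
          n ↔
        n = ∑ l ∈ Finset.univ.filter (fun l : Fin κ → Fin d₀ =>
            (∑ α, ((l α : ℕ) : ℤ)) ≡ ((κ : ℤ) - 1) * i + j [ZMOD (d₀ : ℤ)]),
          ∏ α, m α (l α) := by
  open CliffordTensor in
  intro Θ G_S G_D G₀ d₀ hd i j m hm n
  subst hd
  have : Fintype G₀ := Fintype.ofFinite _
  have hεF' := algebraMap_pow_eq_one hε F
  have hεK' := algebraMap_pow_eq_one hε K
  have hleS : ∀ α, G₀ ≤ inertiaGroup (baseAction F (Θ α)) (σ α) := fun α =>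
    inf_le_left.trans (inertiaGroup_tensorModule_le Θ hS α)
  have hleD : ∀ α, G₀ ≤ inertiaGroup (baseAction K (Θ α)) (δ α) := fun α =>
    inf_le_right.trans (inertiaGroup_tensorModule_le Θ hD α)
  have hfin : ∀ α, FiniteDimensional K (D α) := fun α => (hD α).finiteDimensional
  have hart : ∀ α, IsArtinianRing (K ⊗[O] A α) := fun α => IsArtinianRing.of_finite K _
  obtain ⟨ν, hν⟩ := exists_mul_card_eq_one hεK G₀
  have hν' : ν * Fintype.card G₀ = 1 := by rwa [← Nat.card_eq_fintype_card]
  have hT := fun α => inertiaHom_mul hεK' (φD α) (hleD α)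
  have u := fun α => ((hD α).nonempty_matrixUnits (hT α)).some
  let c := CrossedProduct.system (baseAction K (diagonalAction Θ)) G₀
  -- The radical of each factor lands in the radical of the whole crossed product, so the tensor
  -- products of matrix units satisfy their relations modulo `c.radical`.
  have hJ : ∀ α, ∀ x ∈ Ring.jacobson (K ⊗[O] A α), factorHom O K A α x ∈ c.radical :=
    fun α x hx => c.of_mem_jacobson (factorHom O K A α)
      (fun g a => baseAction_factorHom hK Θ g α a) (mem_span_factorHom_mul hK α) hx
  let U := tensorMatrixUnits hK (fun α => (hD α).surjective) hJ u
  have hl0 : 0 < Nat.card G₀ := Nat.card_pos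
  -- The lattices supplied for `l = 0` are used for all `l`; since `d₀ > 0`, this index exists.
  -- Independence of the lattice then yields every `m α l` on the same `P α`.
  choose P iP iP' τ hfree hfinite ψ hmult using fun α => hm α ⟨0, hl0⟩
  choose ψ hψ using ψ
  have hroot : ∀ α l, m α l = (baseModule K (τ α) ((u α).projector
      (CrossedProduct.system _ G₀) ν (rootCharacter hεK' G₀ ((l : ℕ) : ℤ)))).charpoly.rootMultiplicity 1 :=
    fun α l => ((u α).isDecompositionNumber_iff hK (hψ α) (hT α)
      (fun x hx => CrossedSystem.of_one_mem_jacobson _ hx) hν'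
      (isTwistedExtension_extension hεK' (φD α) (hleD α) _)).1 (hm α l)
  have hinj : Function.Injective fun l : Fin (Nat.card G₀) =>
      rootCharacter hεK' G₀ ((l : ℕ) : ℤ) := fun l l' h => by
    have h1 := (rootCharacter_eq_iff G₀ hεK _ _).1 h
    exact Fin.ext ((Int.natCast_modEq_iff.1 h1).eq_of_lt_of_lt l.2 l'.2)
  have htri : ∀ α, HasTriangularBasis (fun l : Fin (Nat.card G₀) => baseModule K (τ α) ((u α).projector
      (CrossedProduct.system _ G₀) ν (rootCharacter hεK' G₀ ((l : ℕ) : ℤ)))) (m α) := fun α => by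
    obtain ⟨m', h1, -⟩ := (u α).exists_hasTriangularBasis (CrossedProduct.system _ G₀) (hT α)
      (fun x hx => CrossedSystem.of_one_mem_jacobson _ hx) hν' hinj
      (fun l => isTwistedExtension_extension hεK' (φD α) (hleD α) _) (baseModule K (τ α))
    have h2 : m α = m' := funext fun l => (hroot α l).trans (h1.rootMultiplicity l)
    rw [h2]
    exact h1
  -- The `κ` factors contribute `κ i` to the exponent of the character, and `S_{s,i}` requires `i`.
  let η := rootCharacter hε.pow_eq_one G₀ (-(((κ : ℤ) - 1) * i))
  have hηF : ∀ g, algebraMap O F (η g) * rootCharacter hεF' G₀ i g ^ Fintype.card (Fin κ) =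
      rootCharacter hεF' G₀ i g := fun g => by
    rw [← rootCharacter_algebraMap _ G₀ hεF', ← Finset.card_univ, ← Finset.prod_const, ← rootCharacter_sum,
      ← rootCharacter_add]
    congr 2
    simp
    ring
  have hNF : IsTwistedExtension (CrossedProduct.system _ G₀) (tensorModule σ)
      (tensorGroup fun α => inertiaHom hεF' (φS α) (hleS α)) (rootCharacter hεF' G₀ i)
      ((extension hεF' (tensorInertiaIso hS φS) i).comp
        (CrossedProduct.inclusion inf_le_left)) := by
    rw [← inertiaHom_tensorInertiaIso hεF' hS φS inf_le_left]
    exact isTwistedExtension_extension hεF' _ inf_le_left i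
  have hNK : IsTwistedExtension c (tensorModule δ)
      (tensorGroup fun α => inertiaHom hεK' (φD α) (hleD α)) (rootCharacter hεK' G₀ j)
      ((extension hεK' (tensorInertiaIso hD φD) j).comp
        (CrossedProduct.inclusion inf_le_right)) := by
    rw [← inertiaHom_tensorInertiaIso hεK' hD φD inf_le_right]
    exact isTwistedExtension_extension hεK' _ inf_le_right j
  have hψT := isModuleIso_tensorLattice τ hηF
    (fun α => isTwistedExtension_extension hεF' (φS α) (hleS α) i) hNF hψ
  have : Module.Free O (⨂[O] α, P α) := Module.Free.of_basis
    (Basis.piTensorProduct fun α => Module.Free.chooseBasis O (P α))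
  rw [U.isDecompositionNumber_iff hK hψT (tensorGroup_mul hK hT) (fun x hx => hx) hν' hNK]
  have hproj := baseChangePi_tensorLattice_projector hK u U (fun _ => rfl) hεK' hεK hν
    (η := η) (fun g => (rootCharacter_algebraMap _ G₀ hεK' _ g).symm) τ j
  have hchar := charpoly_eq_of_forall (E' := ⨂[K] α, (K ⊗[O] P α)) (baseChangePi K P) hproj
  rw [hchar, rootMultiplicity_sum_map htri]
  have hfilter : ∀ l : Fin κ → Fin (Nat.card G₀),
      j ≡ -(((κ : ℤ) - 1) * i) + ∑ α, ((l α : ℕ) : ℤ) [ZMOD (Nat.card G₀ : ℕ)] ↔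
      ∑ α, ((l α : ℕ) : ℤ) ≡ ((κ : ℤ) - 1) * i + j [ZMOD (Nat.card G₀ : ℕ)] := fun l => by
    rw [Int.modEq_comm, Int.modEq_iff_dvd, Int.modEq_iff_dvd]
    ring_nf
  simp only [hfilter]
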